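/- Notation and setting. For $0<a\le b$ let $\mathcal U_{(a,b)}$ be the set of $u:\mathbb R\to\mathbb R$ with $u(0)=0$, $u$ non-decreasing and $b$-Lipschitz, and $u(z)-u(z')\ge a(z-z')$ for all $z\ge z'\ge 0$. A distribution $P$ on $\mathbb R^d$ is $(L,R)$-well-behaved if for every subspace $V$ of dimension $k\in\{1,2\}$, identified with $\mathbb R^k$ by any orthonormal basis of $V$, the projection of $P$ onto $V$ has a density $\gamma_V$ with $\gamma_V(z)\ge L$ whenever $\|z\|_\infty\le R$ and $\gamma_V(z)\le \frac1L e^{-L\|z\|_2}$ for all $z$. Write $v^{\perp_w}=v-\frac{(v\cdot w)w}{\|w\|_2^2}$ for $w\neq 0$ and $v^{\perp_0}=v$. Let $a,L,R\in(0,1]$, $b\ge1$, $W\ge 1$, $\varepsilon,\delta>0$. Let $\mathcal D$ be a distribution of $(x,y)\in\mathbb R^d\times\mathbb R$ with $\mathbb E[y^2]<\infty$, whose $x$-marginal is $(L,R)$-well-behaved and satisfies $\mathbb E[xx^\top]\preccurlyeq I$. Let $$\mathrm{OPT}=\inf\{\mathbb E_{(x,y)\sim\mathcal D}[(u(w\cdot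 x)-y)^2] : \|w\|_2\le W,\ u\in\mathcal U_{(a,b)}\},$$ and let $(w^*,u^*)$ with $\|w^*\|_2\le W$, $u^*\in\mathcal U_{(a,b)}$ attain it. Initialization subroutine with step size $\eta$, $t_0$ iterations and batch size $m_0$: put $w^0=0$; for $t=0,\dots,t_0-1$ draw $m_0$ fresh i.i.d. samples $(x^{(i)},y^{(i)})$ from $\mathcal D$, take any $\hat u^t\in\operatorname{argmin}_{u\in\mathcal U_{(a,b)}}\frac1{m_0}\sum_{i=1}^{m_0}(u(w^t\cdot x^{(i)})-y^{(i)})^2$, and put $w^{t+1}=w^t-\eta\,\frac1{m_0}\sum_{i=1}^{m_0}(\hat u^t(w^t\cdot x^{(i)})-y^{(i)})x^{(i)}$; return the list $w^0,\dots,w^{t_0}$. Lemma (Initialization). There are absolute constants $C,C_1,C_2>0$ such that, in every such setting, with $\mu=Ca^2LR^4/b$, step size $\eta=\mu^3/(2^7b^4)$, any batch size $$m_0\ \ge\ C_1\,\frac{W^{9/2}\,b^{10}\,d\,\max\{1,\log(d/(\varepsilon\delta))\}^4}{L^4\mu^6\,\delta\,\varepsilon^{3/2}}$$ and $t_0=\lfloor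 C_2\,b^6\log(b/\mu)/\mu^6\rfloor$ iterations, the following holds with probability at least $1-\delta$ over the $t_0m_0$ samples: the subroutine can be run (all the minimizers exist), and, whichever minimizers are chosen, the list it returns contains a point $\bar w^0$ with $$\|(w^*)^{\perp_{\bar w^0}}\|_2\ \le\ \max\Big\{\frac{\mu\|w^*\|_2}{4b},\ \frac{64b^2}{\mu^3}\big(\sqrt{\mathrm{OPT}}+\sqrt{\varepsilon}\big)\Big\}.$$ -/

import Mathlib

open MeasureTheory
open scoped BigOperators

noncomputable section

namespace RobustSIM

/-- The Euclidean space `ℝ^d` with the `ℓ²` norm. -/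
abbrev Vec (d : ℕ) : Type := EuclideanSpace ℝ (Fin d)

/-- The `(L, R)`-well-behaved distributions on `ℝ^d`: for every subspace `V` of dimension `k`, where
`k` is `1` or `2`, identified with `ℝ^k` through an orthonormal basis `e` of `V`, the projection of
the distribution onto `V` has a density `γ` with respect to Lebesgue measure such that
`γ z ≥ L` whenever `‖z‖_∞ ≤ R`, and `γ z ≤ (1 / L) * exp (- L * ‖z‖₂)` for all `z`.
The norm of `Fin k → ℝ` is the sup norm. -/
def WellBehaved {d : ℕ} (L R : ℝ) (P : Measure (Vec d)) : Prop :=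
  ∀ k : ℕ, 1 ≤ k → k ≤ 2 → ∀ e : Fin k → Vec d, Orthonormal ℝ e →
    ∃ γ : (Fin k → ℝ) → ℝ, Measurable γ ∧
      P.map (fun x : Vec d => fun i : Fin k => (inner ℝ (e i) x : ℝ)) =
        (volume : Measure (Fin k → ℝ)).withDensity (fun z => ENNReal.ofReal (γ z)) ∧
      (∀ z : Fin k → ℝ, ‖z‖ ≤ R → L ≤ γ z) ∧
      (∀ z : Fin k → ℝ, γ z ≤ 1 / L * Real.exp (-L * Real.sqrt (∑ i, z i ^ 2)))

/-- The class `U_(a,b)` of `(a, b)`-unbounded activations. -/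
def Activations (a b : ℝ) : Set (ℝ → ℝ) :=
  {u | u 0 = 0 ∧ Monotone u ∧ (∀ z z' : ℝ, |u z - u z'| ≤ b * |z - z'|) ∧
    ∀ z z' : ℝ, 0 ≤ z' → z' ≤ z → a * (z - z') ≤ u z - u z'}

/-- The population squared loss `E_{(x,y) ∼ D} [(u (w ⬝ x) - y)²]`. -/
def sqLoss {d : ℕ} (D : Measure (Vec d × ℝ)) (w : Vec d) (u : ℝ → ℝ) : ℝ :=
  ∫ p, (u (inner ℝ w p.1) - p.2) ^ 2 ∂D

/-- The best squared loss over `‖w‖ ≤ W` and `u ∈ U_(a,b)`. -/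
def opt {d : ℕ} (D : Measure (Vec d × ℝ)) (a b W : ℝ) : ℝ :=
  sInf {ℓ : ℝ | ∃ (w : Vec d) (u : ℝ → ℝ), ‖w‖ ≤ W ∧ u ∈ Activations a b ∧ ℓ = sqLoss D w u}

/-- The component `v - ((v ⬝ w) / ‖w‖²) w` of `v` orthogonal to `w`; it is `v` for `w = 0`. -/
def perp {d : ℕ} (v w : Vec d) : Vec d :=
  v - ((inner ℝ v w : ℝ) / ‖w‖ ^ 2) • w

/-- The empirical squared loss of `u (w ⬝ x)` on the sample set `S`. -/
def empLoss {d m : ℕ} (S : Fin m → Vec d × ℝ) (w : Vec d) (u : ℝ → ℝ) : ℝ :=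
  1 / (m : ℝ) * ∑ i, (u (inner ℝ w (S i).1) - (S i).2) ^ 2

/-- `u` is a sample-optimal activation in `U_(a,b)` for the weight vector `w` and the sample
set `S`. -/
def IsEmpMinimizer {d m : ℕ} (a b : ℝ) (S : Fin m → Vec d × ℝ) (w : Vec d) (u : ℝ → ℝ) : Prop :=
  u ∈ Activations a b ∧ ∀ v ∈ Activations a b, empLoss S w u ≤ empLoss S w v

/-- The gradient `(1/m) ∑ᵢ (u (w ⬝ xᵢ) - yᵢ) xᵢ` of the empirical surrogate loss. -/
def empGrad {d m : ℕ} (S : Fin m → Vec d × ℝ) (w : Vec d) (u : ℝ → ℝ) : Vec d :=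
  (1 / (m : ℝ)) • ∑ i, (u (inner ℝ w (S i).1) - (S i).2) • (S i).1

/-- `w 0, …, w T` is the list returned by a run of the initialization subroutine with step size `η`
and `T` iterations, where iteration `t` uses the fresh batch `S t` of `m` samples. The argmin in an
iteration may be any minimizer. -/
def IsInitRun {d m T : ℕ} (a b η : ℝ) (S : Fin T → Fin m → Vec d × ℝ)
    (w : Fin (T + 1) → Vec d) : Prop :=
  w 0 = 0 ∧ ∀ t : Fin T, ∃ u : ℝ → ℝ, IsEmpMinimizer a b (S t) (w t.castSucc) u ∧
    w t.succ = w t.castSucc - η • empGrad (S t) (w t.castSucc) u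

/-- The law of `T` independent batches of `m` i.i.d. samples from `D` (`T * m` samples in all). -/
def batchLaw {d : ℕ} (D : Measure (Vec d × ℝ)) (T m : ℕ) :
    Measure (Fin T → Fin m → Vec d × ℝ) :=
  Measure.pi fun _ : Fin T => Measure.pi fun _ : Fin m => D

end RobustSIM

end

namespace RobustSIM

/-! Write `v`, `u` for the optimal weights and activation, and `τ` for the target accuracy. The
potential is `‖w - v‖ ^ 2`, equal to `‖v‖ ^ 2` at the start `w = 0`. From any fixed `w` with `‖w -
v‖ ≤ ‖v‖` and `τ < ‖perp v w‖`, a fresh batch makes the step lower the potential by `κ = μ ^ 6 /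
(128 * b ^ 6) * ‖v‖ ^ 2`, except with probability `δ / t` (`step_deviation`). Freshness allows a
union bound along the random trajectory (`measure_hitSet_le`), and `t * κ > ‖v‖ ^ 2`, so a run
without bad steps must meet an iterate with `‖perp v w‖ ≤ τ`: otherwise the potential would become
negative.

The decrease needs a lower bound on the correlation of the gradient with `w - v`, and an upper bound
on its norm. Let `us` be the empirical minimizer for the noiseless labels `u (v ⬝ x)` on the same
points. The residual of the true minimizer `uh` splits as `(uh - us)(w ⬝ x) + (us (w ⬝ x) - u (v ⬝
x)) - (y - u (v ⬝ x))` (`le_inner_gradAt`). The middle term carries the signal. Optimality of `us`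
against a perturbation built from the inverse of `u` bounds its correlation with `w - v` below by `1
/ b` times its empirical square (`IsEmpMinimizer.realizable_correlation`). That square is at least
of order `a ^ 2 * L * R ^ 4 * ‖perp v w‖ ^ 2`, since a function of `w ⬝ x` cannot follow `u (v ⬝ x)`
in the direction orthogonal to `w` (`sharpness_deviation`). The first term is small because the
variational inequalities of the two minimizers bound the empirical norm of `uh - us` by the
correlation of the noise with one Lipschitz function of `w ⬝ x` (`noise_lipschitz_deviation`). The
last is a linear noise correlation (`noise_correlation_deviation`).

Only the second moment of `y` is available, so concentration comes from truncation, Chebyshev and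
Markov. Uniformity over all Lipschitz functions needs no covering: such a function is an integral of
step functions weighted by its bounded derivative, so one Cauchy–Schwarz inequality treats them all
at once (`emp_lipschitz_deviation`).

The inverse of `u` need not exist, so `u` is replaced by a blend with the line of slope `b`, at an
additional loss of at most `ε` (`exists_strict_activation`). The random iteration is measurable, and
independent of the choice of minimizers, because minimizers agree at the sample points and their
values there are continuous in weights and samples (`continuous_gradAt`). -/

/-- The empirical mean of `f` over the sample set `S`. -/
noncomputable def emp {Ω : Type*} {m : ℕ} (S : Fin m → Ω) (f : Ω → ℝ) : ℝ :=
  1 / (m : ℝ) * ∑ i, f (S i)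

/-! ### Algebra of empirical means. -/

section Emp

variable {Ω : Type*} {m : ℕ} (S : Fin m → Ω)

lemma emp_add (f g : Ω → ℝ) : emp S (fun p => f p + g p) = emp S f + emp S g := by
  simp only [emp, Finset.sum_add_distrib, mul_add]

lemma emp_sub (f g : Ω → ℝ) : emp S (fun p => f p - g p) = emp S f - emp S g := by
  simp only [emp, Finset.sum_sub_distrib, mul_sub]

lemma emp_const_mul (c : ℝ) (f : Ω → ℝ) : emp S (fun p => c * f p) = c * emp S f := by
  simp only [emp, ← Finset.mul_sum]; ring

lemma emp_mono_on {f g : Ω → ℝ} (h : ∀ i, f (S i) ≤ g (S i)) : emp S f ≤ emp S g :=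
  mul_le_mul_of_nonneg_left (Finset.sum_le_sum fun i _ => h i) (by positivity)

lemma emp_mono {f g : Ω → ℝ} (h : ∀ p, f p ≤ g p) : emp S f ≤ emp S g :=
  emp_mono_on S fun _ => h _

lemma emp_nonneg {f : Ω → ℝ} (h : ∀ p, 0 ≤ f p) : 0 ≤ emp S f :=
  mul_nonneg (by positivity) (Finset.sum_nonneg fun i _ => h _)

lemma emp_mul_sq_le (f g : Ω → ℝ) :
    emp S (fun p => f p * g p) ^ 2 ≤ emp S (fun p => f p ^ 2) * emp S (fun p => g p ^ 2) := by
  have h := Finset.sum_mul_sq_le_sq_mul_sq Finset.univ (fun i => f (S i)) (fun i => g (S i))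
  have hm : (0 : ℝ) ≤ (1 / (m : ℝ)) ^ 2 := by positivity
  have := mul_le_mul_of_nonneg_left h hm
  simp only [emp]
  nlinarith [this]

lemma abs_emp_mul_le (f g : Ω → ℝ) :
    |emp S (fun p => f p * g p)| ≤
      Real.sqrt (emp S (fun p => f p ^ 2)) * Real.sqrt (emp S (fun p => g p ^ 2)) := by
  rw [← Real.sqrt_mul (emp_nonneg S fun p => sq_nonneg _)]
  exact Real.abs_le_sqrt (emp_mul_sq_le S f g)

end Emp

/-! ### The activation class: convexity and compactness. -/

section Activations

variable {a b : ℝ} {u v : ℝ → ℝ}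

lemma activation_abs_le (hu : u ∈ Activations a b) (z : ℝ) : |u z| ≤ b * |z| := by
  have := hu.2.2.1 z 0
  simpa [hu.1] using this

lemma activation_lipschitz (hb : 0 ≤ b) (hu : u ∈ Activations a b) :
    LipschitzWith (Real.toNNReal b) u :=
  LipschitzWith.of_dist_le_mul fun x y => by
    simpa [Real.dist_eq, Real.coe_toNNReal b hb] using hu.2.2.1 x y

lemma activation_upper (hu : u ∈ Activations a b) {z z' : ℝ} (h : z' ≤ z) :
    u z - u z' ≤ b * (z - z') := by
  have := hu.2.2.1 z z'
  rw [abs_of_nonneg (sub_nonneg.2 h)] at this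
  exact (le_abs_self _).trans this

lemma mem_activations_of (h0 : u 0 = 0) (hm : ∀ z z', z' ≤ z → 0 ≤ u z - u z')
    (hub : ∀ z z', z' ≤ z → u z - u z' ≤ b * (z - z'))
    (hlb : ∀ z z' : ℝ, 0 ≤ z' → z' ≤ z → a * (z - z') ≤ u z - u z') : u ∈ Activations a b := by
  refine ⟨h0, fun x y h => by linarith [hm y x h], fun z z' => ?_, hlb⟩
  rcases le_total z' z with h | h
  · rw [abs_of_nonneg (hm _ _ h), abs_of_nonneg (sub_nonneg.2 h)]; exact hub _ _ h
  · rw [abs_sub_comm, abs_sub_comm z, abs_of_nonneg (hm _ _ h), abs_of_nonneg (sub_nonneg.2 h)]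
    exact hub _ _ h

/-- The difference of two activations is `b`-Lipschitz. -/
lemma activation_abs_sub_sub_le (hu : u ∈ Activations a b) (hv : v ∈ Activations a b) (z z' : ℝ) :
    |(u z - v z) - (u z' - v z')| ≤ b * |z - z'| := by
  wlog h : z' ≤ z generalizing z z'
  · rw [abs_sub_comm, abs_sub_comm z]; exact this _ _ (le_of_not_ge h)
  have h1 := activation_upper hu h
  have h2 := activation_upper hv h
  have h3 := hu.2.1 h
  have h4 := hv.2.1 h
  rw [abs_of_nonneg (sub_nonneg.2 h), _root_.abs_le]
  constructor <;> linarith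

lemma activation_convex (hu : u ∈ Activations a b) (hv : v ∈ Activations a b) {l : ℝ}
    (hl : 0 ≤ l) (hl1 : l ≤ 1) : (fun z => u z + l * (v z - u z)) ∈ Activations a b := by
  have key : ∀ z z', (u z + l * (v z - u z)) - (u z' + l * (v z' - u z'))
      = (1 - l) * (u z - u z') + l * (v z - v z') := fun z z' => by ring
  have h1l : 0 ≤ 1 - l := by linarith
  refine mem_activations_of (by simp [hu.1, hv.1]) (fun z z' h => ?_) (fun z z' h => ?_)
    (fun z z' h0 h => ?_) <;> rw [key]
  · have := hu.2.1 h; have := hv.2.1 h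
    exact add_nonneg (mul_nonneg h1l (by linarith)) (mul_nonneg hl (by linarith))
  · nlinarith [mul_le_mul_of_nonneg_left (activation_upper hu h) h1l,
      mul_le_mul_of_nonneg_left (activation_upper hv h) hl]
  · nlinarith [mul_le_mul_of_nonneg_left (hu.2.2.2 z z' h0 h) h1l,
      mul_le_mul_of_nonneg_left (hv.2.2.2 z z' h0 h) hl]

lemma linear_mem_activations {c : ℝ} (hc : 0 ≤ c) (hac : a ≤ c) (hcb : c ≤ b) :
    (fun z => c * z) ∈ Activations a b := by
  refine mem_activations_of (by simp) (fun z z' h => ?_) (fun z z' h => ?_) (fun z z' h0 h => ?_)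
  all_goals
    rw [← mul_sub]
    have := sub_nonneg.2 h
    first | positivity | exact mul_le_mul_of_nonneg_right (by assumption) this

/-- The topology is that of pointwise convergence: every defining condition is closed and involves
at most two points, and the values at `z` lie in `[-b|z|, b|z|]`, so Tychonoff applies. -/
lemma isCompact_activations : IsCompact (Activations a b) := by
  have hsub : Activations a b ⊆ Set.pi Set.univ (fun z => Set.Icc (-(b * |z|)) (b * |z|)) :=
    fun u hu z _ => abs_le.1 (activation_abs_le hu z)
  refine (isCompact_univ_pi fun z => isCompact_Icc).of_isClosed_subset ?_ hsub
  have e : Activations a b = {u | u 0 = 0} ∩ ({u | Monotone u} ∩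
      ({u | ∀ z z' : ℝ, |u z - u z'| ≤ b * |z - z'|} ∩
      {u | ∀ z z' : ℝ, 0 ≤ z' → z' ≤ z → a * (z - z') ≤ u z - u z'})) := by
    ext u; rfl
  rw [e]
  refine IsClosed.inter (isClosed_eq (continuous_apply 0) continuous_const) (IsClosed.inter ?_
    (IsClosed.inter ?_ ?_))
  · simp only [Monotone, Set.ofPred_forall]
    exact isClosed_iInter fun x => isClosed_iInter fun y => isClosed_iInter fun _ =>
      isClosed_le (continuous_apply x) (continuous_apply y)
  · simp only [Set.ofPred_forall]
    exact isClosed_iInter fun x => isClosed_iInter fun y =>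
      isClosed_le ((continuous_apply x).sub (continuous_apply y)).abs continuous_const
  · simp only [Set.ofPred_forall]
    exact isClosed_iInter fun x => isClosed_iInter fun y => isClosed_iInter fun _ =>
      isClosed_iInter fun _ =>
      isClosed_le continuous_const ((continuous_apply x).sub (continuous_apply y))

end Activations

/-! ### Empirical minimizers: optimality, stability, and the noiseless correlation bound. -/

section Minimizer

variable {d m : ℕ} {a b : ℝ}

lemma empLoss_eq_emp (S : Fin m → Vec d × ℝ) (w : Vec d) (u : ℝ → ℝ) :
    empLoss S w u = emp S (fun p => (u (inner ℝ w p.1) - p.2) ^ 2) := rfl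

/-- The empirical loss reads `u` at finitely many points only, hence is continuous for pointwise
convergence and attains its minimum on the compact class. -/
lemma exists_isEmpMinimizer (ha : 0 < a) (hab : a ≤ b) (S : Fin m → Vec d × ℝ) (w : Vec d) :
    ∃ u, IsEmpMinimizer a b S w u := by
  have hc : Continuous (fun u : ℝ → ℝ => empLoss S w u) := by
    unfold empLoss
    exact continuous_const.mul (continuous_finsetSum _ fun i _ =>
      ((continuous_apply _).sub continuous_const).pow 2)
  obtain ⟨u, hu, hmin⟩ := isCompact_activations.exists_isMinOn
    ⟨_, linear_mem_activations ha.le le_rfl hab⟩ hc.continuousOn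
  exact ⟨u, hu, fun v hv => hmin hv⟩

/-- First-order optimality over the convex class. -/
lemma IsEmpMinimizer.variational {S : Fin m → Vec d × ℝ} {w : Vec d} {u v : ℝ → ℝ}
    (hu : IsEmpMinimizer a b S w u) (hv : v ∈ Activations a b) :
    emp S (fun p => (u (inner ℝ w p.1) - p.2) * (u (inner ℝ w p.1) - v (inner ℝ w p.1))) ≤ 0 := by
  set A := emp S (fun p => (u (inner ℝ w p.1) - p.2) * (u (inner ℝ w p.1) - v (inner ℝ w p.1)))
    with hA
  set B := emp S (fun p => (u (inner ℝ w p.1) - v (inner ℝ w p.1)) ^ 2) with hB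
  have hB0 : 0 ≤ B := emp_nonneg S fun p => sq_nonneg _
  -- Moving a fraction `l` from `u` towards `v` stays in the class; the change of loss is `l * (-2 *
  -- A + l * B)`.
  have key : ∀ l : ℝ, 0 < l → l ≤ 1 → 0 ≤ -2 * A + l * B := by
    intro l hl hl1
    have h := hu.2 _ (activation_convex hu.1 hv hl.le hl1)
    rw [empLoss_eq_emp, empLoss_eq_emp] at h
    have e : emp S (fun p => (u (inner ℝ w p.1) + l * (v (inner ℝ w p.1) - u (inner ℝ w p.1))
        - p.2) ^ 2) = emp S (fun p => (u (inner ℝ w p.1) - p.2) ^ 2) + l * (-2 * A + l * B) := by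
      rw [hA, hB, ← emp_const_mul, ← emp_const_mul, ← emp_add, ← emp_const_mul, ← emp_add]
      congr 1; ext p; ring
    rw [e] at h
    have : 0 ≤ l * (-2 * A + l * B) := by linarith
    exact nonneg_of_mul_nonneg_right this hl
  by_contra hcon
  push Not at hcon
  -- If `A` were positive, this `l` would make `l * B ≤ A < 2 * A`, a contradiction.
  have h1 := key (min 1 (A / (B + 1))) (by positivity) (min_le_left _ _)
  have h2 : min 1 (A / (B + 1)) * B ≤ A := by
    calc _ ≤ A / (B + 1) * B := mul_le_mul_of_nonneg_right (min_le_right _ _) hB0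
      _ = A * (B / (B + 1)) := by ring
      _ ≤ A * 1 := by
        refine mul_le_mul_of_nonneg_left ?_ hcon.le
        rw [div_le_one (by linarith)]; linarith
      _ = A := mul_one _
  linarith

/-- Stability of the minimizer in the weights and the samples. -/
lemma IsEmpMinimizer.stability {S S' : Fin m → Vec d × ℝ} {w w' : Vec d} {u u' : ℝ → ℝ}
    (hu : IsEmpMinimizer a b S w u) (hu' : IsEmpMinimizer a b S' w' u') :
    ∑ i, (u (inner ℝ w (S i).1) - u' (inner ℝ w' (S' i).1)) ^ 2 ≤
      ∑ i, ((S i).2 - (S' i).2) * (u (inner ℝ w (S i).1) - u' (inner ℝ w' (S' i).1)) +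
      ∑ i, (|u (inner ℝ w (S i).1) - (S i).2| + |u' (inner ℝ w' (S' i).1) - (S' i).2|) *
        (b * |(inner ℝ w (S i).1 : ℝ) - inner ℝ w' (S' i).1|) := by
  rcases Nat.eq_zero_or_pos m with rfl | hm
  · simp
  have hm' : (0 : ℝ) < 1 / (m : ℝ) := by positivity
  have h1 := hu.variational hu'.1
  have h2 := hu'.variational hu.1
  have h1' := nonpos_of_mul_nonpos_right h1 hm'
  have h2' := nonpos_of_mul_nonpos_right h2 hm'
  -- The last two products are the summands of the variational inequalities of each minimizer tested
  -- against the other; replacing `z` by `z'` in the arguments costs the Lipschitz terms.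
  have : ∀ i, (u (inner ℝ w (S i).1) - u' (inner ℝ w' (S' i).1)) ^ 2 ≤
      ((S i).2 - (S' i).2) * (u (inner ℝ w (S i).1) - u' (inner ℝ w' (S' i).1)) +
      (|u (inner ℝ w (S i).1) - (S i).2| + |u' (inner ℝ w' (S' i).1) - (S' i).2|) *
        (b * |(inner ℝ w (S i).1 : ℝ) - inner ℝ w' (S' i).1|) +
      ((u (inner ℝ w (S i).1) - (S i).2) * (u (inner ℝ w (S i).1) - u' (inner ℝ w (S i).1)) +
       (u' (inner ℝ w' (S' i).1) - (S' i).2) *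
        (u' (inner ℝ w' (S' i).1) - u (inner ℝ w' (S' i).1))) := by
    intro i
    set z : ℝ := inner ℝ w (S i).1
    set z' : ℝ := inner ℝ w' (S' i).1
    have e1 := hu'.1.2.2.1 z z'
    have e2 := hu.1.2.2.1 z z'
    have f1 := neg_abs_le ((u z - (S i).2) * (u' z' - u' z))
    have f2 := neg_abs_le ((u' z' - (S' i).2) * (u z - u z'))
    rw [abs_mul] at f1 f2
    rw [abs_sub_comm] at e1
    have g1 := mul_le_mul_of_nonneg_left e1 (abs_nonneg (u z - (S i).2))
    have g2 := mul_le_mul_of_nonneg_left e2 (abs_nonneg (u' z' - (S' i).2))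
    nlinarith
  have := Finset.sum_le_sum fun i (_ : i ∈ Finset.univ) => this i
  rw [Finset.sum_add_distrib, Finset.sum_add_distrib, Finset.sum_add_distrib] at this
  linarith

/-- Stability with identical data has right-hand side zero. The gradient therefore does not depend
on the minimizer chosen. -/
lemma IsEmpMinimizer.values_unique {S : Fin m → Vec d × ℝ} {w : Vec d} {u u' : ℝ → ℝ}
    (hu : IsEmpMinimizer a b S w u) (hu' : IsEmpMinimizer a b S w u') (i : Fin m) :
    u (inner ℝ w (S i).1) = u' (inner ℝ w (S i).1) := by
  have h := hu.stability hu'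
  simp only [sub_self, zero_mul, abs_zero, mul_zero, Finset.sum_const_zero, add_zero] at h
  have h2 := (Finset.sum_eq_zero_iff_of_nonneg (fun i _ => sq_nonneg _)).1
    (le_antisymm h (Finset.sum_nonneg fun i _ => sq_nonneg _)) i (Finset.mem_univ _)
  exact sub_eq_zero.1 (pow_eq_zero_iff two_ne_zero |>.1 h2)

/-- A choice of a sample-optimal activation. -/
noncomputable def minimizer (a b : ℝ) (q : Vec d × (Fin m → Vec d × ℝ)) : ℝ → ℝ :=
  open Classical in if h : ∃ u, IsEmpMinimizer a b q.2 q.1 u then h.choose else 0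

/-- The gradient step of the subroutine at `q = (w, S)`. -/
noncomputable def gradAt (a b : ℝ) (q : Vec d × (Fin m → Vec d × ℝ)) : Vec d :=
  empGrad q.2 q.1 (minimizer a b q)

lemma minimizer_spec (ha : 0 < a) (hab : a ≤ b) (q : Vec d × (Fin m → Vec d × ℝ)) :
    IsEmpMinimizer a b q.2 q.1 (minimizer a b q) := by
  have h := exists_isEmpMinimizer ha hab q.2 q.1
  rw [minimizer, dif_pos h]
  exact h.choose_spec

lemma IsEmpMinimizer.empGrad_eq (ha : 0 < a) (hab : a ≤ b) {S : Fin m → Vec d × ℝ} {w : Vec d}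
    {u : ℝ → ℝ} (hu : IsEmpMinimizer a b S w u) : empGrad S w u = gradAt a b (w, S) := by
  unfold gradAt empGrad
  congr 1
  refine Finset.sum_congr rfl fun i _ => ?_
  rw [hu.values_unique (minimizer_spec ha hab (w, S)) i]

/-- Although minimizers are picked by choice, stability controls their values at the sample points
by the change of the data; this is what makes the update map measurable. -/
lemma continuous_minimizer_value (ha : 0 < a) (hab : a ≤ b) (i : Fin m) :
    Continuous (fun q : Vec d × (Fin m → Vec d × ℝ) =>
      minimizer a b q (inner ℝ q.1 (q.2 i).1)) := by
  rw [continuous_iff_continuousAt]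
  intro q₀
  set u₀ := minimizer a b q₀ with hu₀
  have h₀ := minimizer_spec ha hab q₀
  have hz : ∀ j, Continuous (fun q : Vec d × (Fin m → Vec d × ℝ) =>
      (inner ℝ q.1 (q.2 j).1 : ℝ)) := fun j => by fun_prop
  have hy : ∀ j, Continuous (fun q : Vec d × (Fin m → Vec d × ℝ) => (q.2 j).2) :=
    fun j => by fun_prop
  -- The right-hand side of the stability estimate, with each minimizer replaced by its envelope `b
  -- * |z|`: it is visibly continuous in `q` and vanishes at `q₀`.
  let F : Vec d × (Fin m → Vec d × ℝ) → ℝ := fun q =>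
    ∑ j, |(q.2 j).2 - (q₀.2 j).2| * (b * |(inner ℝ q.1 (q.2 j).1 : ℝ)| +
        b * |(inner ℝ q₀.1 (q₀.2 j).1 : ℝ)|) +
      ∑ j, ((b * |(inner ℝ q.1 (q.2 j).1 : ℝ)| + |(q.2 j).2|) +
        (b * |(inner ℝ q₀.1 (q₀.2 j).1 : ℝ)| + |(q₀.2 j).2|)) *
        (b * |(inner ℝ q.1 (q.2 j).1 : ℝ) - inner ℝ q₀.1 (q₀.2 j).1|)
  have hF : Continuous F := by
    refine Continuous.add (continuous_finsetSum _ fun j _ => ?_)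
      (continuous_finsetSum _ fun j _ => ?_)
    · exact (((hy j).sub continuous_const).abs).mul
        ((continuous_const.mul (hz j).abs).add continuous_const)
    · exact (((continuous_const.mul (hz j).abs).add (hy j).abs).add continuous_const).mul
        (continuous_const.mul ((hz j).sub continuous_const).abs)
  have hF0 : F q₀ = 0 := by simp [F]
  have hbd : ∀ q : Vec d × (Fin m → Vec d × ℝ),
      (minimizer a b q (inner ℝ q.1 (q.2 i).1) - u₀ (inner ℝ q₀.1 (q₀.2 i).1)) ^ 2 ≤ F q := by
    intro q
    have hq := minimizer_spec ha hab q
    have h := hq.stability h₀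
    refine (Finset.single_le_sum (f := fun i => (minimizer a b q (inner ℝ q.1 (q.2 i).1) -
      u₀ (inner ℝ q₀.1 (q₀.2 i).1)) ^ 2) (fun i _ => sq_nonneg _) (Finset.mem_univ i)).trans
      (h.trans ?_)
    refine add_le_add (Finset.sum_le_sum fun j _ => ?_) (Finset.sum_le_sum fun j _ => ?_)
    · refine (le_abs_self _).trans ?_
      rw [abs_mul]
      refine mul_le_mul_of_nonneg_left ((abs_sub _ _).trans ?_) (abs_nonneg _)
      exact add_le_add (activation_abs_le hq.1 _) (activation_abs_le h₀.1 _)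
    · have hb : 0 ≤ b := by linarith
      refine mul_le_mul_of_nonneg_right (add_le_add ?_ ?_) (by positivity)
      · exact (abs_sub _ _).trans (add_le_add (activation_abs_le hq.1 _) le_rfl)
      · exact (abs_sub _ _).trans (add_le_add (activation_abs_le h₀.1 _) le_rfl)
  rw [ContinuousAt, tendsto_iff_dist_tendsto_zero]
  have hlim : Filter.Tendsto (fun q => Real.sqrt (F q)) (nhds q₀) (nhds 0) := by
    have := (Real.continuous_sqrt.comp hF).tendsto q₀
    simpa [Function.comp_def, hF0] using this
  refine squeeze_zero (fun q => dist_nonneg) (fun q => ?_) hlim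
  rw [Real.dist_eq]
  exact Real.abs_le_sqrt (hbd q)

lemma continuous_gradAt (ha : 0 < a) (hab : a ≤ b) :
    Continuous (gradAt (d := d) (m := m) a b) := by
  have key : Continuous (fun q : Vec d × (Fin m → Vec d × ℝ) => ∑ i,
      (minimizer a b q (inner ℝ q.1 (q.2 i).1) - (q.2 i).2) • (q.2 i).1) := by
    refine continuous_finsetSum _ fun i _ => ?_
    have hy : Continuous (fun q : Vec d × (Fin m → Vec d × ℝ) => (q.2 i).2) := by fun_prop
    have hx : Continuous (fun q : Vec d × (Fin m → Vec d × ℝ) => (q.2 i).1) := by fun_prop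
    exact ((continuous_minimizer_value ha hab i).sub hy).smul hx
  exact (continuous_const (y := 1 / (m : ℝ))).smul key

/-- For labels realized by a strictly monotone activation `v` in the class, the residual of the
sample-optimal activation is positively correlated with the error of the weights. -/
lemma IsEmpMinimizer.realizable_correlation (ha : 0 < a) (hb : 0 < b) {S : Fin m → Vec d × ℝ}
    {w w' : Vec d} {u v : ℝ → ℝ} (hu : IsEmpMinimizer a b S w u) (hv : v ∈ Activations a b)
    {r : ℝ} (hr : 0 < r) (hvr : ∀ z z', z' ≤ z → r * (z - z') ≤ v z - v z')
    (hS : ∀ i, (S i).2 = v (inner ℝ w' (S i).1)) :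
    1 / b * emp S (fun p => (u (inner ℝ w p.1) - p.2) ^ 2) ≤
      emp S (fun p => (u (inner ℝ w p.1) - p.2) * (inner ℝ w p.1 - inner ℝ w' p.1)) := by
  -- Slope at least `r > 0` makes `v` a bijection of the line; its inverse `f` has slopes in `[1 /
  -- b, 1 / r]`, and at most `1 / a` on the positive half-line.
  have hvc : Continuous v := (activation_lipschitz hb.le hv).continuous
  have hvs : Function.Surjective v := by
    refine hvc.surjective ?_ ?_
    · refine Filter.tendsto_atTop_mono' _ ?_ (Filter.tendsto_id.const_mul_atTop hr)
      filter_upwards [Filter.eventually_ge_atTop 0] with z hz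
      have := hvr z 0 hz
      simpa [hv.1] using this
    · refine Filter.tendsto_atBot_mono' _ ?_ (Filter.tendsto_id.const_mul_atBot hr)
      filter_upwards [Filter.eventually_le_atBot 0] with z hz
      have := hvr 0 z hz
      rw [hv.1] at this
      simp only [id]; linarith
  choose f hf using hvs
  have hvm : ∀ {s t : ℝ}, v s ≤ v t → s ≤ t := by
    intro s t hst
    by_contra hlt
    push Not at hlt
    have := hvr s t hlt.le
    have h0 : 0 < r * (s - t) := mul_pos hr (by linarith)
    linarith
  have hfm : ∀ {s t : ℝ}, s ≤ t → f s ≤ f t := fun h => hvm (by rwa [hf, hf])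
  have hf0 : f 0 = 0 := le_antisymm (hvm (by rw [hf, hv.1])) (hvm (by rw [hf, hv.1]))
  have hfl : ∀ {s t : ℝ}, s ≤ t → r * (f t - f s) ≤ t - s := fun {s t} h => by
    simpa [hf] using hvr _ _ (hfm h)
  have hfu : ∀ {s t : ℝ}, s ≤ t → t - s ≤ b * (f t - f s) := fun {s t} h => by
    simpa [hf] using activation_upper hv (hfm h)
  have hfa : ∀ {s t : ℝ}, 0 ≤ s → s ≤ t → a * (f t - f s) ≤ t - s := fun {s t} h0 h => by
    have := hv.2.2.2 _ _ (hf0 ▸ hfm h0) (hfm h)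
    simpa [hf] using this
  -- The three bounds on `l` serve the three constraints of the class below: `r` for monotonicity,
  -- `b` for the Lipschitz bound, `a` for the lower slope.
  set l := min (min a r) b with hl
  have hl0 : 0 < l := by positivity
  have hla : l ≤ a := (min_le_left _ _).trans (min_le_left _ _)
  have hlr : l ≤ r := (min_le_left _ _).trans (min_le_right _ _)
  have hlb : l ≤ b := min_le_right _ _
  -- The perturbation moves `u z` in the direction `z - f (u z)`. Testing optimality of `u` against
  -- it gives a nonnegative correlation of the residual with `w ⬝ x - f (u (w ⬝ x))`.
  have hmem : (fun z => u z + l * (z - f (u z))) ∈ Activations a b := by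
    refine mem_activations_of (by simp [hu.1.1, hf0]) (fun z z' h => ?_) (fun z z' h => ?_)
      (fun z z' h0 h => ?_)
    · have h1 := hfl (hu.1.2.1 h)
      have h2 : l * (f (u z) - f (u z')) ≤ r * (f (u z) - f (u z')) :=
        mul_le_mul_of_nonneg_right hlr (sub_nonneg.2 (hfm (hu.1.2.1 h)))
      have h3 := mul_nonneg hl0.le (sub_nonneg.2 h)
      linarith
    · have h1 := hfu (hu.1.2.1 h)
      have h2 := activation_upper hu.1 h
      have h3 : b * (u z - u z' + l * ((z - z') - (f (u z) - f (u z')))) ≤ b * (b * (z - z')) := by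
        nlinarith [mul_le_mul_of_nonneg_left h1 hl0.le,
          mul_le_mul_of_nonneg_left h2 (sub_nonneg.2 hlb)]
      have := le_of_mul_le_mul_left h3 hb
      linarith
    · have h1 := hfa (by simpa [hu.1.1] using hu.1.2.1 h0) (hu.1.2.1 h)
      have h2 := hu.1.2.2.2 z z' h0 h
      have h3 : a * (a * (z - z')) ≤ a * (u z - u z' + l * ((z - z') - (f (u z) - f (u z')))) := by
        nlinarith [mul_le_mul_of_nonneg_left h1 hl0.le,
          mul_le_mul_of_nonneg_left h2 (sub_nonneg.2 hla)]
      have := le_of_mul_le_mul_left h3 ha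
      linarith
  have hvi := hu.variational hmem
  have e1 : emp S (fun p => (u (inner ℝ w p.1) - p.2) * (u (inner ℝ w p.1) -
      (u (inner ℝ w p.1) + l * (inner ℝ w p.1 - f (u (inner ℝ w p.1))))))
      = -l * emp S (fun p => (u (inner ℝ w p.1) - p.2) *
        (inner ℝ w p.1 - f (u (inner ℝ w p.1)))) := by
    rw [← emp_const_mul]; congr 1; ext p; ring
  rw [e1] at hvi
  have hvi' : 0 ≤ emp S (fun p => (u (inner ℝ w p.1) - p.2) *
      (inner ℝ w p.1 - f (u (inner ℝ w p.1)))) := by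
    by_contra hcon
    push Not at hcon
    nlinarith
  have e2 : emp S (fun p => (u (inner ℝ w p.1) - p.2) * (inner ℝ w p.1 - inner ℝ w' p.1)) =
      emp S (fun p => (u (inner ℝ w p.1) - p.2) * (inner ℝ w p.1 - f (u (inner ℝ w p.1)))) +
      emp S (fun p => (u (inner ℝ w p.1) - p.2) * (f (u (inner ℝ w p.1)) - inner ℝ w' p.1)) := by
    rw [← emp_add]; congr 1; ext p; ring
  rw [e2, ← emp_const_mul]
  -- The remaining part of `w ⬝ x - w' ⬝ x` is `f (u (w ⬝ x)) - f (y)`, an increment of `f` over the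
  -- residual, and `f` has slope at least `1 / b`.
  have h3 : emp S (fun p => 1 / b * (u (inner ℝ w p.1) - p.2) ^ 2) ≤
      emp S (fun p => (u (inner ℝ w p.1) - p.2) * (f (u (inner ℝ w p.1)) - inner ℝ w' p.1)) := by
    refine emp_mono_on S fun i => ?_
    rw [hS i]
    set s := u (inner ℝ w (S i).1)
    set t : ℝ := inner ℝ w' (S i).1
    rw [div_mul_eq_mul_div, one_mul, div_le_iff₀ hb]
    have ht : f (v t) = t := le_antisymm (hvm (by rw [hf])) (hvm (by rw [hf]))
    rcases le_total s (v t) with h | h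
    · have := hfu h
      rw [ht] at this
      nlinarith
    · have := hfu h
      rw [ht] at this
      nlinarith
  linarith

end Minimizer


/-! ### Markov and Chebyshev for empirical means; uniform deviation over Lipschitz functions. -/

section Deviation

variable {Ω : Type*} [MeasurableSpace Ω]

/-- Markov's inequality in a form where the event `A` need not be measurable: only the dominating
`Φ` is. Events quantified over all Lipschitz functions are treated this way. -/
lemma measure_le_of_lintegral_le {Ω' : Type*} [MeasurableSpace Ω'] {P : Measure Ω'}
    {Φ : Ω' → ENNReal} (hΦ : AEMeasurable Φ P) {c p : ℝ} (hc : 0 < c)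
    (hI : ∫⁻ x, Φ x ∂P ≤ ENNReal.ofReal (c * p)) {A : Set Ω'}
    (hA : ∀ x ∈ A, ENNReal.ofReal c ≤ Φ x) : P A ≤ ENNReal.ofReal p := by
  have hc0 : ENNReal.ofReal c ≠ 0 := by simpa using hc
  refine (measure_mono (t := {x | ENNReal.ofReal c ≤ Φ x}) hA).trans
    ((meas_ge_le_lintegral_div hΦ hc0 ENNReal.ofReal_ne_top).trans ?_)
  refine ENNReal.div_le_of_le_mul (hI.trans ?_)
  rw [mul_comm, ENNReal.ofReal_mul' hc.le]

variable {P : Measure Ω} [IsProbabilityMeasure P] {m : ℕ}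

lemma integrable_emp {f : Ω → ℝ} (hf : Integrable f P) :
    Integrable (fun S : Fin m → Ω => emp S f) (Measure.pi fun _ : Fin m => P) :=
  (integrable_finsetSum _ fun _ _ => integrable_comp_eval (μ := fun _ : Fin m => P) hf).const_mul _

lemma integral_emp (hm : 0 < m) {f : Ω → ℝ} (hf : Integrable f P) :
    ∫ S : Fin m → Ω, emp S f ∂(Measure.pi fun _ : Fin m => P) = ∫ x, f x ∂P := by
  unfold emp
  rw [integral_const_mul, integral_finsetSum _ fun _ _ =>
    integrable_comp_eval (μ := fun _ : Fin m => P) hf]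
  have : ∀ i : Fin m, ∫ S : Fin m → Ω, f (S i) ∂(Measure.pi fun _ : Fin m => P) = ∫ x, f x ∂P :=
    fun i => integral_comp_eval (μ := fun _ : Fin m => P) hf.aestronglyMeasurable
  simp only [this, Finset.sum_const, Finset.card_univ, Fintype.card_fin, nsmul_eq_mul]
  field_simp

/-- Markov's inequality for empirical means. -/
lemma emp_markov {f : Ω → ℝ} (hf0 : ∀ x, 0 ≤ f x) (hf : Integrable f P) {c p : ℝ} (hc : 0 < c)
    (h : ∫ x, f x ∂P ≤ c * p) :
    (Measure.pi fun _ : Fin m => P) {S | c < emp S f} ≤ ENNReal.ofReal p := by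
  rcases Nat.eq_zero_or_pos m with rfl | hm
  · have : {S : Fin 0 → Ω | c < emp S f} = ∅ := by
      ext S; simp [emp, hc.le]
    rw [this]; simp
  refine measure_le_of_lintegral_le
    (Φ := fun S => ENNReal.ofReal (emp S f)) ?_ hc ?_ ?_
  · exact (integrable_emp hf).aestronglyMeasurable.aemeasurable.ennreal_ofReal
  · rw [← ofReal_integral_eq_lintegral_ofReal (integrable_emp hf)
      (Filter.Eventually.of_forall fun S => emp_nonneg S hf0), integral_emp hm hf]
    exact ENNReal.ofReal_le_ofReal h
  · exact fun S hS => ENNReal.ofReal_le_ofReal (le_of_lt hS)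

/-- Variances of independent samples add. The Lebesgue-integral form allows a later interchange with
the integral over thresholds by Tonelli. -/
lemma lintegral_emp_deviation_sq (hm : 0 < m) {f : Ω → ℝ} (hf : MemLp f 2 P) :
    ∫⁻ S : Fin m → Ω, ENNReal.ofReal ((emp S f - ∫ x, f x ∂P) ^ 2)
      ∂(Measure.pi fun _ : Fin m => P) ≤ ENNReal.ofReal ((∫ x, f x ^ 2 ∂P) / m) := by
  have hm' : (0 : ℝ) < m := by exact_mod_cast hm
  have hfi : Integrable f P := hf.integrable (by norm_num)
  have hL : MemLp (fun S : Fin m → Ω => emp S f) 2 (Measure.pi fun _ : Fin m => P) := by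
    have hs : MemLp (fun S : Fin m → Ω => ∑ i, f (S i)) 2 (Measure.pi fun _ : Fin m => P) :=
      memLp_finsetSum Finset.univ (f := fun i (S : Fin m → Ω) => f (S i)) fun i _ =>
        hf.comp_measurePreserving (measurePreserving_eval (fun _ : Fin m => P) i)
    exact hs.const_mul _
  have h1 := ProbabilityTheory.evariance_eq_lintegral_ofReal (fun S : Fin m → Ω => emp S f)
    (Measure.pi fun _ : Fin m => P)
  rw [integral_emp hm hfi] at h1
  rw [← h1, ← hL.ofReal_variance_eq]
  refine ENNReal.ofReal_le_ofReal ?_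
  have h2 := ProbabilityTheory.variance_sum_pi (μ := fun _ : Fin m => P) (X := fun _ => f)
    (fun _ => hf)
  have h3 : (fun S : Fin m → Ω => emp S f) =
      fun S => 1 / (m : ℝ) * (∑ i, fun S : Fin m → Ω => f (S i)) S := by
    ext S; simp [emp]
  rw [h3, ProbabilityTheory.variance_const_mul, h2]
  have h4 := ProbabilityTheory.variance_le_expectation_sq hf.aestronglyMeasurable
  simp only [Finset.sum_const, Finset.card_univ, Fintype.card_fin, nsmul_eq_mul]
  calc (1 / (m : ℝ)) ^ 2 * (m * ProbabilityTheory.variance f P)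
      = ProbabilityTheory.variance f P / m := by field_simp
    _ ≤ _ := div_le_div_of_nonneg_right (by simpa using h4) hm'.le

/-- Chebyshev's inequality for the empirical mean of a vector. -/
lemma emp_chebyshev_sum {ι : Type*} [Fintype ι] (hm : 0 < m) {F : ι → Ω → ℝ}
    (hF : ∀ j, MemLp (F j) 2 P)
    {c p : ℝ} (hc : 0 < c) (h : ∑ j, ∫ x, F j x ^ 2 ∂P ≤ c * (m * p)) :
    (Measure.pi fun _ : Fin m => P) {S | c < ∑ j, (emp S (F j) - ∫ x, F j x ∂P) ^ 2} ≤
      ENNReal.ofReal p := by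
  have hm' : (0 : ℝ) < m := by exact_mod_cast hm
  have hmeas : ∀ j, AEMeasurable (fun S : Fin m → Ω => ENNReal.ofReal
      ((emp S (F j) - ∫ x, F j x ∂P) ^ 2)) (Measure.pi fun _ : Fin m => P) := fun j =>
    (((integrable_emp ((hF j).integrable (by norm_num))).aestronglyMeasurable.aemeasurable).sub
      aemeasurable_const |>.pow_const 2).ennreal_ofReal
  refine measure_le_of_lintegral_le
    (Φ := fun S => ∑ j, ENNReal.ofReal ((emp S (F j) - ∫ x, F j x ∂P) ^ 2)) ?_ hc ?_ ?_
  · exact Finset.aemeasurable_fun_sum _ fun j _ => hmeas j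
  · rw [lintegral_finsetSum' _ fun j _ => hmeas j]
    calc _ ≤ ∑ j, ENNReal.ofReal ((∫ x, F j x ^ 2 ∂P) / m) :=
            Finset.sum_le_sum fun j _ => lintegral_emp_deviation_sq hm (hF j)
        _ = ENNReal.ofReal (∑ j, (∫ x, F j x ^ 2 ∂P) / m) := by
            rw [ENNReal.ofReal_sum_of_nonneg]
            exact fun j _ => div_nonneg (integral_nonneg fun x => sq_nonneg _) hm'.le
        _ ≤ _ := by
            refine ENNReal.ofReal_le_ofReal ?_
            rw [← Finset.sum_div, div_le_iff₀ hm']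
            linarith
  · intro S hS
    rw [← ENNReal.ofReal_sum_of_nonneg fun j _ => sq_nonneg _]
    exact ENNReal.ofReal_le_ofReal (le_of_lt hS)

/-- Chebyshev's inequality for empirical means. -/
lemma emp_chebyshev (hm : 0 < m) {f : Ω → ℝ} (hf : MemLp f 2 P) {c p : ℝ} (hc : 0 < c)
    (h : ∫ x, f x ^ 2 ∂P ≤ c ^ 2 * (m * p)) :
    (Measure.pi fun _ : Fin m => P) {S | c < |emp S f - ∫ x, f x ∂P|} ≤ ENNReal.ofReal p := by
  have := emp_chebyshev_sum (ι := Unit) hm (F := fun _ => f) (fun _ => hf) (c := c ^ 2)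
    (by positivity) (by simpa using h)
  refine (measure_mono ?_).trans this
  intro S hS
  simp only [Set.mem_ofPred_eq, Finset.univ_unique, Finset.sum_const, Finset.card_singleton,
    one_smul] at hS ⊢
  rw [← sq_abs (emp S f - _)]
  exact pow_lt_pow_left₀ hS hc.le two_ne_zero

/-- The kernel with `h z = ∫ h' s * stepKernel s z ds`. -/
noncomputable def stepKernel (s z : ℝ) : ℝ :=
  Set.indicator {q : ℝ × ℝ | 0 ≤ q.1 ∧ q.1 < q.2} 1 (s, z) -
    Set.indicator {q : ℝ × ℝ | q.2 ≤ q.1 ∧ q.1 < 0} 1 (s, z)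

lemma measurable_stepKernel : Measurable (fun q : ℝ × ℝ => stepKernel q.1 q.2) := by
  unfold stepKernel
  refine Measurable.sub (measurable_one.indicator ?_) (measurable_one.indicator ?_)
  · exact (measurableSet_le measurable_const measurable_fst).inter
      (measurableSet_lt measurable_fst measurable_snd)
  · exact (measurableSet_le measurable_snd measurable_fst).inter
      (measurableSet_lt measurable_fst measurable_const)

lemma abs_stepKernel_le (s z : ℝ) : |stepKernel s z| ≤ 1 := by
  unfold stepKernel
  simp only [Set.indicator, Set.mem_ofPred_eq, Pi.one_apply]
  split_ifs <;> simp

/-- The fundamental theorem of calculus for Lipschitz functions. As a function of `s`, the kernel is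
the signed indicator of the interval between `0` and `z`, so the range of integration no longer
depends on `z`. -/
lemma eq_integral_deriv_mul_stepKernel {h : ℝ → ℝ} {K : NNReal} (hh : LipschitzWith K h)
    (h0 : h 0 = 0) {T z : ℝ} (hz : |z| ≤ T) :
    h z = ∫ s in Set.Ico (-T) T, deriv h s * stepKernel s z := by
  obtain ⟨hz1, hz2⟩ := abs_le.1 hz
  have ftc : ∀ x y : ℝ, ∫ s in x..y, deriv h s = h y - h x := fun x y =>
    (hh.lipschitzOnWith.absolutelyContinuousOnInterval).integral_deriv_eq_sub
  rcases le_total 0 z with hp | hp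
  · have e : ∀ s, deriv h s * stepKernel s z = Set.indicator (Set.Ico 0 z) (deriv h) s := by
      intro s
      unfold stepKernel
      simp only [Set.indicator, Set.mem_ofPred_eq, Set.mem_Ico, Pi.one_apply]
      have : ¬ (z ≤ s ∧ s < 0) := fun hc => by linarith [hc.1, hc.2]
      rw [if_neg this]
      split_ifs <;> simp
    simp only [e]
    rw [setIntegral_indicator measurableSet_Ico,
      Set.inter_eq_right.2 (Set.Ico_subset_Ico (by linarith) hz2),
      integral_Ico_eq_integral_Ioc, ← intervalIntegral.integral_of_le hp, ftc, h0, sub_zero]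
  · have e : ∀ s, deriv h s * stepKernel s z = -Set.indicator (Set.Ico z 0) (deriv h) s := by
      intro s
      unfold stepKernel
      simp only [Set.indicator, Set.mem_ofPred_eq, Set.mem_Ico, Pi.one_apply]
      have : ¬ (0 ≤ s ∧ s < z) := fun hc => by linarith [hc.1, hc.2]
      rw [if_neg this]
      split_ifs <;> simp
    simp only [e]
    rw [integral_neg, setIntegral_indicator measurableSet_Ico,
      Set.inter_eq_right.2 (Set.Ico_subset_Ico hz1 (by linarith)),
      integral_Ico_eq_integral_Ioc, ← intervalIntegral.integral_of_le hp, ftc, h0]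
    ring

lemma lintegral_sq_le_measure_mul {α : Type*} [MeasurableSpace α] (ν : Measure α)
    {f : α → ENNReal} (hf : AEMeasurable f ν) :
    (∫⁻ x, f x ∂ν) ^ 2 ≤ ν Set.univ * ∫⁻ x, f x ^ 2 ∂ν := by
  have h := ENNReal.lintegral_mul_le_Lp_mul_Lq ν Real.HolderConjugate.two_two hf
    (aemeasurable_const (b := (1 : ENNReal)))
  simp only [Pi.mul_apply, mul_one, ENNReal.one_rpow, lintegral_const, one_mul] at h
  calc (∫⁻ x, f x ∂ν) ^ 2 ≤ ((∫⁻ x, f x ^ (2 : ℝ) ∂ν) ^ (1 / (2 : ℝ)) *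
        (ν Set.univ) ^ (1 / (2 : ℝ))) ^ 2 := by gcongr
    _ = _ := by
      rw [mul_pow, ← ENNReal.rpow_natCast, ← ENNReal.rpow_natCast (ν Set.univ ^ _),
        ← ENNReal.rpow_mul, ← ENNReal.rpow_mul]
      norm_num
      rw [mul_comm]

/-- The deviation of the empirical mean of `stepKernel s (z x) * Y x`. -/
noncomputable def stepDev (P : Measure Ω) (z Y : Ω → ℝ) (S : Fin m → Ω) (s : ℝ) : ℝ :=
  emp S (fun x => stepKernel s (z x) * Y x) - ∫ x, stepKernel s (z x) * Y x ∂P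

lemma measurable_stepDev {z Y : Ω → ℝ} (hz : Measurable z) (hY : Measurable Y) :
    Measurable (fun q : (Fin m → Ω) × ℝ => stepDev P z Y q.1 q.2) := by
  have hk : Measurable (fun q : ℝ × Ω => stepKernel q.1 (z q.2) * Y q.2) :=
    (measurable_stepKernel.comp (measurable_fst.prodMk (hz.comp measurable_snd))).mul
      (hY.comp measurable_snd)
  unfold stepDev emp
  refine Measurable.sub (measurable_const.mul (Finset.measurable_fun_sum _ fun i _ => ?_)) ?_
  · exact hk.comp (measurable_snd.prodMk ((measurable_pi_apply i).comp measurable_fst))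
  · exact (hk.stronglyMeasurable.integral_prod_right').measurable.comp measurable_snd

/-- Only the factor `deriv h s` depends on `h`; the randomness sits in the deviations of step
functions, which are the same for every `h`. -/
lemma emp_sub_integral_eq_integral_stepDev {h : ℝ → ℝ} {K : NNReal} (hh : LipschitzWith K h)
    (h0 : h 0 = 0) {T : ℝ} {z Y : Ω → ℝ} (hz : Measurable z) (hYm : Measurable Y)
    (hY : Integrable Y P) (hYT : ∀ x, T < |z x| → Y x = 0) (S : Fin m → Ω) :
    emp S (fun x => h (z x) * Y x) - ∫ x, h (z x) * Y x ∂P =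
      ∫ s in Set.Ico (-T) T, deriv h s * stepDev P z Y S s := by
  have hd : ∀ s, |deriv h s| ≤ K := fun s => norm_deriv_le_of_lipschitz hh
  have hk : Measurable (fun q : Ω × ℝ => deriv h q.2 * (stepKernel q.2 (z q.1) * Y q.1)) :=
    ((measurable_deriv h).comp measurable_snd).mul
      ((measurable_stepKernel.comp (measurable_snd.prodMk (hz.comp measurable_fst))).mul
      (hYm.comp measurable_fst))
  have hrep : ∀ x, h (z x) * Y x =
      ∫ s in Set.Ico (-T) T, deriv h s * (stepKernel s (z x) * Y x) := by
    intro x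
    by_cases hx : |z x| ≤ T
    · rw [eq_integral_deriv_mul_stepKernel hh h0 hx, ← integral_mul_const]
      simp only [mul_assoc]
    · simp [hYT x (not_le.1 hx)]
  have hbd : ∀ (s : ℝ) (x : Ω), ‖deriv h s * (stepKernel s (z x) * Y x)‖ ≤ K * ‖Y x‖ := by
    intro s x
    rw [norm_mul, norm_mul]
    have h1 := hd s
    have h2 := abs_stepKernel_le s (z x)
    simp only [Real.norm_eq_abs]
    calc |deriv h s| * (|stepKernel s (z x)| * |Y x|) ≤ K * (1 * |Y x|) := by gcongr
      _ = _ := by ring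
  have hprod : Integrable (Function.uncurry fun (x : Ω) (s : ℝ) =>
      deriv h s * (stepKernel s (z x) * Y x)) (P.prod (volume.restrict (Set.Ico (-T) T))) := by
    refine Integrable.mono' (g := fun q : Ω × ℝ => K * ‖Y q.1‖)
      ((hY.norm.const_mul _).comp_fst _) hk.aestronglyMeasurable
      (Filter.Eventually.of_forall fun q => hbd q.2 q.1)
  have hint : ∀ x, IntegrableOn (fun s => deriv h s * (stepKernel s (z x) * Y x))
      (Set.Ico (-T) T) := fun x =>
    Integrable.of_bound (hk.comp (measurable_const.prodMk measurable_id)).aestronglyMeasurable _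
      (Filter.Eventually.of_forall fun s => hbd s x)
  have e1 : emp S (fun x => h (z x) * Y x) = ∫ s in Set.Ico (-T) T,
      deriv h s * emp S (fun x => stepKernel s (z x) * Y x) := by
    unfold emp
    simp only [hrep]
    rw [← integral_finsetSum _ fun i _ => hint _, ← integral_const_mul]
    congr 1; ext s
    rw [← Finset.mul_sum]; ring
  have e2 : ∫ x, h (z x) * Y x ∂P = ∫ s in Set.Ico (-T) T,
      deriv h s * ∫ x, stepKernel s (z x) * Y x ∂P := by
    simp only [hrep]
    rw [integral_integral_swap hprod]
    simp only [integral_const_mul]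
  rw [e1, e2, ← integral_sub]
  · congr 1; ext s
    unfold stepDev; ring
  · have : (fun s => deriv h s * emp S (fun x => stepKernel s (z x) * Y x)) =
        fun s => 1 / (m : ℝ) * ∑ i, deriv h s * (stepKernel s (z (S i)) * Y (S i)) := by
      ext s; unfold emp; rw [← Finset.mul_sum]; ring
    rw [this]
    exact (integrable_finsetSum _ fun i _ => hint _).const_mul _
  · have := hprod.integral_prod_right
    simpa only [Function.uncurry_apply_pair, integral_const_mul] using this

lemma measurable_stepDev_right {z Y : Ω → ℝ} (hz : Measurable z) (hY : Measurable Y)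
    (S : Fin m → Ω) : Measurable (stepDev P z Y S) := by
  have hD := measurable_stepDev (P := P) (m := m) hz hY
  exact Measurable.of_uncurry_left (f := stepDev P z Y) hD

/-- Cauchy–Schwarz on an interval of length `2 * T` with `|deriv h| ≤ K`. The right-hand side is
free of `h`, which is the source of uniformity. -/
lemma sq_emp_sub_integral_le {h : ℝ → ℝ} {K : NNReal} (hh : LipschitzWith K h)
    (h0 : h 0 = 0) {T : ℝ} {z Y : Ω → ℝ} (hz : Measurable z) (hYm : Measurable Y)
    (hY : Integrable Y P) (hYT : ∀ x, T < |z x| → Y x = 0) (S : Fin m → Ω) :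
    ENNReal.ofReal ((emp S (fun x => h (z x) * Y x) - ∫ x, h (z x) * Y x ∂P) ^ 2) ≤
      ENNReal.ofReal (K ^ 2) * (ENNReal.ofReal (2 * T) *
        ∫⁻ s in Set.Ico (-T) T, ENNReal.ofReal (stepDev P z Y S s ^ 2)) := by
  rw [emp_sub_integral_eq_integral_stepDev hh h0 hz hYm hY hYT]
  have hD : Measurable (stepDev P z Y S) :=  measurable_stepDev_right hz hYm S
  have hd : ∀ s, |deriv h s| ≤ K := fun s => norm_deriv_le_of_lipschitz hh
  have h1 : ENNReal.ofReal ((∫ s in Set.Ico (-T) T, deriv h s * stepDev P z Y S s) ^ 2) =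
      ‖∫ s in Set.Ico (-T) T, deriv h s * stepDev P z Y S s‖ₑ ^ 2 := by
    rw [← sq_abs, ENNReal.ofReal_pow (abs_nonneg _), ← Real.norm_eq_abs, ofReal_norm]
  rw [h1]
  have h2 : ‖∫ s in Set.Ico (-T) T, deriv h s * stepDev P z Y S s‖ₑ ≤
      ENNReal.ofReal K * ∫⁻ s in Set.Ico (-T) T, ‖stepDev P z Y S s‖ₑ := by
    refine (enorm_integral_le_lintegral_enorm _).trans ?_
    rw [← lintegral_const_mul _ hD.enorm]
    refine lintegral_mono fun s => ?_
    rw [enorm_mul]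
    gcongr
    rw [← ofReal_norm]
    exact ENNReal.ofReal_le_ofReal (hd s)
  calc _ ≤ (ENNReal.ofReal K * ∫⁻ s in Set.Ico (-T) T, ‖stepDev P z Y S s‖ₑ) ^ 2 := by gcongr
    _ = ENNReal.ofReal (K ^ 2) * (∫⁻ s in Set.Ico (-T) T, ‖stepDev P z Y S s‖ₑ) ^ 2 := by
      rw [mul_pow, ENNReal.ofReal_pow K.coe_nonneg]
    _ ≤ _ := by
      gcongr
      refine (lintegral_sq_le_measure_mul _ hD.enorm.aemeasurable).trans (le_of_eq ?_)
      congr 1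
      · rw [Measure.restrict_apply_univ, Real.volume_Ico]; congr 1; ring
      · refine lintegral_congr fun s => ?_
        rw [← sq_abs (stepDev _ _ _ _ _), ENNReal.ofReal_pow (abs_nonneg _), ← Real.norm_eq_abs,
          ofReal_norm]

/-- Uniform deviation over all `K`-Lipschitz functions of a bounded linear statistic. -/
lemma emp_lipschitz_deviation {ι : Type*} [Fintype ι] (hm : 0 < m) {Y : ι → Ω → ℝ}
    (hYm : ∀ j, Measurable (Y j)) (hY : ∀ j, MemLp (Y j) 2 P) {z : Ω → ℝ} (hz : Measurable z)
    {T : ℝ} (hT : 0 ≤ T) (hYT : ∀ j x, T < |z x| → Y j x = 0) {K : NNReal} {c p : ℝ} (hc : 0 < c)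
    (hcp : K ^ 2 * (4 * T ^ 2 * ∑ j, ∫ x, Y j x ^ 2 ∂P) ≤ c * (m * p)) :
    (Measure.pi fun _ : Fin m => P) {S | ∃ h : ℝ → ℝ, LipschitzWith K h ∧ h 0 = 0 ∧
      c < ∑ j, (emp S (fun x => h (z x) * Y j x) - ∫ x, h (z x) * Y j x ∂P) ^ 2} ≤
      ENNReal.ofReal p := by
  have hm' : (0 : ℝ) < m := by exact_mod_cast hm
  have hmeas : ∀ j, Measurable (fun q : (Fin m → Ω) × ℝ =>
      ENNReal.ofReal (stepDev P z (Y j) q.1 q.2 ^ 2)) := fun j =>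
    ((measurable_stepDev hz (hYm j)).pow_const 2).ennreal_ofReal
  have hmeas' : ∀ j, Measurable (fun S : Fin m → Ω => ENNReal.ofReal (K ^ 2) *
      (ENNReal.ofReal (2 * T) *
        ∫⁻ s in Set.Ico (-T) T, ENNReal.ofReal (stepDev P z (Y j) S s ^ 2))) := fun j =>
    ((hmeas j).lintegral_prod_right'.const_mul _).const_mul _
  -- A single Markov inequality for the `h`-free majorant. By Tonelli its mean is an integral over
  -- `s` of variances of step-function averages, giving `K ^ 2 * 4 * T ^ 2 / m` times the second
  -- moments of the `Y j`.
  refine measure_le_of_lintegral_le (Φ := fun S => ∑ j, ENNReal.ofReal (K ^ 2) *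
      (ENNReal.ofReal (2 * T) *
        ∫⁻ s in Set.Ico (-T) T, ENNReal.ofReal (stepDev P z (Y j) S s ^ 2))) ?_ hc ?_ ?_
  · exact Finset.aemeasurable_fun_sum _ fun j _ => (hmeas' j).aemeasurable
  · rw [lintegral_finsetSum _ fun j _ => hmeas' j]
    have hj : ∀ j, ∫⁻ S : Fin m → Ω, ENNReal.ofReal (K ^ 2) * (ENNReal.ofReal (2 * T) *
        ∫⁻ s in Set.Ico (-T) T, ENNReal.ofReal (stepDev P z (Y j) S s ^ 2))
        ∂(Measure.pi fun _ : Fin m => P) ≤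
        ENNReal.ofReal (K ^ 2 * (4 * T ^ 2 * ((∫ x, Y j x ^ 2 ∂P) / m))) := by
      intro j
      have hI : 0 ≤ (∫ x, Y j x ^ 2 ∂P) / m :=
        div_nonneg (integral_nonneg fun x => sq_nonneg _) hm'.le
      rw [lintegral_const_mul _ ((hmeas j).lintegral_prod_right'.const_mul _),
        lintegral_const_mul _ (hmeas j).lintegral_prod_right',
        lintegral_lintegral_swap (hmeas j).aemeasurable]
      have hs : ∀ s, ∫⁻ S : Fin m → Ω, ENNReal.ofReal (stepDev P z (Y j) S s ^ 2)
          ∂(Measure.pi fun _ : Fin m => P) ≤ ENNReal.ofReal ((∫ x, Y j x ^ 2 ∂P) / m) := by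
        intro s
        have hks : Measurable (fun x => stepKernel s (z x)) :=
          measurable_stepKernel.comp (measurable_const.prodMk hz)
        have hL : MemLp (fun x => stepKernel s (z x) * Y j x) 2 P := by
          refine MemLp.mono (hY j) (hks.mul (hYm j)).aestronglyMeasurable
            (Filter.Eventually.of_forall fun x => ?_)
          rw [norm_mul]
          exact mul_le_of_le_one_left (norm_nonneg _) (abs_stepKernel_le _ _)
        refine (lintegral_emp_deviation_sq hm hL).trans (ENNReal.ofReal_le_ofReal ?_)
        refine div_le_div_of_nonneg_right (integral_mono hL.integrable_sq (hY j).integrable_sq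
          fun x => ?_) hm'.le
        have := abs_stepKernel_le s (z x)
        simp only [mul_pow]
        refine mul_le_of_le_one_left (sq_nonneg _) ?_
        rw [← sq_abs]; exact pow_le_one₀ (abs_nonneg _) this
      calc _ ≤ ENNReal.ofReal (K ^ 2) * (ENNReal.ofReal (2 * T) *
            ∫⁻ s in Set.Ico (-T) T, ENNReal.ofReal ((∫ x, Y j x ^ 2 ∂P) / m)) := by
            gcongr with s; exact hs s
        _ = _ := by
            rw [setLIntegral_const, Real.volume_Ico, ← ENNReal.ofReal_mul hI,
              ← ENNReal.ofReal_mul (by positivity), ← ENNReal.ofReal_mul (by positivity)]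
            congr 1; ring
    refine (Finset.sum_le_sum fun j _ => hj j).trans ?_
    rw [← ENNReal.ofReal_sum_of_nonneg]
    · refine ENNReal.ofReal_le_ofReal ?_
      rw [← Finset.mul_sum, ← Finset.mul_sum, ← Finset.sum_div]
      rw [← mul_div_assoc, ← mul_div_assoc, div_le_iff₀ hm']
      linarith
    · intro j _
      have : 0 ≤ ∫ x, Y j x ^ 2 ∂P := integral_nonneg fun x => sq_nonneg _
      positivity
  · rintro S ⟨h, hh, h0, hS⟩
    refine (ENNReal.ofReal_le_ofReal hS.le).trans ?_
    rw [ENNReal.ofReal_sum_of_nonneg fun j _ => sq_nonneg _]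
    exact Finset.sum_le_sum fun j _ => sq_emp_sub_integral_le hh h0 hz (hYm j)
      ((hY j).integrable (by norm_num)) (hYT j) S

end Deviation


/-! ### Consequences of well-behavedness: exponential tails above, mass of boxes below. -/

section WellBehaved

variable {d : ℕ} {L R : ℝ}

/-- Exponential moments of all one-dimensional projections of the first marginal. -/
def HasExpTails (L : ℝ) (D : Measure (Vec d × ℝ)) : Prop :=
  ∀ e : Vec d, ‖e‖ = 1 →
    ∫⁻ p, ENNReal.ofReal (Real.exp (L / 2 * |(inner ℝ e p.1 : ℝ)|)) ∂D ≤ ENNReal.ofReal (4 / L ^ 2)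

lemma lintegral_exp_neg_mul_abs {c : ℝ} (hc : 0 < c) :
    ∫⁻ t : ℝ, ENNReal.ofReal (Real.exp (-c * |t|)) = ENNReal.ofReal (2 / c) := by
  have h1 : ∫ t : ℝ, Real.exp (-c * |t|) = 2 / c := by
    rw [integral_comp_abs (f := fun t : ℝ => Real.exp (-c * t)), integral_exp_mul_Ioi (by linarith)]
    simp
    field_simp
  have h2 : Integrable (fun t : ℝ => Real.exp (-c * |t|)) :=
    Integrable.of_integral_ne_zero (by rw [h1]; positivity)
  rw [← ofReal_integral_eq_lintegral_ofReal h2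
    (Filter.Eventually.of_forall fun t => (Real.exp_pos _).le), h1]

/-- The density bound for `k = 1` times `exp (L / 2 * |z|)` still decays at rate `L / 2`, and
integrates to `(1 / L) * (4 / L)`. -/
lemma WellBehaved.hasExpTails {D : Measure (Vec d × ℝ)} (hL : 0 < L)
    (h : WellBehaved L R D.fst) : HasExpTails L D := by
  intro e he
  obtain ⟨γ, hγ, hmap, -, hub⟩ := h 1 le_rfl (by norm_num) (fun _ => e)
    ⟨fun _ => he, fun i j hij => absurd (Subsingleton.elim i j) hij⟩
  have hm : Measurable (fun x : Vec d => fun _ : Fin 1 => (inner ℝ e x : ℝ)) := by fun_prop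
  have hg : Measurable (fun z : Fin 1 → ℝ => ENNReal.ofReal (Real.exp (L / 2 * |z 0|))) := by
    fun_prop
  have e1 : ∫⁻ p, ENNReal.ofReal (Real.exp (L / 2 * |(inner ℝ e p.1 : ℝ)|)) ∂D =
      ∫⁻ z : Fin 1 → ℝ, ENNReal.ofReal (γ z) * ENNReal.ofReal (Real.exp (L / 2 * |z 0|)) := by
    have h1 := lintegral_withDensity_eq_lintegral_mul volume hγ.ennreal_ofReal hg
    rw [← hmap, lintegral_map hg hm, Measure.fst, lintegral_map (by fun_prop) measurable_fst] at h1
    exact h1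
  rw [e1]
  have e2 : ∀ z : Fin 1 → ℝ, ENNReal.ofReal (γ z) * ENNReal.ofReal (Real.exp (L / 2 * |z 0|)) ≤
      ENNReal.ofReal (1 / L) * ENNReal.ofReal (Real.exp (-(L / 2) * |z 0|)) := by
    intro z
    rw [← ENNReal.ofReal_mul' (Real.exp_pos _).le, ← ENNReal.ofReal_mul' (Real.exp_pos _).le]
    refine ENNReal.ofReal_le_ofReal ?_
    refine (mul_le_mul_of_nonneg_right (hub z) (Real.exp_pos _).le).trans (le_of_eq ?_)
    rw [mul_assoc, ← Real.exp_add]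
    simp only [Finset.univ_unique, Fin.default_eq_zero, Finset.sum_singleton, Real.sqrt_sq_eq_abs]
    congr 2; ring
  refine (lintegral_mono e2).trans ?_
  have hg2 : Measurable (fun t : ℝ => ENNReal.ofReal (Real.exp (-(L / 2) * |t|))) := by fun_prop
  rw [lintegral_const_mul _ (by fun_prop)]
  have e3 := (volume_preserving_funUnique (Fin 1) ℝ).lintegral_comp hg2
  have e4 : ∫⁻ z : Fin 1 → ℝ, ENNReal.ofReal (Real.exp (-(L / 2) * |z 0|)) =
      ENNReal.ofReal (2 / (L / 2)) := by
    rw [← lintegral_exp_neg_mul_abs (by positivity), ← e3]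
    rfl
  rw [e4, ← ENNReal.ofReal_mul (by positivity)]
  refine ENNReal.ofReal_le_ofReal (le_of_eq ?_)
  field_simp; norm_num

/-- The box lies in the sup-norm ball of radius `R`, where the density is at least `L`. Half-open
boxes are used so that neighbouring ones are disjoint. -/
lemma WellBehaved.le_measure_box {D : Measure (Vec d × ℝ)} (h : WellBehaved L R D.fst) {k : ℕ}
    (hk : 1 ≤ k) (hk2 : k ≤ 2) {e : Fin k → Vec d} (he : Orthonormal ℝ e) {s t : Fin k → ℝ}
    (hs : ∀ i, -R ≤ s i) (hst : ∀ i, s i ≤ t i) (ht : ∀ i, t i ≤ R) (hR : 0 ≤ R) (hL : 0 ≤ L) :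
    ENNReal.ofReal (L * ∏ i, (t i - s i)) ≤
      D {p | ∀ i, (inner ℝ (e i) p.1 : ℝ) ∈ Set.Ico (s i) (t i)} := by
  obtain ⟨γ, hγ, hmap, hlb, -⟩ := h k hk hk2 e he
  have hm : Measurable (fun x : Vec d => fun i : Fin k => (inner ℝ (e i) x : ℝ)) := by fun_prop
  set B : Set (Fin k → ℝ) := Set.pi Set.univ (fun i => Set.Ico (s i) (t i)) with hB
  have hBm : MeasurableSet B := MeasurableSet.univ_pi fun i => measurableSet_Ico
  have e1 : D {p | ∀ i, (inner ℝ (e i) p.1 : ℝ) ∈ Set.Ico (s i) (t i)} =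
      (D.fst.map (fun x : Vec d => fun i : Fin k => (inner ℝ (e i) x : ℝ))) B := by
    rw [Measure.map_apply hm hBm, Measure.fst_apply (hm hBm)]
    congr 1; ext p; simp [B]
  rw [e1, hmap, withDensity_apply _ hBm]
  calc ENNReal.ofReal (L * ∏ i, (t i - s i)) = ∫⁻ _ in B, ENNReal.ofReal L := by
        rw [setLIntegral_const, ENNReal.ofReal_mul hL, hB, Real.volume_pi_Ico,
          ENNReal.ofReal_prod_of_nonneg fun i _ => sub_nonneg.2 (hst i)]
    _ ≤ _ := by
        refine setLIntegral_mono' hBm fun z hz => ENNReal.ofReal_le_ofReal (hlb z ?_)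
        rw [pi_norm_le_iff_of_nonneg hR]
        intro i
        have := hz i (Set.mem_univ _)
        rw [Real.norm_eq_abs, abs_le]
        exact ⟨(hs i).trans this.1, (this.2.le).trans (ht i)⟩

end WellBehaved

/-! ### Fourth moments and truncated second moments of projections. -/

section Tails

variable {d : ℕ} {L : ℝ} {D : Measure (Vec d × ℝ)}

lemma HasExpTails.integrable_exp (h : HasExpTails L D) {e : Vec d} (he : ‖e‖ = 1) :
    Integrable (fun p => Real.exp (L / 2 * |(inner ℝ e p.1 : ℝ)|)) D := by
  have hm : Measurable (fun p : Vec d × ℝ => Real.exp (L / 2 * |(inner ℝ e p.1 : ℝ)|)) := by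
    fun_prop
  refine ⟨hm.aestronglyMeasurable, ?_⟩
  rw [hasFiniteIntegral_iff_ofReal (Filter.Eventually.of_forall fun p => (Real.exp_pos _).le)]
  exact (h e he).trans_lt ENNReal.ofReal_lt_top

lemma HasExpTails.integral_exp_le (h : HasExpTails L D) {e : Vec d} (he : ‖e‖ = 1) :
    ∫ p, Real.exp (L / 2 * |(inner ℝ e p.1 : ℝ)|) ∂D ≤ 4 / L ^ 2 := by
  have h1 := h e he
  rw [← ofReal_integral_eq_lintegral_ofReal (h.integrable_exp he)
    (Filter.Eventually.of_forall fun t => (Real.exp_pos _).le)] at h1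
  exact (ENNReal.ofReal_le_ofReal_iff (by positivity)).1 h1

/-- The bound on the truncated second moment of a one-dimensional projection. -/
noncomputable def tailBound (L T : ℝ) : ℝ := 128 / L ^ 4 * Real.exp (-(L * T / 4))

lemma pow_four_le_exp (hL : 0 < L) (z : ℝ) :
    z ^ 4 ≤ 384 / L ^ 4 * Real.exp (L / 2 * |z|) := by
  have h := Real.pow_div_factorial_le_exp (L / 2 * |z|) (by positivity) 4
  have e : (L / 2 * |z|) ^ 4 / (Nat.factorial 4 : ℝ) = L ^ 4 / 384 * z ^ 4 := by
    rw [mul_pow, show |z| ^ 4 = z ^ 4 from by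
      rw [show (4 : ℕ) = 2 * 2 from rfl, pow_mul, sq_abs, ← pow_mul]]
    norm_num [Nat.factorial]; ring
  rw [e] at h
  calc z ^ 4 = 384 / L ^ 4 * (L ^ 4 / 384 * z ^ 4) := by field_simp
    _ ≤ _ := by gcongr

/-- Half of the available exponent `L / 2` absorbs the square; the other half gives the decay in
`T`. -/
lemma sq_le_exp_of_lt (hL : 0 < L) {T z : ℝ} (hz : T ≤ |z|) :
    z ^ 2 ≤ 32 / L ^ 2 * Real.exp (-(L * T / 4)) * Real.exp (L / 2 * |z|) := by
  have h := Real.pow_div_factorial_le_exp (L / 4 * |z|) (by positivity) 2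
  have e : (L / 4 * |z|) ^ 2 / (Nat.factorial 2 : ℝ) = L ^ 2 / 32 * z ^ 2 := by
    rw [mul_pow, sq_abs]
    norm_num [Nat.factorial]; ring
  rw [e] at h
  calc z ^ 2 = 32 / L ^ 2 * (L ^ 2 / 32 * z ^ 2) := by field_simp
    _ ≤ 32 / L ^ 2 * Real.exp (L / 4 * |z|) := by gcongr
    _ ≤ 32 / L ^ 2 * Real.exp (-(L * T / 4) + L / 2 * |z|) := by
        gcongr; nlinarith
    _ = _ := by rw [Real.exp_add]; ring

lemma exists_unit_smul (v : Vec d) (hv : v ≠ 0) : ∃ e : Vec d, ‖e‖ = 1 ∧ v = ‖v‖ • e := by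
  have h : ‖v‖ ≠ 0 := norm_ne_zero_iff.2 hv
  exact ⟨‖v‖⁻¹ • v, by rw [norm_smul, norm_inv, norm_norm, inv_mul_cancel₀ h],
    by rw [smul_smul, mul_inv_cancel₀ h, one_smul]⟩

lemma HasExpTails.integrable_pow_four (hL : 0 < L) (h : HasExpTails L D) (v : Vec d) :
    Integrable (fun p => (inner ℝ v p.1 : ℝ) ^ 4) D := by
  rcases eq_or_ne v 0 with rfl | hv
  · simp
  obtain ⟨e, he, hve⟩ := exists_unit_smul v hv
  have h1 : Integrable (fun p => (inner ℝ e p.1 : ℝ) ^ 4) D := by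
    refine Integrable.mono' ((h.integrable_exp he).const_mul (384 / L ^ 4))
      (by fun_prop) (Filter.Eventually.of_forall fun p => ?_)
    rw [Real.norm_of_nonneg (by positivity)]
    exact pow_four_le_exp hL _
  rw [hve]
  simp only [inner_smul_left, mul_pow]
  exact h1.const_mul _

lemma HasExpTails.integral_pow_four_le (hL : 0 < L) (h : HasExpTails L D) (v : Vec d) :
    ∫ p, (inner ℝ v p.1 : ℝ) ^ 4 ∂D ≤ ‖v‖ ^ 4 * (1536 / L ^ 6) := by
  rcases eq_or_ne v 0 with rfl | hv
  · simp
  obtain ⟨e, he, hve⟩ := exists_unit_smul v hv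
  have h1 : ∫ p, (inner ℝ e p.1 : ℝ) ^ 4 ∂D ≤ 1536 / L ^ 6 := by
    calc _ ≤ ∫ p, 384 / L ^ 4 * Real.exp (L / 2 * |(inner ℝ e p.1 : ℝ)|) ∂D :=
          integral_mono (h.integrable_pow_four hL e) ((h.integrable_exp he).const_mul _)
            fun p => pow_four_le_exp hL _
      _ ≤ 384 / L ^ 4 * (4 / L ^ 2) := by
          rw [integral_const_mul]
          exact mul_le_mul_of_nonneg_left (h.integral_exp_le he) (by positivity)
      _ = _ := by field_simp; norm_num
  have h2 : ∀ p : Vec d × ℝ, (inner ℝ v p.1 : ℝ) ^ 4 = ‖v‖ ^ 4 * (inner ℝ e p.1 : ℝ) ^ 4 := by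
    intro p
    conv_lhs => rw [hve]
    rw [real_inner_smul_left, mul_pow]
  simp only [h2]
  rw [integral_const_mul]
  exact mul_le_mul_of_nonneg_left h1 (by positivity)

variable [IsProbabilityMeasure D]

lemma HasExpTails.memLp (hL : 0 < L) (h : HasExpTails L D) (v : Vec d) :
    MemLp (fun p : Vec d × ℝ => (inner ℝ v p.1 : ℝ)) 2 D := by
  rw [memLp_two_iff_integrable_sq (by fun_prop)]
  refine Integrable.mono' ((h.integrable_pow_four hL v).add (integrable_const (1 : ℝ)))
      (by fun_prop) (Filter.Eventually.of_forall fun p => ?_)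
  rw [Real.norm_of_nonneg (by positivity)]
  simp only [Pi.add_apply]
  nlinarith [sq_nonneg ((inner ℝ v p.1 : ℝ) ^ 2 - 1)]

lemma HasExpTails.integral_tail_le (hL : 0 < L) (h : HasExpTails L D) (v : Vec d) {T : ℝ} :
    ∫ p, {p : Vec d × ℝ | T * ‖v‖ < |(inner ℝ v p.1 : ℝ)|}.indicator
      (fun p => (inner ℝ v p.1 : ℝ) ^ 2) p ∂D ≤ ‖v‖ ^ 2 * tailBound L T := by
  rcases eq_or_ne v 0 with rfl | hv
  · simp
  obtain ⟨e, he, hve⟩ := exists_unit_smul v hv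
  have hv0 : 0 < ‖v‖ := norm_pos_iff.2 hv
  have hms : MeasurableSet {p : Vec d × ℝ | T * ‖v‖ < |(inner ℝ v p.1 : ℝ)|} :=
    measurableSet_lt measurable_const (by fun_prop)
  have h2 : ∀ p : Vec d × ℝ, (inner ℝ v p.1 : ℝ) = ‖v‖ * (inner ℝ e p.1 : ℝ) := by
    intro p
    conv_lhs => rw [hve]
    rw [real_inner_smul_left]
  calc _ ≤ ∫ p, ‖v‖ ^ 2 * (32 / L ^ 2 * Real.exp (-(L * T / 4)) *
        Real.exp (L / 2 * |(inner ℝ e p.1 : ℝ)|)) ∂D := by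
        refine integral_mono ((h.memLp hL v).integrable_sq.indicator hms)
          (((h.integrable_exp he).const_mul _).const_mul _) fun p => ?_
        simp only [Set.indicator, Set.mem_ofPred_eq]
        split_ifs with hp
        · rw [h2, mul_pow]
          rw [h2, abs_mul, abs_of_pos hv0, mul_comm] at hp
          exact mul_le_mul_of_nonneg_left
            (sq_le_exp_of_lt hL (lt_of_mul_lt_mul_left hp hv0.le).le) (by positivity)
        · positivity
    _ ≤ ‖v‖ ^ 2 * (32 / L ^ 2 * Real.exp (-(L * T / 4)) * (4 / L ^ 2)) := by
        rw [integral_const_mul, integral_const_mul]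
        gcongr
        exact h.integral_exp_le he
    _ = _ := by unfold tailBound; field_simp; norm_num

end Tails


/-! ### Union bound along a trajectory driven by fresh inputs. -/

section Iteration

variable {X Ω : Type*}

/-- The pairs of a starting point and an input sequence whose trajectory under `F` meets `B`. -/
def hitSet (F : X × Ω → X) (B : Set (X × Ω)) : (T : ℕ) → Set (X × (Fin T → Ω))
  | 0 => ∅
  | T + 1 => {q | (q.1, q.2 0) ∈ B} ∪ {q | (F (q.1, q.2 0), Fin.tail q.2) ∈ hitSet F B T}

lemma notMem_of_notMem_hitSet {F : X × Ω → X} {B : Set (X × Ω)} {T : ℕ} {S : Fin T → Ω}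
    {w : Fin (T + 1) → X} (hS : (w 0, S) ∉ hitSet F B T)
    (hw : ∀ t : Fin T, w t.succ = F (w t.castSucc, S t)) (t : Fin T) :
    (w t.castSucc, S t) ∉ B := by
  induction T with
  | zero => exact t.elim0
  | succ T ih =>
    simp only [hitSet, Set.mem_union, Set.mem_ofPred_eq, not_or] at hS
    refine Fin.cases ?_ (fun t => ?_) t
    · exact hS.1
    · have h0 := hw 0
      rw [Fin.castSucc_zero] at h0
      rw [← h0] at hS
      exact ih (S := Fin.tail S) (w := Fin.tail w) hS.2 (fun t => hw t.succ) t

lemma exists_trajectory (F : X × Ω → X) (x : X) {T : ℕ} (S : Fin T → Ω) :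
    ∃ w : Fin (T + 1) → X, w 0 = x ∧ ∀ t : Fin T, w t.succ = F (w t.castSucc, S t) := by
  induction T generalizing x with
  | zero => exact ⟨fun _ => x, rfl, fun t => t.elim0⟩
  | succ T ih =>
    obtain ⟨w, hw0, hw⟩ := ih (F (x, S 0)) (Fin.tail S)
    refine ⟨Fin.cons x w, rfl, fun t => ?_⟩
    refine Fin.cases ?_ (fun t => ?_) t
    · simpa using hw0
    · simpa [Fin.tail] using hw t

variable [MeasurableSpace X] [MeasurableSpace Ω]

lemma measurableSet_hitSet {F : X × Ω → X} (hF : Measurable F) {B : Set (X × Ω)}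
    (hB : MeasurableSet B) (T : ℕ) : MeasurableSet (hitSet F B T) := by
  induction T with
  | zero => exact MeasurableSet.empty
  | succ T ih =>
    have h0 : Measurable (fun q : X × (Fin (T + 1) → Ω) => (q.1, q.2 0)) := by fun_prop
    have h1 : Measurable (fun q : X × (Fin (T + 1) → Ω) => Fin.tail q.2) := by
      refine measurable_pi_lambda _ fun i => ?_
      exact (measurable_pi_apply i.succ).comp measurable_snd
    exact (h0 hB).union (((hF.comp h0).prodMk h1) ih)

/-- Conditionally on the first input the rest of the trajectory is again one from a fixed point with
fresh inputs, so Fubini and induction add one `p` per step. The bound on `B` must hold from every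
starting point. -/
lemma measure_hitSet_le {P : Measure Ω} [IsProbabilityMeasure P] {F : X × Ω → X}
    (hF : Measurable F) {B : Set (X × Ω)} (hB : MeasurableSet B) {p : ENNReal}
    (hp : ∀ x, P {s | (x, s) ∈ B} ≤ p) (T : ℕ) (x : X) :
    (Measure.pi fun _ : Fin T => P) {S | (x, S) ∈ hitSet F B T} ≤ T * p := by
  induction T generalizing x with
  | zero => simp [hitSet]
  | succ T ih =>
    have hmp := measurePreserving_piFinSuccAbove (fun _ : Fin (T + 1) => P) 0
    have h1 : MeasurableSet {q : Ω × (Fin T → Ω) | (x, q.1) ∈ B} :=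
      (measurable_const.prodMk measurable_fst) hB
    have h2 : MeasurableSet {q : Ω × (Fin T → Ω) | (F (x, q.1), q.2) ∈ hitSet F B T} :=
      ((hF.comp (measurable_const.prodMk measurable_fst)).prodMk measurable_snd)
        (measurableSet_hitSet hF hB T)
    have e : {S : Fin (T + 1) → Ω | (x, S) ∈ hitSet F B (T + 1)} =
        (MeasurableEquiv.piFinSuccAbove (fun _ : Fin (T + 1) => Ω) 0) ⁻¹'
          ({q | (x, q.1) ∈ B} ∪ {q | (F (x, q.1), q.2) ∈ hitSet F B T}) := by
      ext S
      rfl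
    rw [e, hmp.measure_preimage (h1.union h2).nullMeasurableSet]
    have b1 : (P.prod (Measure.pi fun _ : Fin T => P)) {q | (x, q.1) ∈ B} ≤ p := by
      rw [Measure.prod_apply h1]
      calc _ = ∫⁻ s, {s | (x, s) ∈ B}.indicator 1 s ∂P := by
            refine lintegral_congr fun s => ?_
            by_cases hs : (x, s) ∈ B <;> simp [hs]
        _ = P {s | (x, s) ∈ B} := lintegral_indicator_one (measurable_prodMk_left hB)
        _ ≤ p := hp x
    have b2 : (P.prod (Measure.pi fun _ : Fin T => P))
        {q | (F (x, q.1), q.2) ∈ hitSet F B T} ≤ T * p := by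
      rw [Measure.prod_apply h2]
      calc _ ≤ ∫⁻ _, (T * p : ENNReal) ∂P := lintegral_mono fun s => ih (F (x, s))
        _ = T * p := by simp
    calc _ ≤ p + T * p := (measure_union_le _ _).trans (add_le_add b1 b2)
      _ = _ := by push_cast; ring

end Iteration


/-! ### Cauchy–Schwarz bounds and the coordinates of the sample points. -/

lemma abs_integral_mul_le_of_sq {Ω : Type*} [MeasurableSpace Ω] {P : Measure Ω} {f g : Ω → ℝ}
    (hf : MemLp f 2 P) (hg : MemLp g 2 P) {A B : ℝ} (hA : 0 < A) (hB : 0 < B)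
    (hfA : ∫ x, f x ^ 2 ∂P ≤ A ^ 2) (hgB : ∫ x, g x ^ 2 ∂P ≤ B ^ 2) :
    |∫ x, f x * g x ∂P| ≤ A * B := by
  have hfg : Integrable (fun x => f x * g x) P := hf.integrable_mul hg
  calc |∫ x, f x * g x ∂P| ≤ ∫ x, |f x * g x| ∂P := abs_integral_le_integral_abs
    _ ≤ ∫ x, (B / (2 * A) * f x ^ 2 + A / (2 * B) * g x ^ 2) ∂P := by
        refine integral_mono hfg.abs
          ((hf.integrable_sq.const_mul _).add (hg.integrable_sq.const_mul _)) fun x => ?_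
        rw [abs_mul, ← sq_abs (f x), ← sq_abs (g x)]
        have h := sq_nonneg (B * |f x| - A * |g x|)
        have e : B / (2 * A) * |f x| ^ 2 + A / (2 * B) * |g x| ^ 2 - |f x| * |g x| =
            (B * |f x| - A * |g x|) ^ 2 / (2 * A * B) := by field_simp; ring
        have : 0 ≤ (B * |f x| - A * |g x|) ^ 2 / (2 * A * B) := by positivity
        linarith
    _ = B / (2 * A) * ∫ x, f x ^ 2 ∂P + A / (2 * B) * ∫ x, g x ^ 2 ∂P := by
        rw [integral_add (hf.integrable_sq.const_mul _) (hg.integrable_sq.const_mul _),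
          integral_const_mul, integral_const_mul]
    _ ≤ B / (2 * A) * A ^ 2 + A / (2 * B) * B ^ 2 := by gcongr
    _ = A * B := by field_simp; ring

lemma abs_sum_mul_le {d : ℕ} (q : Vec d) {f : Fin d → ℝ} {c : ℝ} (hc : 0 ≤ c)
    (hf : ∑ j, f j ^ 2 ≤ c ^ 2) : |∑ j, q j * f j| ≤ ‖q‖ * c := by
  have h := Finset.sum_mul_sq_le_sq_mul_sq Finset.univ (fun j => q j) f
  rw [← EuclideanSpace.real_norm_sq_eq] at h
  refine abs_le_of_sq_le_sq ?_ (by positivity)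
  calc _ ≤ _ := h
    _ ≤ ‖q‖ ^ 2 * c ^ 2 := by gcongr
    _ = _ := by ring

lemma inner_eq_sum {d : ℕ} (q x : Vec d) : (inner ℝ q x : ℝ) = ∑ j, q j * x j := by
  simp [PiLp.inner_apply, mul_comm]

section Coordinates

variable {d : ℕ} {L : ℝ} {D : Measure (Vec d × ℝ)}

lemma coord_eq_inner (j : Fin d) (x : Vec d) :
    x j = inner ℝ (EuclideanSpace.single j (1 : ℝ)) x := by
  simp [EuclideanSpace.inner_single_left]

lemma integral_coord_sq_le (hI : ∀ v : Vec d, ∫ p, (inner ℝ v p.1 : ℝ) ^ 2 ∂D ≤ ‖v‖ ^ 2)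
    (j : Fin d) : ∫ p, p.1 j ^ 2 ∂D ≤ 1 := by
  have := hI (EuclideanSpace.single j (1 : ℝ))
  simpa [coord_eq_inner j] using this

variable [IsProbabilityMeasure D]

lemma HasExpTails.memLp_coord (hL : 0 < L) (h : HasExpTails L D) (j : Fin d) :
    MemLp (fun p : Vec d × ℝ => p.1 j) 2 D := by
  simp only [coord_eq_inner j]
  exact h.memLp hL _

lemma HasExpTails.integrable_norm_sq (hL : 0 < L) (h : HasExpTails L D) :
    Integrable (fun p : Vec d × ℝ => ‖p.1‖ ^ 2) D := by
  simp only [EuclideanSpace.real_norm_sq_eq]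
  exact integrable_finsetSum _ fun j _ => (h.memLp_coord hL j).integrable_sq

lemma HasExpTails.integral_norm_sq_le (hL : 0 < L) (h : HasExpTails L D)
    (hI : ∀ v : Vec d, ∫ p, (inner ℝ v p.1 : ℝ) ^ 2 ∂D ≤ ‖v‖ ^ 2) :
    ∫ p, ‖p.1‖ ^ 2 ∂D ≤ d := by
  simp only [EuclideanSpace.real_norm_sq_eq]
  rw [integral_finsetSum _ fun j _ => (h.memLp_coord hL j).integrable_sq]
  calc _ ≤ ∑ _j : Fin d, (1 : ℝ) := Finset.sum_le_sum fun j _ => integral_coord_sq_le hI j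
    _ = d := by simp

/-- The samples with a large Euclidean norm. -/
def farSet (d : ℕ) (T : ℝ) : Set (Vec d × ℝ) := {p | 4 * d * T ^ 2 < ‖p.1‖ ^ 2}

lemma measurableSet_farSet (T : ℝ) : MeasurableSet (farSet d T) :=
  measurableSet_lt measurable_const (by fun_prop)

/-- Coordinates of size at most `T` contribute at most `d * T ^ 2`, a quarter of `‖x‖ ^ 2` on the
far set. So the coordinates beyond `T` carry most of the norm, and their tails are known. -/
lemma HasExpTails.integral_farSet_le (hL : 0 < L) (h : HasExpTails L D) {T : ℝ} :
    ∫ p, (farSet d T).indicator (fun p => ‖p.1‖ ^ 2) p ∂D ≤ 2 * d * tailBound L T := by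
  have hms : ∀ j : Fin d, MeasurableSet {p : Vec d × ℝ | T < |p.1 j|} := fun j =>
    measurableSet_lt measurable_const (by fun_prop)
  have hi : ∀ j : Fin d, Integrable (fun p : Vec d × ℝ =>
      {p : Vec d × ℝ | T < |p.1 j|}.indicator (fun p => p.1 j ^ 2) p) D := fun j =>
    (h.memLp_coord hL j).integrable_sq.indicator (hms j)
  have hpt : ∀ p : Vec d × ℝ, (farSet d T).indicator (fun p => ‖p.1‖ ^ 2) p ≤
      2 * ∑ j, {p : Vec d × ℝ | T < |p.1 j|}.indicator (fun p => p.1 j ^ 2) p := by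
    intro p
    have hnn : ∀ j, 0 ≤ {p : Vec d × ℝ | T < |p.1 j|}.indicator (fun p => p.1 j ^ 2) p :=
      fun j => Set.indicator_nonneg (fun p _ => sq_nonneg _) p
    by_cases hp : p ∈ farSet d T
    · rw [Set.indicator_of_mem hp]
      have h1 : ‖p.1‖ ^ 2 ≤ d * T ^ 2 +
          ∑ j, {p : Vec d × ℝ | T < |p.1 j|}.indicator (fun p => p.1 j ^ 2) p := by
        rw [EuclideanSpace.real_norm_sq_eq]
        calc ∑ j, p.1 j ^ 2 ≤ ∑ j, (T ^ 2 +
              {p : Vec d × ℝ | T < |p.1 j|}.indicator (fun p => p.1 j ^ 2) p) := by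
              refine Finset.sum_le_sum fun j _ => ?_
              by_cases hj : T < |p.1 j|
              · rw [Set.indicator_of_mem (by exact hj)]
                nlinarith [sq_nonneg T]
              · rw [Set.indicator_of_notMem (by exact hj), add_zero, ← sq_abs]
                exact pow_le_pow_left₀ (abs_nonneg _) (not_lt.1 hj) 2
          _ = _ := by rw [Finset.sum_add_distrib]; simp
      have h2 : 4 * d * T ^ 2 < ‖p.1‖ ^ 2 := hp
      have h3 : 0 ≤ (d : ℝ) * T ^ 2 := by positivity
      linarith
    · rw [Set.indicator_of_notMem hp]
      exact mul_nonneg (by norm_num) (Finset.sum_nonneg fun j _ => hnn j)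
  calc _ ≤ ∫ p, 2 * ∑ j, {p : Vec d × ℝ | T < |p.1 j|}.indicator (fun p => p.1 j ^ 2) p ∂D :=
        integral_mono ((h.integrable_norm_sq hL).indicator (measurableSet_farSet T))
          ((integrable_finsetSum _ fun j _ => hi j).const_mul _) hpt
    _ = 2 * ∑ j, ∫ p, {p : Vec d × ℝ | T < |p.1 j|}.indicator (fun p => p.1 j ^ 2) p ∂D := by
        rw [integral_const_mul, integral_finsetSum _ fun j _ => hi j]
    _ ≤ 2 * ∑ _j : Fin d, tailBound L T := by
        gcongr with j
        have := h.integral_tail_le hL (EuclideanSpace.single j (1 : ℝ)) (T := T)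
        simpa [← coord_eq_inner j] using this
    _ = _ := by simp; ring

end Coordinates


lemma emp_sum {Ω : Type*} {m : ℕ} (S : Fin m → Ω) {ι : Type*} (s : Finset ι) (f : ι → Ω → ℝ) :
    emp S (fun p => ∑ j ∈ s, f j p) = ∑ j ∈ s, emp S (f j) := by
  unfold emp
  rw [Finset.sum_comm, Finset.mul_sum]

lemma measure_le_two_mul {α : Type*} [MeasurableSpace α] {P : Measure α} {A B₁ B₂ : Set α}
    {c : ENNReal} (hA : A ⊆ B₁ ∪ B₂) (h₁ : P B₁ ≤ c) (h₂ : P B₂ ≤ c) : P A ≤ 2 * c := by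
  refine (measure_mono hA).trans ((measure_union_le _ _).trans ?_)
  rw [two_mul]
  exact add_le_add h₁ h₂

lemma measure_le_three_mul {α : Type*} [MeasurableSpace α] {P : Measure α} {A B₁ B₂ B₃ : Set α}
    {c : ENNReal} (hA : A ⊆ B₁ ∪ B₂ ∪ B₃) (h₁ : P B₁ ≤ c) (h₂ : P B₂ ≤ c) (h₃ : P B₃ ≤ c) :
    P A ≤ 3 * c := by
  refine (measure_mono hA).trans ((measure_union_le _ _).trans ?_)
  rw [show (3 : ENNReal) * c = 2 * c + c by ring]
  exact add_le_add (measure_le_two_mul subset_rfl h₁ h₂) h₃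

/-! ### Concentration events for a batch at a fixed weight vector. -/

section Events

variable {d m : ℕ} {L : ℝ} {D : Measure (Vec d × ℝ)} [IsProbabilityMeasure D]

/-- Concentration of the empirical correlation of a square-integrable noise with the sample
points, uniformly over directions. -/
lemma noise_correlation_deviation (hm : 0 < m) (hL : 0 < L) (h : HasExpTails L D)
    (hI : ∀ v : Vec d, ∫ p, (inner ℝ v p.1 : ℝ) ^ 2 ∂D ≤ ‖v‖ ^ 2)
    {ξ : Vec d × ℝ → ℝ} (hξm : Measurable ξ) (hξ : MemLp ξ 2 D) {ρ p T : ℝ} (hρ : 0 < ρ)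
    (hp : 0 < p) (hξρ : ∫ x, ξ x ^ 2 ∂D ≤ ρ ^ 2) (hc1 : 4 * d * T ^ 2 ≤ m * p)
    (hc2 : 2 * d * tailBound L T ≤ p ^ 2) :
    (Measure.pi fun _ : Fin m => D) {S | ¬ ∀ q : Vec d,
      |emp S (fun x => ξ x * (inner ℝ q x.1 : ℝ))| ≤ 3 * ρ * ‖q‖} ≤ 3 * ENNReal.ofReal p := by
  -- Cutting off large points keeps the vector square-integrable: `ξ * x` would need more than the
  -- second moment of `ξ`.
  set F : Fin d → Vec d × ℝ → ℝ := fun j => (farSet d T)ᶜ.indicator (fun x => ξ x * x.1 j)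
    with hF
  have hfm := (measurableSet_farSet (d := d) T)
  have hFm : ∀ j, Measurable (F j) := fun j =>
    (hξm.mul (by fun_prop)).indicator hfm.compl
  have hFsum : ∀ x, ∑ j, F j x ^ 2 ≤ 4 * d * T ^ 2 * ξ x ^ 2 := by
    intro x
    by_cases hx : x ∈ farSet d T
    · have : ∀ j, F j x = 0 := fun j => Set.indicator_of_notMem (by simpa using hx) _
      simp only [this]
      simp; positivity
    · have : ∀ j, F j x = ξ x * x.1 j := fun j => Set.indicator_of_mem (by simpa using hx) _
      simp only [this, mul_pow]
      rw [← Finset.mul_sum, ← EuclideanSpace.real_norm_sq_eq, mul_comm]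
      have hx' : ‖x.1‖ ^ 2 ≤ 4 * d * T ^ 2 := not_lt.1 hx
      exact mul_le_mul_of_nonneg_right hx' (sq_nonneg _)
  have hFL : ∀ j, MemLp (F j) 2 D := by
    intro j
    rw [memLp_two_iff_integrable_sq (hFm j).aestronglyMeasurable]
    refine Integrable.mono' (hξ.integrable_sq.const_mul (4 * d * T ^ 2))
      ((hFm j).pow_const 2).aestronglyMeasurable (Filter.Eventually.of_forall fun x => ?_)
    rw [Real.norm_of_nonneg (sq_nonneg _)]
    exact (Finset.single_le_sum (f := fun j => F j x ^ 2) (fun j _ => sq_nonneg _)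
      (Finset.mem_univ j)).trans (hFsum x)
  have E1 := emp_chebyshev_sum (m := m) hm hFL (c := ρ ^ 2) (p := p) (by positivity) (by
    rw [← integral_finsetSum _ fun j _ => (hFL j).integrable_sq]
    calc _ ≤ ∫ x, 4 * d * T ^ 2 * ξ x ^ 2 ∂D :=
          integral_mono (integrable_finsetSum _ fun j _ => (hFL j).integrable_sq)
            (hξ.integrable_sq.const_mul _) hFsum
      _ ≤ 4 * d * T ^ 2 * ρ ^ 2 := by
          rw [integral_const_mul]; gcongr
      _ ≤ _ := by rw [mul_comm]; gcongr)
  -- The empirical noise may be as large as `ρ ^ 2 / p`; the far points have empirical second moment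
  -- at most `p`, and `p` cancels in Cauchy–Schwarz.
  have E2 := emp_markov (m := m) (P := D) (f := fun x => ξ x ^ 2) (fun x => sq_nonneg _)
    hξ.integrable_sq (c := ρ ^ 2 / p) (p := p) (by positivity)
    (by rw [div_mul_cancel₀ _ hp.ne']; exact hξρ)
  have E3 := emp_markov (m := m) (P := D) (f := (farSet d T).indicator (fun p => ‖p.1‖ ^ 2))
    (fun x => Set.indicator_nonneg (fun _ _ => sq_nonneg _) x)
    ((h.integrable_norm_sq hL).indicator hfm) (c := p) (p := p) hp
    ((h.integral_farSet_le hL).trans (by rw [← sq]; exact hc2))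
  refine measure_le_three_mul ?_ E1 E2 E3
  intro S hS
  by_contra hcon
  simp only [Set.mem_union, Set.mem_ofPred_eq, not_or, not_lt] at hcon
  obtain ⟨⟨h1, h2⟩, h3⟩ := hcon
  apply hS
  intro q
  rcases eq_or_ne q 0 with rfl | hq
  · simp [emp]
  have hq0 : 0 < ‖q‖ := norm_pos_iff.2 hq
  -- Fluctuation of the truncated average, its mean, and the far part; each costs `ρ * ‖q‖`.
  have e1 : emp S (fun x => ξ x * (inner ℝ q x.1 : ℝ)) =
      ∑ j, q j * (emp S (F j) - ∫ x, F j x ∂D) +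
      ∫ x, ξ x * (farSet d T)ᶜ.indicator (fun x => (inner ℝ q x.1 : ℝ)) x ∂D +
      emp S (fun x => ξ x * (farSet d T).indicator (fun x => (inner ℝ q x.1 : ℝ)) x) := by
    have a1 : ∀ x, ∑ j, q j * F j x =
        ξ x * (farSet d T)ᶜ.indicator (fun x => (inner ℝ q x.1 : ℝ)) x := by
      intro x
      by_cases hx : x ∈ farSet d T
      · have : ∀ j, F j x = 0 := fun j => Set.indicator_of_notMem (by simpa using hx) _
        rw [Set.indicator_of_notMem (by simpa using hx)]
        simp [this]
      · have : ∀ j, F j x = ξ x * x.1 j := fun j => Set.indicator_of_mem (by simpa using hx) _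
        rw [Set.indicator_of_mem (by simpa using hx)]
        simp only [this, inner_eq_sum, Finset.mul_sum]
        exact Finset.sum_congr rfl fun j _ => by ring
    have a2 : ∫ x, ξ x * (farSet d T)ᶜ.indicator (fun x => (inner ℝ q x.1 : ℝ)) x ∂D =
        ∑ j, q j * ∫ x, F j x ∂D := by
      simp only [← a1]
      rw [integral_finsetSum _ fun j _ => ((hFL j).integrable (by norm_num)).const_mul _]
      simp only [integral_const_mul]
    have a3 : ∑ j, q j * emp S (F j) =
        emp S (fun x => ξ x * (farSet d T)ᶜ.indicator (fun x => (inner ℝ q x.1 : ℝ)) x) := by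
      simp only [← a1]
      rw [emp_sum]
      simp only [emp_const_mul]
    rw [a2]
    simp only [mul_sub, Finset.sum_sub_distrib]
    rw [a3, sub_add_cancel, ← emp_add]
    congr 1; ext x
    rw [← mul_add, add_comm, Set.indicator_self_add_compl_apply]
  rw [e1]
  have b1 := abs_sum_mul_le q hρ.le h1
  have b2 : |∫ x, ξ x * (farSet d T)ᶜ.indicator (fun x => (inner ℝ q x.1 : ℝ)) x ∂D| ≤
      ρ * ‖q‖ := by
    refine abs_integral_mul_le_of_sq hξ ((h.memLp hL q).indicator hfm.compl) hρ hq0 hξρ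
      (le_trans ?_ (hI q))
    refine integral_mono ((h.memLp hL q).indicator hfm.compl).integrable_sq
      (h.memLp hL q).integrable_sq fun x => ?_
    by_cases hx : x ∈ (farSet d T)ᶜ
    · simp [Set.indicator_of_mem hx]
    · simp only [Set.indicator_of_notMem hx]; nlinarith [sq_nonneg (inner ℝ q x.1 : ℝ)]
  have b3 : |emp S (fun x => ξ x * (farSet d T).indicator (fun x => (inner ℝ q x.1 : ℝ)) x)| ≤
      ρ * ‖q‖ := by
    refine (abs_emp_mul_le S _ _).trans ?_
    rw [← Real.sqrt_mul (emp_nonneg S fun x => sq_nonneg _)]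
    refine Real.sqrt_le_iff.2 ⟨by positivity, ?_⟩
    have c1 : emp S (fun x => (farSet d T).indicator (fun x => (inner ℝ q x.1 : ℝ)) x ^ 2) ≤
        ‖q‖ ^ 2 * p := by
      refine le_trans ?_ (mul_le_mul_of_nonneg_left h3 (sq_nonneg ‖q‖))
      rw [← emp_const_mul]
      refine emp_mono S fun x => ?_
      by_cases hx : x ∈ farSet d T
      · simp only [Set.indicator_of_mem hx]
        rw [← mul_pow, ← sq_abs]
        exact pow_le_pow_left₀ (abs_nonneg _) (abs_real_inner_le_norm _ _) 2
      · simp [Set.indicator_of_notMem hx]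
    calc _ ≤ ρ ^ 2 / p * (‖q‖ ^ 2 * p) := by
          refine mul_le_mul h2 c1 (emp_nonneg S fun x => sq_nonneg _) (by positivity)
      _ = _ := by field_simp
  calc _ ≤ _ := abs_add_three _ _ _
    _ ≤ ‖q‖ * ρ + ρ * ‖q‖ + ρ * ‖q‖ := by gcongr
    _ = _ := by ring

/-- Uniform bound for the empirical correlation of Lipschitz functions of a one-dimensional
projection with the sample points. -/
lemma lipschitz_correlation_deviation (hm : 0 < m) (hd : 0 < d) (hL : 0 < L)
    (h : HasExpTails L D)
    (hI : ∀ v : Vec d, ∫ p, (inner ℝ v p.1 : ℝ) ^ 2 ∂D ≤ ‖v‖ ^ 2)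
    {p T b : ℝ} (hp : 0 < p) (hb : 0 < b) (hT : 0 ≤ T)
    (hc1 : 4 * d * T ^ 2 ≤ m * p) (hc2 : d * tailBound L T ≤ p ^ 2) (w : Vec d) :
    (Measure.pi fun _ : Fin m => D) {S | ¬ ∀ f : ℝ → ℝ, LipschitzWith b.toNNReal f → f 0 = 0 →
      ∀ q : Vec d, |emp S (fun x => f (inner ℝ w x.1) * (inner ℝ q x.1 : ℝ))| ≤
        3 * b * ‖w‖ * ‖q‖} ≤ 3 * ENNReal.ofReal p := by
  rcases eq_or_ne w 0 with rfl | hw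
  · have : {S : Fin m → Vec d × ℝ | ¬ ∀ f : ℝ → ℝ, LipschitzWith b.toNNReal f → f 0 = 0 →
      ∀ q : Vec d, |emp S (fun x => f (inner ℝ (0 : Vec d) x.1) * (inner ℝ q x.1 : ℝ))| ≤
        3 * b * ‖(0 : Vec d)‖ * ‖q‖} = ∅ := by
      ext S
      simp only [Set.mem_ofPred_eq, Set.mem_empty_iff_false, iff_false, not_not]
      intro f _ hf q
      simp [hf, emp]
    rw [this]; simp
  have hw0 : 0 < ‖w‖ := norm_pos_iff.2 hw
  have hd0 : (0 : ℝ) < d := by exact_mod_cast hd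
  have hbK : ((b.toNNReal : NNReal) : ℝ) = b := Real.coe_toNNReal b hb.le
  set B : Set (Vec d × ℝ) := {x | T * ‖w‖ < |(inner ℝ w x.1 : ℝ)|} with hB
  have hBm : MeasurableSet B := measurableSet_lt measurable_const (by fun_prop)
  set Y : Fin d → Vec d × ℝ → ℝ := fun j => Bᶜ.indicator (fun x => x.1 j) with hY
  have hYm : ∀ j, Measurable (Y j) := fun j => Measurable.indicator (by fun_prop) hBm.compl
  have hYL : ∀ j, MemLp (Y j) 2 D := fun j => (h.memLp_coord hL j).indicator hBm.compl
  have hz : Measurable (fun x : Vec d × ℝ => (inner ℝ w x.1 : ℝ)) := by fun_prop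
  have hYI : ∀ j, ∫ x, Y j x ^ 2 ∂D ≤ 1 := by
    intro j
    refine le_trans (integral_mono (hYL j).integrable_sq (h.memLp_coord hL j).integrable_sq
      fun x => ?_) (integral_coord_sq_le hI j)
    by_cases hx : x ∈ Bᶜ
    · simp [Y, Set.indicator_of_mem hx]
    · simp only [Y, Set.indicator_of_notMem hx]; nlinarith [sq_nonneg (x.1 j)]
  have E1 := emp_lipschitz_deviation (m := m) (P := D) hm hYm hYL hz (T := T * ‖w‖)
    (by positivity)
    (fun j x hx => Set.indicator_of_notMem (by simpa [B] using hx) _) (K := b.toNNReal)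
    (c := (b * ‖w‖) ^ 2) (p := p) (by positivity) (by
      rw [hbK]
      calc _ ≤ b ^ 2 * (4 * (T * ‖w‖) ^ 2 * ∑ _j : Fin d, (1 : ℝ)) := by
            gcongr with j; exact hYI j
        _ = (b * ‖w‖) ^ 2 * (4 * d * T ^ 2) := by simp; ring
        _ ≤ _ := by gcongr)
  have hBi : Integrable (B.indicator (fun x => (inner ℝ w x.1 : ℝ) ^ 2)) D :=
    (h.memLp hL w).integrable_sq.indicator hBm
  -- The level `p / d` here compensates the crude bound `d / p` on the empirical mean of `‖x‖ ^ 2`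
  -- in the next event.
  have E2 := emp_markov (m := m) (P := D) (f := B.indicator (fun x => (inner ℝ w x.1 : ℝ) ^ 2))
    (fun x => Set.indicator_nonneg (fun _ _ => sq_nonneg _) x) hBi
    (c := ‖w‖ ^ 2 * (p / d)) (p := p) (by positivity) (by
      refine (h.integral_tail_le hL w).trans ?_
      rw [mul_assoc]
      refine mul_le_mul_of_nonneg_left ?_ (sq_nonneg _)
      rw [div_mul_eq_mul_div, le_div_iff₀ hd0]
      linarith)
  have E3 := emp_markov (m := m) (P := D) (f := fun x => ‖x.1‖ ^ 2) (fun x => sq_nonneg _)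
    (h.integrable_norm_sq hL) (c := d / p) (p := p) (by positivity)
    (by rw [div_mul_cancel₀ _ hp.ne']; exact h.integral_norm_sq_le hL hI)
  refine measure_le_three_mul ?_ E1 E2 E3
  intro S hS
  by_contra hcon
  simp only [Set.mem_union, Set.mem_ofPred_eq, not_or, not_lt, not_exists, not_and] at hcon
  obtain ⟨⟨h1, h2⟩, h3⟩ := hcon
  apply hS
  intro f hf hf0 q
  have h1 := h1 f hf hf0
  have hfz : ∀ z, f z ^ 2 ≤ b ^ 2 * z ^ 2 := by
    intro z
    have := hf.dist_le_mul z 0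
    rw [hbK, hf0, Real.dist_eq, Real.dist_eq, sub_zero, sub_zero] at this
    rw [← mul_pow, ← sq_abs (f z), ← sq_abs (b * z), abs_mul, abs_of_pos hb]
    exact pow_le_pow_left₀ (abs_nonneg _) this 2
  rcases eq_or_ne q 0 with rfl | hq
  · simp [emp]
  have hq0 : 0 < ‖q‖ := norm_pos_iff.2 hq
  have hfm : Measurable (fun x : Vec d × ℝ => f (inner ℝ w x.1)) :=
    hf.continuous.measurable.comp hz
  have hfL : MemLp (fun x : Vec d × ℝ => f (inner ℝ w x.1)) 2 D := by
    rw [memLp_two_iff_integrable_sq hfm.aestronglyMeasurable]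
    refine Integrable.mono' ((h.memLp hL w).integrable_sq.const_mul (b ^ 2))
      (hfm.pow_const 2).aestronglyMeasurable (Filter.Eventually.of_forall fun x => ?_)
    rw [Real.norm_of_nonneg (sq_nonneg _)]
    exact hfz _
  have hfI : ∫ x : Vec d × ℝ, f (inner ℝ w x.1) ^ 2 ∂D ≤ (b * ‖w‖) ^ 2 := by
    calc _ ≤ ∫ x : Vec d × ℝ, b ^ 2 * (inner ℝ w x.1 : ℝ) ^ 2 ∂D :=
          integral_mono hfL.integrable_sq ((h.memLp hL w).integrable_sq.const_mul _)
            fun x => hfz _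
      _ ≤ _ := by
          rw [integral_const_mul, mul_pow]
          exact mul_le_mul_of_nonneg_left (hI w) (sq_nonneg _)
  have e1 : emp S (fun x => f (inner ℝ w x.1) * (inner ℝ q x.1 : ℝ)) =
      ∑ j, q j * (emp S (fun x => f (inner ℝ w x.1) * Y j x) -
        ∫ x, f (inner ℝ w x.1) * Y j x ∂D) +
      ∫ x, f (inner ℝ w x.1) * Bᶜ.indicator (fun x => (inner ℝ q x.1 : ℝ)) x ∂D +
      emp S (fun x => B.indicator (fun x => f (inner ℝ w x.1)) x * (inner ℝ q x.1 : ℝ)) := by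
    have a1 : ∀ x : Vec d × ℝ, ∑ j, q j * (f (inner ℝ w x.1) * Y j x) =
        f (inner ℝ w x.1) * Bᶜ.indicator (fun x => (inner ℝ q x.1 : ℝ)) x := by
      intro x
      by_cases hx : x ∈ B
      · have : ∀ j, Y j x = 0 := fun j => Set.indicator_of_notMem (by simpa using hx) _
        rw [Set.indicator_of_notMem (by simpa using hx)]
        simp [this]
      · have : ∀ j, Y j x = x.1 j := fun j => Set.indicator_of_mem (by simpa using hx) _
        rw [Set.indicator_of_mem (by simpa using hx)]
        simp only [this, inner_eq_sum, Finset.mul_sum]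
        exact Finset.sum_congr rfl fun j _ => by ring
    have a2 : ∫ x, f (inner ℝ w x.1) * Bᶜ.indicator (fun x => (inner ℝ q x.1 : ℝ)) x ∂D =
        ∑ j, q j * ∫ x, f (inner ℝ w x.1) * Y j x ∂D := by
      simp only [← a1]
      have a4 : ∀ j, Integrable (fun x : Vec d × ℝ => f (inner ℝ w x.1) * Y j x) D :=
        fun j => hfL.integrable_mul (hYL j)
      rw [integral_finsetSum _ fun j _ => (a4 j).const_mul _]
      simp only [integral_const_mul]
    have a3 : ∑ j, q j * emp S (fun x => f (inner ℝ w x.1) * Y j x) =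
        emp S (fun x => f (inner ℝ w x.1) *
          Bᶜ.indicator (fun x => (inner ℝ q x.1 : ℝ)) x) := by
      simp only [← a1]
      rw [emp_sum]
      simp only [emp_const_mul]
    rw [a2]
    simp only [mul_sub, Finset.sum_sub_distrib]
    rw [a3, sub_add_cancel, ← emp_add]
    congr 1; ext x
    by_cases hx : x ∈ B
    · rw [Set.indicator_of_mem hx, Set.indicator_of_notMem (by simpa using hx)]; ring
    · rw [Set.indicator_of_notMem hx, Set.indicator_of_mem (by simpa using hx)]; ring
  rw [e1]
  have b1 := abs_sum_mul_le q (by positivity) h1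
  have b2 : |∫ x, f (inner ℝ w x.1) * Bᶜ.indicator (fun x => (inner ℝ q x.1 : ℝ)) x ∂D| ≤
      b * ‖w‖ * ‖q‖ := by
    refine abs_integral_mul_le_of_sq hfL ((h.memLp hL q).indicator hBm.compl)
      (by positivity) hq0 hfI (le_trans ?_ (hI q))
    refine integral_mono ((h.memLp hL q).indicator hBm.compl).integrable_sq
      (h.memLp hL q).integrable_sq fun x => ?_
    by_cases hx : x ∈ Bᶜ
    · simp [Set.indicator_of_mem hx]
    · simp only [Set.indicator_of_notMem hx]; nlinarith [sq_nonneg (inner ℝ q x.1 : ℝ)]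
  have b3 : |emp S (fun x => B.indicator (fun x => f (inner ℝ w x.1)) x *
      (inner ℝ q x.1 : ℝ))| ≤ b * ‖w‖ * ‖q‖ := by
    refine (abs_emp_mul_le S _ _).trans ?_
    rw [← Real.sqrt_mul (emp_nonneg S fun x => sq_nonneg _)]
    refine Real.sqrt_le_iff.2 ⟨by positivity, ?_⟩
    have c1 : emp S (fun x => B.indicator (fun x => f (inner ℝ w x.1)) x ^ 2) ≤
        b ^ 2 * (‖w‖ ^ 2 * (p / d)) := by
      refine le_trans ?_ (mul_le_mul_of_nonneg_left h2 (sq_nonneg b))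
      rw [← emp_const_mul]
      refine emp_mono S fun x => ?_
      by_cases hx : x ∈ B
      · simp only [Set.indicator_of_mem hx]
        exact hfz _
      · simp [Set.indicator_of_notMem hx]
    have c2 : emp S (fun x => (inner ℝ q x.1 : ℝ) ^ 2) ≤ ‖q‖ ^ 2 * (d / p) := by
      refine le_trans ?_ (mul_le_mul_of_nonneg_left h3 (sq_nonneg ‖q‖))
      rw [← emp_const_mul]
      refine emp_mono S fun x => ?_
      rw [← mul_pow, ← sq_abs]
      exact pow_le_pow_left₀ (abs_nonneg _) (abs_real_inner_le_norm _ _) 2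
    calc _ ≤ b ^ 2 * (‖w‖ ^ 2 * (p / d)) * (‖q‖ ^ 2 * (d / p)) := by
          refine mul_le_mul c1 c2 (emp_nonneg S fun x => sq_nonneg _) (by positivity)
      _ = _ := by field_simp
  calc _ ≤ _ := abs_add_three _ _ _
    _ ≤ ‖q‖ * (b * ‖w‖) + b * ‖w‖ * ‖q‖ + b * ‖w‖ * ‖q‖ := by gcongr
    _ = _ := by ring

end Events


section Events

variable {d m : ℕ} {L : ℝ} {D : Measure (Vec d × ℝ)} [IsProbabilityMeasure D]

/-- Uniform bound for the empirical correlation of a square-integrable noise with Lipschitz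
functions of a one-dimensional projection. -/
lemma noise_lipschitz_deviation (hm : 0 < m) (hL : 0 < L) (h : HasExpTails L D)
    {ξ : Vec d × ℝ → ℝ} (hξm : Measurable ξ) (hξ : MemLp ξ 2 D) {ρ p T b : ℝ} (hρ : 0 < ρ)
    (hp : 0 < p) (hb : 0 < b) (hT : 0 ≤ T) (hξρ : ∫ x, ξ x ^ 2 ∂D ≤ ρ ^ 2) (w : Vec d)
    (hc1 : 4 * b ^ 2 * T ^ 2 * ‖w‖ ^ 2 ≤ ρ ^ 2 * (m * p))
    (hc2 : b ^ 2 * ‖w‖ ^ 2 * tailBound L T ≤ ρ ^ 2 * p ^ 2) :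
    (Measure.pi fun _ : Fin m => D) {S | ¬ ∀ f : ℝ → ℝ, LipschitzWith b.toNNReal f → f 0 = 0 →
      emp S (fun x => ξ x * f (inner ℝ w x.1)) ≤
        2 * ρ * Real.sqrt (emp S (fun x => f (inner ℝ w x.1) ^ 2)) + 3 * ρ ^ 2} ≤
      4 * ENNReal.ofReal p := by
  have hm0 : (0 : ℝ) < m := by exact_mod_cast hm
  have hbK : ((b.toNNReal : NNReal) : ℝ) = b := Real.coe_toNNReal b hb.le
  -- The largest truncation of the noise for which Chebyshev still holds `ξ ^ 2` restricted to `G`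
  -- within `ρ ^ 2` of its mean: its second moment is at most `K ^ 2 * ρ ^ 2`.
  set K := ρ * Real.sqrt (m * p) with hK
  have hK0 : 0 < K := by positivity
  have hK2 : K ^ 2 = ρ ^ 2 * (m * p) := by rw [hK, mul_pow, Real.sq_sqrt (by positivity)]
  set G : Set (Vec d × ℝ) := {x | |ξ x| ≤ K} with hG
  have hGm : MeasurableSet G := measurableSet_le (by fun_prop) measurable_const
  set B : Set (Vec d × ℝ) := {x | T * ‖w‖ < |(inner ℝ w x.1 : ℝ)|} with hB
  have hBm : MeasurableSet B := measurableSet_lt measurable_const (by fun_prop)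
  have hz : Measurable (fun x : Vec d × ℝ => (inner ℝ w x.1 : ℝ)) := by fun_prop
  set f₁ : Vec d × ℝ → ℝ := G.indicator (fun x => ξ x ^ 2) with hf₁
  have hf₁m : Measurable f₁ := (hξm.pow_const 2).indicator hGm
  have hf₁b : ∀ x, f₁ x ^ 2 ≤ K ^ 2 * ξ x ^ 2 := by
    intro x
    by_cases hx : x ∈ G
    · simp only [f₁, Set.indicator_of_mem hx]
      have : ξ x ^ 2 ≤ K ^ 2 := by
        rw [← sq_abs]; exact pow_le_pow_left₀ (abs_nonneg _) hx 2
      nlinarith [sq_nonneg (ξ x)]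
    · simp only [f₁, Set.indicator_of_notMem hx]; rw [zero_pow two_ne_zero]; positivity
  have hf₁L : MemLp f₁ 2 D := by
    rw [memLp_two_iff_integrable_sq hf₁m.aestronglyMeasurable]
    refine Integrable.mono' (hξ.integrable_sq.const_mul (K ^ 2))
      (hf₁m.pow_const 2).aestronglyMeasurable (Filter.Eventually.of_forall fun x => ?_)
    rw [Real.norm_of_nonneg (sq_nonneg _)]
    exact hf₁b x
  have hf₁I : ∫ x, f₁ x ∂D ≤ ρ ^ 2 := by
    refine le_trans (integral_mono (hf₁L.integrable (by norm_num)) hξ.integrable_sq fun x => ?_)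
      hξρ
    exact Set.indicator_le_self' (fun _ _ => sq_nonneg _) x
  have E1 := emp_chebyshev (m := m) hm hf₁L (c := ρ ^ 2) (p := p) (by positivity) (by
    calc _ ≤ ∫ x, K ^ 2 * ξ x ^ 2 ∂D :=
          integral_mono hf₁L.integrable_sq (hξ.integrable_sq.const_mul _) hf₁b
      _ ≤ K ^ 2 * ρ ^ 2 := by
          rw [integral_const_mul]; gcongr
      _ = _ := by rw [hK2]; ring)
  have E2 := emp_markov (m := m) (P := D) (f := fun x => ξ x ^ 2) (fun x => sq_nonneg _)
    hξ.integrable_sq (c := ρ ^ 2 / p) (p := p) (by positivity)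
    (by rw [div_mul_cancel₀ _ hp.ne']; exact hξρ)
  have E3 := emp_markov (m := m) (P := D) (f := B.indicator (fun x => (inner ℝ w x.1 : ℝ) ^ 2))
    (fun x => Set.indicator_nonneg (fun _ _ => sq_nonneg _) x)
    ((h.memLp hL w).integrable_sq.indicator hBm)
    (c := ρ ^ 2 * p / b ^ 2) (p := p) (by positivity) (by
      refine (h.integral_tail_le hL w).trans ?_
      rw [div_mul_eq_mul_div, le_div_iff₀ (by positivity)]
      linarith)
  set Y : Vec d × ℝ → ℝ := (Gᶜ ∩ Bᶜ).indicator ξ with hY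
  have hYm : Measurable Y := hξm.indicator (hGm.compl.inter hBm.compl)
  have hYL : MemLp Y 2 D := hξ.indicator (hGm.compl.inter hBm.compl)
  have hYI : ∫ x, Y x ^ 2 ∂D ≤ ρ ^ 2 := by
    refine le_trans (integral_mono hYL.integrable_sq hξ.integrable_sq fun x => ?_) hξρ
    by_cases hx : x ∈ Gᶜ ∩ Bᶜ
    · simp [Y, Set.indicator_of_mem hx]
    · simp only [Y, Set.indicator_of_notMem hx]; nlinarith [sq_nonneg (ξ x)]
  have E4 := emp_lipschitz_deviation (ι := Unit) (m := m) (P := D) hm (Y := fun _ => Y)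
    (fun _ => hYm) (fun _ => hYL) hz (T := T * ‖w‖) (by positivity)
    (fun j x hx => Set.indicator_of_notMem (fun hc => hc.2 hx) _) (K := b.toNNReal)
    (c := (ρ ^ 2) ^ 2) (p := p) (by positivity) (by
      rw [hbK]
      simp only [Finset.univ_unique, Finset.sum_const, Finset.card_singleton, one_smul]
      calc _ ≤ b ^ 2 * (4 * (T * ‖w‖) ^ 2 * ρ ^ 2) := by gcongr
        _ = ρ ^ 2 * (4 * b ^ 2 * T ^ 2 * ‖w‖ ^ 2) := by ring
        _ ≤ ρ ^ 2 * (ρ ^ 2 * (m * p)) := by gcongr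
        _ = _ := by ring)
  have hU : ∀ c : ENNReal, (2 : ENNReal) * (2 * c) = 4 * c := fun c => by ring
  rw [← hU]
  refine measure_le_two_mul ?_ (measure_le_two_mul subset_rfl E1 E2)
    (measure_le_two_mul subset_rfl E3 E4)
  intro S hS
  by_contra hcon
  simp only [Set.mem_union, Set.mem_ofPred_eq, not_or, not_lt, not_exists, not_and,
    Finset.univ_unique, Finset.sum_const, Finset.card_singleton, one_smul] at hcon
  obtain ⟨⟨h1, h2⟩, h3, h4⟩ := hcon
  apply hS
  intro f hf hf0
  have h4 := Real.abs_le_sqrt (h4 f hf hf0)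
  rw [Real.sqrt_sq (by positivity)] at h4
  have hfa : ∀ z, |f z| ≤ b * |z| := by
    intro z
    have := hf.dist_le_mul z 0
    rwa [hbK, hf0, Real.dist_eq, Real.dist_eq, sub_zero, sub_zero] at this
  have hfz : ∀ z, f z ^ 2 ≤ b ^ 2 * z ^ 2 := by
    intro z
    rw [← mul_pow, ← sq_abs (f z), ← sq_abs (b * z), abs_mul, abs_of_pos hb]
    exact pow_le_pow_left₀ (abs_nonneg _) (hfa z) 2
  -- Moderate noise gives the term proportional to the empirical norm of `f`. Large noise gives
  -- three terms of size `ρ ^ 2`: fluctuation and mean where `w ⬝ x` is moderate, and the part where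
  -- it is not.
  have e1 : emp S (fun x => ξ x * f (inner ℝ w x.1)) =
      emp S (fun x => G.indicator ξ x * f (inner ℝ w x.1)) +
      (emp S (fun x => f (inner ℝ w x.1) * Y x) - ∫ x, f (inner ℝ w x.1) * Y x ∂D) +
      ∫ x, f (inner ℝ w x.1) * Y x ∂D +
      emp S (fun x => ξ x * (Gᶜ ∩ B).indicator (fun x => f (inner ℝ w x.1)) x) := by
    rw [add_assoc (emp S _), sub_add_cancel, ← emp_add, ← emp_add]
    congr 1; ext x
    simp only [Y, Set.indicator, Set.mem_inter_iff, Set.mem_compl_iff]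
    by_cases hx : x ∈ G <;> by_cases hx' : x ∈ B <;> simp [hx, hx', mul_comm]
  rw [e1]
  have b1 : emp S (fun x => G.indicator ξ x * f (inner ℝ w x.1)) ≤
      2 * ρ * Real.sqrt (emp S (fun x => f (inner ℝ w x.1) ^ 2)) := by
    refine (le_abs_self _).trans ((abs_emp_mul_le S _ _).trans ?_)
    refine mul_le_mul_of_nonneg_right (Real.sqrt_le_iff.2 ⟨by positivity, ?_⟩)
      (Real.sqrt_nonneg _)
    have e : (fun x => G.indicator ξ x ^ 2) = f₁ := by
      ext x
      by_cases hx : x ∈ G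
      · simp [f₁, Set.indicator_of_mem hx]
      · simp [f₁, Set.indicator_of_notMem hx]
    rw [e]
    have := (abs_le.1 h1).2
    nlinarith [sq_nonneg ρ]
  have b2 : emp S (fun x => f (inner ℝ w x.1) * Y x) - ∫ x, f (inner ℝ w x.1) * Y x ∂D ≤ ρ ^ 2 :=
    (le_abs_self _).trans h4
  have b3 : ∫ x, f (inner ℝ w x.1) * Y x ∂D ≤ ρ ^ 2 := by
    -- Where the noise exceeds `K` and `w ⬝ x` is moderate, `|f| ≤ K < |ξ|`, so the product is at
    -- most `ξ ^ 2`.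
    have hTK : b * (T * ‖w‖) ≤ K := by
      refine le_of_sq_le_sq ?_ hK0.le
      rw [hK2]
      nlinarith [mul_nonneg (mul_nonneg (sq_nonneg b) (sq_nonneg T)) (sq_nonneg ‖w‖)]
    have hpt : ∀ x : Vec d × ℝ, ‖f (inner ℝ w x.1) * Y x‖ ≤ ξ x ^ 2 := by
      intro x
      rw [Real.norm_eq_abs, abs_mul]
      by_cases hx : x ∈ Gᶜ ∩ Bᶜ
      · simp only [Y, Set.indicator_of_mem hx]
        have hx1 : K < |ξ x| := not_le.1 hx.1
        have hx2 : |(inner ℝ w x.1 : ℝ)| ≤ T * ‖w‖ := not_lt.1 hx.2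
        have := (hfa (inner ℝ w x.1)).trans (mul_le_mul_of_nonneg_left hx2 hb.le)
        rw [← sq_abs, sq]
        exact mul_le_mul_of_nonneg_right ((this.trans hTK).trans hx1.le) (abs_nonneg _)
      · simp only [Y, Set.indicator_of_notMem hx]
        simpa using sq_nonneg (ξ x)
    calc _ ≤ ‖∫ x, f (inner ℝ w x.1) * Y x ∂D‖ := Real.le_norm_self _
      _ ≤ ∫ x, ξ x ^ 2 ∂D :=
          norm_integral_le_of_norm_le hξ.integrable_sq (Filter.Eventually.of_forall hpt)
      _ ≤ _ := hξρ
  have b4 : emp S (fun x => ξ x * (Gᶜ ∩ B).indicator (fun x => f (inner ℝ w x.1)) x) ≤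
      ρ ^ 2 := by
    refine (le_abs_self _).trans ((abs_emp_mul_le S _ _).trans ?_)
    rw [← Real.sqrt_mul (emp_nonneg S fun x => sq_nonneg _)]
    refine Real.sqrt_le_iff.2 ⟨by positivity, ?_⟩
    have c1 : emp S (fun x => (Gᶜ ∩ B).indicator (fun x => f (inner ℝ w x.1)) x ^ 2) ≤
        b ^ 2 * (ρ ^ 2 * p / b ^ 2) := by
      refine le_trans ?_ (mul_le_mul_of_nonneg_left h3 (sq_nonneg b))
      rw [← emp_const_mul]
      refine emp_mono S fun x => ?_
      by_cases hx : x ∈ B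
      · rw [Set.indicator_of_mem hx]
        by_cases hx' : x ∈ Gᶜ ∩ B
        · rw [Set.indicator_of_mem hx']; exact hfz _
        · rw [Set.indicator_of_notMem hx']; simp; positivity
      · rw [Set.indicator_of_notMem hx, Set.indicator_of_notMem fun hc => hx hc.2]; simp
    calc _ ≤ ρ ^ 2 / p * (b ^ 2 * (ρ ^ 2 * p / b ^ 2)) :=
          mul_le_mul h2 c1 (emp_nonneg S fun x => sq_nonneg _) (by positivity)
      _ = _ := by field_simp
  linarith

/-- Chebyshev with the fourth moment; the mean takes one `‖q‖ ^ 2` and the deviation the other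
three. -/
lemma second_moment_deviation (hm : 0 < m) (hL : 0 < L) (h : HasExpTails L D)
    (hI : ∀ v : Vec d, ∫ p, (inner ℝ v p.1 : ℝ) ^ 2 ∂D ≤ ‖v‖ ^ 2) {p : ℝ}
    (hc : 1536 / L ^ 6 ≤ 9 * (m * p)) (q : Vec d) :
    (Measure.pi fun _ : Fin m => D) {S | ¬ emp S (fun x => (inner ℝ q x.1 : ℝ) ^ 2) ≤
      4 * ‖q‖ ^ 2} ≤ ENNReal.ofReal p := by
  rcases eq_or_ne q 0 with rfl | hq
  · simp [emp]
  have hq0 : 0 < ‖q‖ := norm_pos_iff.2 hq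
  have hf : MemLp (fun x : Vec d × ℝ => (inner ℝ q x.1 : ℝ) ^ 2) 2 D := by
    rw [memLp_two_iff_integrable_sq (by fun_prop)]
    simpa only [← pow_mul] using h.integrable_pow_four hL q
  refine (measure_mono ?_).trans (emp_chebyshev (m := m) hm hf (c := 3 * ‖q‖ ^ 2) (p := p)
    (by positivity) ?_)
  · intro S hS
    simp only [Set.mem_ofPred_eq, not_le] at hS ⊢
    have := hI q
    exact lt_of_lt_of_le (by linarith) (le_abs_self _)
  · simp only [← pow_mul]
    refine (h.integral_pow_four_le hL q).trans ?_
    have : ‖q‖ ^ 4 * (1536 / L ^ 6) ≤ ‖q‖ ^ 4 * (9 * (m * p)) := by gcongr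
    refine this.trans (le_of_eq (by ring))

end Events

/-! ### Empirical masses of cells and lower bounds from paired cells. -/

section Cells

variable {Ω : Type*} [MeasurableSpace Ω] {P : Measure Ω} [IsProbabilityMeasure P] {m : ℕ}

lemma emp_indicator_deviation (hm : 0 < m) {A : Set Ω} (hA : MeasurableSet A) {π p : ℝ}
    (hπ : 0 < π) (hp : 0 < p) (hPA : ENNReal.ofReal π ≤ P A) (hc : 4 ≤ π * (m * p)) :
    (Measure.pi fun _ : Fin m => P) {S | emp S (A.indicator 1) < π / 2} ≤ ENNReal.ofReal p := by
  have hL : MemLp (A.indicator (1 : Ω → ℝ)) 2 P := (memLp_const (1 : ℝ)).indicator hA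
  have hI : ∫ x, A.indicator (1 : Ω → ℝ) x ∂P = P.real A := integral_indicator_one hA
  have hr : π ≤ P.real A := (ENNReal.ofReal_le_iff_le_toReal (measure_ne_top P A)).1 hPA
  have hr0 : 0 < P.real A := hπ.trans_le hr
  refine (measure_mono ?_).trans (emp_chebyshev (m := m) hm hL (c := P.real A / 2) (p := p)
    (by positivity) ?_)
  · intro S hS
    simp only [Set.mem_ofPred_eq] at hS ⊢
    rw [hI]
    refine lt_of_lt_of_le ?_ (neg_le_abs _)
    linarith
  · have : (fun x => A.indicator (1 : Ω → ℝ) x ^ 2) = A.indicator 1 := by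
      ext x
      by_cases hx : x ∈ A <;> simp [hx]
    rw [this, hI]
    have hmp : 0 ≤ (m : ℝ) * p := by positivity
    have : 4 ≤ P.real A * (m * p) := hc.trans (mul_le_mul_of_nonneg_right hr hmp)
    nlinarith

lemma emp_indicator_deviation_forall {ι : Type*} [Fintype ι] [Nonempty ι] (hm : 0 < m)
    {A : ι → Set Ω} (hA : ∀ i, MeasurableSet (A i)) {π p : ℝ}
    (hπ : 0 < π) (hp : 0 < p) (hPA : ∀ i, ENNReal.ofReal π ≤ P (A i))
    (hc : 4 * Fintype.card ι ≤ π * (m * p)) :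
    (Measure.pi fun _ : Fin m => P) {S | ¬ ∀ i, π / 2 ≤ emp S ((A i).indicator 1)} ≤
      ENNReal.ofReal p := by
  have hN : (0 : ℝ) < Fintype.card ι := by exact_mod_cast Fintype.card_pos
  have : {S : Fin m → Ω | ¬ ∀ i, π / 2 ≤ emp S ((A i).indicator 1)} =
      ⋃ i, {S | emp S ((A i).indicator 1) < π / 2} := by
    ext S; simp
  rw [this]
  refine (measure_iUnion_fintype_le _ _).trans ?_
  calc _ ≤ ∑ _i : ι, ENNReal.ofReal (p / Fintype.card ι) := by
        refine Finset.sum_le_sum fun i _ => emp_indicator_deviation hm (hA i) hπ (by positivity)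
          (hPA i) ?_
        rw [← mul_div_assoc, ← mul_div_assoc, le_div_iff₀ hN]
        linarith
    _ = ENNReal.ofReal p := by
        rw [Finset.sum_const, Finset.card_univ, nsmul_eq_mul, ← ENNReal.ofReal_natCast,
          ← ENNReal.ofReal_mul hN.le]
        congr 1; field_simp

/-- If `f` differs by at least `2 * γ` between `A i` and `B i`, then `|f| ≥ γ` on the whole of one
of the two cells. Which one may depend on `f`, so both must carry empirical mass. -/
lemma le_emp_sq_of_cells {Ω : Type*} {m : ℕ} {ι : Type*} [Fintype ι] {A B : ι → Set Ω}
    {S : Fin m → Ω} {π γ : ℝ} (hγ : 0 ≤ γ)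
    (hdisj : Pairwise fun i j => Disjoint (A i ∪ B i) (A j ∪ B j)) {f : Ω → ℝ}
    (hf : ∀ i, ∀ x ∈ A i, ∀ y ∈ B i, 2 * γ ≤ f x - f y)
    (hA : ∀ i, π ≤ emp S ((A i).indicator 1)) (hB : ∀ i, π ≤ emp S ((B i).indicator 1)) :
    γ ^ 2 * (Fintype.card ι * π) ≤ emp S (fun x => f x ^ 2) := by
  have hex : ∀ i, ∃ C : Set Ω, C ⊆ A i ∪ B i ∧ (∀ x ∈ C, γ ^ 2 ≤ f x ^ 2) ∧
      π ≤ emp S (C.indicator 1) := by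
    intro i
    by_cases h : ∀ x ∈ A i, γ ≤ |f x|
    · refine ⟨A i, Set.subset_union_left, fun x hx => ?_, hA i⟩
      rw [← sq_abs (f x)]
      exact pow_le_pow_left₀ hγ (h x hx) 2
    · push Not at h
      obtain ⟨x, hx, hxγ⟩ := h
      refine ⟨B i, Set.subset_union_right, fun y hy => ?_, hB i⟩
      have h1 := hf i x hx y hy
      have h2 := (abs_lt.1 hxγ).2
      rw [← sq_abs (f y)]
      refine pow_le_pow_left₀ hγ ?_ 2
      have := neg_le_abs (f y)
      linarith
  choose C hC hCf hCe using hex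
  calc γ ^ 2 * (Fintype.card ι * π) = γ ^ 2 * ∑ _i : ι, π := by simp
    _ ≤ γ ^ 2 * ∑ i, emp S ((C i).indicator 1) := by
        gcongr with i; exact hCe i
    _ = emp S (fun x => γ ^ 2 * ∑ i, (C i).indicator 1 x) := by
        rw [← emp_sum, ← emp_const_mul]
    _ ≤ _ := by
        refine emp_mono S fun x => ?_
        by_cases hx : ∃ i, x ∈ C i
        · obtain ⟨i, hi⟩ := hx
          rw [Finset.sum_eq_single i]
          · rw [Set.indicator_of_mem hi]; simpa using hCf i x hi
          · intro j _ hj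
            refine Set.indicator_of_notMem (fun hxj => ?_) _
            exact Set.disjoint_left.1 (hdisj hj) (hC j hxj) (hC i hi)
          · simp
        · push Not at hx
          have : ∀ i, (C i).indicator (1 : Ω → ℝ) x = 0 := fun i =>
            Set.indicator_of_notMem (hx i) _
          simp only [this]
          simpa using sq_nonneg (f x)

end Cells


/-! ### The orthogonal component and a frame adapted to two vectors. -/

section Geometry

variable {d : ℕ}

lemma perp_zero_right (v : Vec d) : perp v 0 = v := by simp [perp]

lemma inner_perp (v w : Vec d) : (inner ℝ w (perp v w) : ℝ) = 0 := by
  rcases eq_or_ne w 0 with rfl | hw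
  · simp
  · have : ‖w‖ ^ 2 ≠ 0 := by simpa using hw
    rw [perp, inner_sub_right, inner_smul_right, real_inner_self_eq_norm_sq,
      div_mul_cancel₀ _ this, real_inner_comm, sub_self]

lemma norm_perp_le (v w : Vec d) : ‖perp v w‖ ≤ ‖v‖ := by
  have h : v = (inner ℝ v w / ‖w‖ ^ 2 : ℝ) • w + perp v w := by simp [perp]
  have h2 : ‖v‖ ^ 2 = ‖(inner ℝ v w / ‖w‖ ^ 2 : ℝ) • w‖ ^ 2 + ‖perp v w‖ ^ 2 := by
    conv_lhs => rw [h]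
    rw [norm_add_sq_real, inner_smul_left, inner_perp]; simp
  exact le_of_sq_le_sq (by nlinarith [sq_nonneg ‖(inner ℝ v w / ‖w‖ ^ 2 : ℝ) • w‖]) (norm_nonneg _)

/-- Coordinates adapted to the decomposition of `v` along and orthogonal to `w`. -/
lemma exists_adapted_frame {v w : Vec d} (hw : w ≠ 0) (hv : perp v w ≠ 0) :
    ∃ e : Fin 2 → Vec d, Orthonormal ℝ e ∧ ∃ β κ : ℝ, 0 ≤ β ∧ β ≤ ‖v‖ ∧ |κ| = ‖w‖ ∧
      (∀ x, (inner ℝ v x : ℝ) = β * inner ℝ (e 0) x + ‖perp v w‖ * inner ℝ (e 1) x) ∧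
      ∀ x, (inner ℝ w x : ℝ) = κ * inner ℝ (e 0) x := by
  have hw0 : 0 < ‖w‖ := norm_pos_iff.2 hw
  have hv0 : 0 < ‖perp v w‖ := norm_pos_iff.2 hv
  -- Orienting the first axis this way makes `β ≥ 0`, so `v ⬝ x ≥ 0` on the positive quadrant, the
  -- region where activations have slope at least `a`.
  obtain ⟨σ, hσ, hσv⟩ : ∃ σ : ℝ, |σ| = 1 ∧ 0 ≤ σ * inner ℝ v w := by
    rcases le_total 0 (inner ℝ v w : ℝ) with h | h
    · exact ⟨1, by simp, by simpa using h⟩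
    · exact ⟨-1, by simp, by simpa using h⟩
  have hσ2 : σ * σ = 1 := by
    have := abs_mul_abs_self σ
    rw [hσ] at this; linarith
  set f₀ : Vec d := (σ * ‖w‖⁻¹) • w with hf₀
  set f₁ : Vec d := ‖perp v w‖⁻¹ • perp v w with hf₁
  have hn0 : ‖f₀‖ = 1 := by
    rw [hf₀, norm_smul, norm_mul, Real.norm_eq_abs, hσ, norm_inv, norm_norm, one_mul,
      inv_mul_cancel₀ hw0.ne']
  have hn1 : ‖f₁‖ = 1 := by
    rw [hf₁, norm_smul, norm_inv, norm_norm, inv_mul_cancel₀ hv0.ne']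
  have h01 : (inner ℝ f₀ f₁ : ℝ) = 0 := by
    rw [hf₀, hf₁, real_inner_smul_left, real_inner_smul_right, inner_perp]; simp
  refine ⟨![f₀, f₁], ?_, σ * inner ℝ v w / ‖w‖, σ * ‖w‖, by positivity, ?_, ?_, ?_, ?_⟩
  · constructor
    · intro i; fin_cases i <;> simp [hn0, hn1]
    · intro i j hij
      fin_cases i <;> fin_cases j <;> simp_all [real_inner_comm]
  · rw [div_le_iff₀ hw0]
    calc σ * inner ℝ v w ≤ |σ * inner ℝ v w| := le_abs_self _
      _ = |(inner ℝ v w : ℝ)| := by rw [abs_mul, hσ, one_mul]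
      _ ≤ _ := abs_real_inner_le_norm _ _
  · rw [abs_mul, hσ, one_mul, abs_norm]
  · intro x
    simp only [Matrix.cons_val_zero, Matrix.cons_val_one]
    rw [hf₀, hf₁, real_inner_smul_left, real_inner_smul_left, ← mul_assoc ‖perp v w‖,
      mul_inv_cancel₀ hv0.ne', one_mul]
    have : (inner ℝ v x : ℝ) = (inner ℝ v w / ‖w‖ ^ 2 : ℝ) * inner ℝ w x +
        inner ℝ (perp v w) x := by
      rw [← real_inner_smul_left, ← inner_add_left]; simp [perp]
    rw [this]
    congr 1
    field_simp
    linear_combination (-(inner ℝ v w : ℝ) * inner ℝ w x) * hσ2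
  · intro x
    simp only [Matrix.cons_val_zero]
    rw [hf₀, real_inner_smul_left]
    field_simp
    linear_combination (-(inner ℝ w x : ℝ)) * hσ2

end Geometry

/-! ### No activation of `w ⬝ x` imitates `u (v ⬝ x)`. -/

section Sharpness

variable {d m : ℕ} {a b L R : ℝ} {D : Measure (Vec d × ℝ)}

lemma measurableSet_box {k : ℕ} (e : Fin k → Vec d) (s t : Fin k → ℝ) :
    MeasurableSet {p : Vec d × ℝ | ∀ i, (inner ℝ (e i) p.1 : ℝ) ∈ Set.Ico (s i) (t i)} := by
  have : {p : Vec d × ℝ | ∀ i, (inner ℝ (e i) p.1 : ℝ) ∈ Set.Ico (s i) (t i)} =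
      ⋂ i, (fun p : Vec d × ℝ => (inner ℝ (e i) p.1 : ℝ)) ⁻¹' Set.Ico (s i) (t i) := by
    ext p; simp
  rw [this]
  exact MeasurableSet.iInter fun i => measurableSet_Ico.preimage (by fun_prop)

/-- Pairs of cells on which functions of `w ⬝ x` cannot match `u (v ⬝ x)`. -/
lemma exists_separating_cells (ha : 0 < a) (hb : 0 < b) (hL : 0 < L) (hR : 0 < R) (hR1 : R ≤ 1)
    (hD : WellBehaved L R D.fst) {v w : Vec d} (hv : perp v w ≠ 0) {N : ℕ} (hN : 0 < N)
    (hN1 : 12 * ‖v‖ ≤ N * ‖perp v w‖) (hN2 : 12 * b * ‖w‖ ≤ N * (a * ‖perp v w‖)) :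
    ∃ n : ℕ, 0 < n ∧ n ≤ N ∧ ∃ A B : Fin n → Set (Vec d × ℝ),
      (∀ i, MeasurableSet (A i)) ∧ (∀ i, MeasurableSet (B i)) ∧
      (Pairwise fun i j => Disjoint (A i ∪ B i) (A j ∪ B j)) ∧
      (∀ i, ENNReal.ofReal (L * R ^ 2 / (3 * n)) ≤ D (A i)) ∧
      (∀ i, ENNReal.ofReal (L * R ^ 2 / (3 * n)) ≤ D (B i)) ∧
      ∀ u ∈ Activations a b, ∀ h ∈ Activations a b, ∀ i, ∀ x ∈ A i, ∀ y ∈ B i,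
        2 * (a * ‖perp v w‖ * R / 12) ≤ (h (inner ℝ w y.1) - u (inner ℝ v y.1)) -
          (h (inner ℝ w x.1) - u (inner ℝ v x.1)) := by
  have hv0 : 0 < ‖perp v w‖ := norm_pos_iff.2 hv
  -- At `w = 0` every candidate is constant zero and there is no direction of `w`: one pair of slabs
  -- along `v` suffices, with the one-dimensional density.
  rcases eq_or_ne w 0 with rfl | hw
  · rw [perp_zero_right] at hv hv0 ⊢
    obtain ⟨e, he, hve⟩ := exists_unit_smul v hv
    have hin : ∀ x : Vec d, (inner ℝ v x : ℝ) = ‖v‖ * inner ℝ e x := by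
      intro x
      conv_lhs => rw [hve]
      rw [real_inner_smul_left]
    have ho : Orthonormal ℝ (fun _ : Fin 1 => e) :=
      ⟨fun _ => he, fun i j hij => absurd (Subsingleton.elim i j) hij⟩
    refine ⟨1, one_pos, hN,
      fun _ => {p | ∀ i : Fin 1, (inner ℝ e p.1 : ℝ) ∈ Set.Ico (2 * R / 3) R},
      fun _ => {p | ∀ i : Fin 1, (inner ℝ e p.1 : ℝ) ∈ Set.Ico 0 (R / 3)},
      fun _ => measurableSet_box (fun _ => e) (fun _ => 2 * R / 3) (fun _ => R),
      fun _ => measurableSet_box (fun _ => e) (fun _ => 0) (fun _ => R / 3),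
      fun i j hij => absurd (Subsingleton.elim i j) hij, fun _ => ?_, fun _ => ?_, ?_⟩
    · refine le_trans (ENNReal.ofReal_le_ofReal ?_) (hD.le_measure_box le_rfl (by norm_num) ho
        (s := fun _ => 2 * R / 3) (t := fun _ => R) (fun _ => by linarith) (fun _ => by linarith)
        (fun _ => le_rfl) hR.le hL.le)
      simp only [Finset.univ_unique, Finset.prod_const, Finset.card_singleton, pow_one]
      have : R ^ 2 ≤ R := by nlinarith
      have := mul_le_mul_of_nonneg_left this hL.le
      push_cast
      linarith
    · refine le_trans (ENNReal.ofReal_le_ofReal ?_) (hD.le_measure_box le_rfl (by norm_num) ho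
        (s := fun _ => 0) (t := fun _ => R / 3) (fun _ => by linarith) (fun _ => by linarith)
        (fun _ => by linarith) hR.le hL.le)
      simp only [Finset.univ_unique, Finset.prod_const, Finset.card_singleton, pow_one]
      have : R ^ 2 ≤ R := by nlinarith
      have := mul_le_mul_of_nonneg_left this hL.le
      push_cast
      linarith
    · intro u hu h hh i x hx y hy
      have hx := hx 0
      have hy := hy 0
      simp only [inner_zero_left]
      rw [hin, hin]
      have h1 := hu.2.2.2 (‖v‖ * inner ℝ e x.1) (‖v‖ * inner ℝ e y.1)
        (mul_nonneg hv0.le hy.1)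
        (mul_le_mul_of_nonneg_left (by linarith [hx.1, hy.2]) hv0.le)
      have h2 : ‖v‖ * (R / 3) ≤ ‖v‖ * inner ℝ e x.1 - ‖v‖ * inner ℝ e y.1 := by
        rw [← mul_sub]
        exact mul_le_mul_of_nonneg_left (by linarith [hx.1, hy.2]) hv0.le
      have h3 := mul_le_mul_of_nonneg_left h2 ha.le
      have h4 : 0 ≤ a * ‖v‖ * R := by positivity
      linarith
  · obtain ⟨e, he, β, κ, hβ, hβv, hκ, hin, hinw⟩ := exists_adapted_frame hw hv
    have hN0 : (0 : ℝ) < N := by exact_mod_cast hN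
    have hcell : ∀ j : Fin N, ((j : ℕ) : ℝ) + 1 ≤ N := fun j => by exact_mod_cast j.2
    have hcell0 : ∀ j : Fin N, (0 : ℝ) ≤ (j : ℕ) * R / N := fun j => by positivity
    have hcellR : ∀ j : Fin N, (((j : ℕ) : ℝ) + 1) * R / N ≤ R := fun j => by
      rw [div_le_iff₀ hN0, mul_comm R]
      exact mul_le_mul_of_nonneg_right (hcell j) hR.le
    have hcelle : ∀ j : Fin N, (((j : ℕ) : ℝ) + 1) * R / N - (j : ℕ) * R / N = R / N := fun j => by
      ring
    have hRN : 0 < R / N := by positivity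
    -- The square `[0, R]²` is cut into `N` columns along the direction of `w`, and each column
    -- keeps its top and bottom thirds. Within a column `h (w ⬝ x)` barely moves, while between the
    -- thirds `u (v ⬝ x)` rises by at least `a * ‖perp v w‖ * R / 4`.
    let s : Fin N → ℝ → Fin 2 → ℝ := fun j r => ![(j : ℕ) * R / N, r]
    let t : Fin N → ℝ → Fin 2 → ℝ := fun j r => ![(((j : ℕ) : ℝ) + 1) * R / N, r]
    let C : ℝ → ℝ → Fin N → Set (Vec d × ℝ) := fun r r' j =>
      {p | ∀ i, (inner ℝ (e i) p.1 : ℝ) ∈ Set.Ico (s j r i) (t j r' i)}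
    have hC : ∀ r r', 0 ≤ r → r' ≤ R → r' - r = R / 3 → ∀ j,
        ENNReal.ofReal (L * R ^ 2 / (3 * N)) ≤ D (C r r' j) := by
      intro r r' hr hr' hrr j
      refine le_trans (ENNReal.ofReal_le_ofReal (le_of_eq ?_)) (hD.le_measure_box (by norm_num)
        le_rfl he (s := s j r) (t := t j r') ?_ ?_ ?_ hR.le hL.le)
      · simp only [Fin.prod_univ_two, s, t, Matrix.cons_val_zero, Matrix.cons_val_one]
        rw [hcelle, hrr]; field_simp
      · intro i
        fin_cases i
        · simp only [s]; simpa using (by linarith [hcell0 j] : -R ≤ (j : ℕ) * R / N)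
        · simpa [s] using by linarith
      · intro i
        fin_cases i
        · have := hcelle j
          simpa [s, t] using (by linarith : ((j : ℕ) : ℝ) * R / N ≤ (((j : ℕ) : ℝ) + 1) * R / N)
        · simpa [s, t] using by linarith
      · intro i
        fin_cases i
        · simpa [t] using hcellR j
        · simpa [t] using hr'
    have hC0 : ∀ {r r' j x}, x ∈ C r r' j →
        (inner ℝ (e 0) x.1 : ℝ) ∈ Set.Ico ((j : ℕ) * R / N) ((((j : ℕ) : ℝ) + 1) * R / N) :=
      fun hx => hx 0
    have hC1 : ∀ {r r' j x}, x ∈ C r r' j → (inner ℝ (e 1) x.1 : ℝ) ∈ Set.Ico r r' :=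
      fun hx => hx 1
    refine ⟨N, hN, le_rfl, C (2 * R / 3) R, C 0 (R / 3), fun j => measurableSet_box e _ _,
      fun j => measurableSet_box e _ _, ?_, hC _ _ (by linarith) le_rfl (by ring),
      hC _ _ le_rfl (by linarith) (by ring), ?_⟩
    · have key : ∀ i j : Fin N, i < j → ∀ z : ℝ,
          z ∈ Set.Ico (((i : ℕ) : ℝ) * R / N) ((((i : ℕ) : ℝ) + 1) * R / N) →
          z ∉ Set.Ico (((j : ℕ) : ℝ) * R / N) ((((j : ℕ) : ℝ) + 1) * R / N) := by
        intro i j hij z hz hz'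
        have h1 : ((i : ℕ) : ℝ) + 1 ≤ (j : ℕ) := by exact_mod_cast hij
        have h2 : (((i : ℕ) : ℝ) + 1) * R / N ≤ (j : ℕ) * R / N := by gcongr
        linarith [hz.2, hz'.1]
      intro i j hij
      rw [Set.disjoint_left]
      intro x hx hx'
      have hx0 := hx.elim hC0 hC0
      have hx0' := hx'.elim hC0 hC0
      rcases lt_or_gt_of_ne hij with h | h
      · exact key i j h _ hx0 hx0'
      · exact key j i h _ hx0' hx0
    · intro u hu h hh j x hx y hy
      have hx0 := hC0 hx
      have hx1 := hC1 hx
      have hy0 := hC0 hy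
      have hy1 := hC1 hy
      rw [hin, hin, hinw, hinw]
      set s₁ : ℝ := inner ℝ (e 0) x.1
      set s₂ : ℝ := inner ℝ (e 0) y.1
      set t₁ : ℝ := inner ℝ (e 1) x.1
      set t₂ : ℝ := inner ℝ (e 1) y.1
      have hss : |s₁ - s₂| ≤ R / N := by
        have := hcelle j
        rw [abs_le]; constructor <;> linarith [hx0.1, hx0.2, hy0.1, hy0.2]
      have g1 : ‖v‖ * (R / N) ≤ ‖perp v w‖ * R / 12 := by
        rw [← mul_div_assoc, div_le_iff₀ hN0]
        nlinarith
      have g2 : b * ‖w‖ * (R / N) ≤ a * ‖perp v w‖ * R / 12 := by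
        rw [← mul_div_assoc, div_le_iff₀ hN0]
        nlinarith
      have g3 : -(‖perp v w‖ * R / 12) ≤ β * (s₁ - s₂) := by
        have k1 := neg_abs_le (β * (s₁ - s₂))
        rw [abs_mul, abs_of_nonneg hβ] at k1
        have k2 : β * |s₁ - s₂| ≤ ‖v‖ * (R / N) := by gcongr
        linarith
      have g4 : ‖perp v w‖ * (R / 3) ≤ ‖perp v w‖ * (t₁ - t₂) :=
        mul_le_mul_of_nonneg_left (by linarith [hx1.1, hy1.2]) hv0.le
      have hpos : 0 ≤ ‖perp v w‖ * R := by positivity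
      have g5 : ‖perp v w‖ * R / 4 ≤
          (β * s₁ + ‖perp v w‖ * t₁) - (β * s₂ + ‖perp v w‖ * t₂) := by linarith
      have g6 := hu.2.2.2 (β * s₁ + ‖perp v w‖ * t₁) (β * s₂ + ‖perp v w‖ * t₂)
        (add_nonneg (mul_nonneg hβ ((hcell0 j).trans hy0.1)) (mul_nonneg hv0.le hy1.1))
        (by linarith)
      have g7 := mul_le_mul_of_nonneg_left g5 ha.le
      have g8 := hh.2.2.1 (κ * s₂) (κ * s₁)
      rw [← mul_sub, abs_mul, hκ, abs_sub_comm s₂ s₁] at g8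
      have g9 : b * (‖w‖ * |s₁ - s₂|) ≤ b * ‖w‖ * (R / N) := by
        rw [← mul_assoc]; gcongr
      have g10 := neg_abs_le (h (κ * s₂) - h (κ * s₁))
      linarith

variable [IsProbabilityMeasure D]

/-- With high probability, no activation of `w ⬝ x` fits `u (v ⬝ x)` better than the size of the
component of `v` orthogonal to `w` allows. -/
lemma sharpness_deviation (hm : 0 < m) (ha : 0 < a) (hb : 0 < b) (hL : 0 < L) (hR : 0 < R)
    (hR1 : R ≤ 1) (hD : WellBehaved L R D.fst) {v w : Vec d} (hv : perp v w ≠ 0)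
    {N : ℕ} (hN : 0 < N)
    (hN1 : 12 * ‖v‖ ≤ N * ‖perp v w‖) (hN2 : 12 * b * ‖w‖ ≤ N * (a * ‖perp v w‖))
    {p : ℝ} (hp : 0 < p) (hc : 24 * (N : ℝ) ^ 2 ≤ L * R ^ 2 * (m * p))
    {u : ℝ → ℝ} (hu : u ∈ Activations a b) :
    (Measure.pi fun _ : Fin m => D) {S | ¬ ∀ h ∈ Activations a b,
      a ^ 2 * L * R ^ 4 / 864 * ‖perp v w‖ ^ 2 ≤
        emp S (fun x => (h (inner ℝ w x.1) - u (inner ℝ v x.1)) ^ 2)} ≤ ENNReal.ofReal p := by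
  obtain ⟨n, hn, hnN, A, B, hA, hB, hdisj, hPA, hPB, hAB⟩ :=
    exists_separating_cells ha hb hL hR hR1 hD hv hN hN1 hN2
  have hn0 : (0 : ℝ) < n := by exact_mod_cast hn
  have hnN' : (n : ℝ) ≤ N := by exact_mod_cast hnN
  have : Nonempty (Fin n) := ⟨⟨0, hn⟩⟩
  -- The random event only asks that each of the `2 * n` cells receive at least half of the lower
  -- bound on its mass. It does not mention `h`, so uniformity over the class is free.
  have E := emp_indicator_deviation_forall (ι := Fin n ⊕ Fin n) (P := D) (m := m) hm
    (A := Sum.elim A B) (π := L * R ^ 2 / (3 * n)) (p := p)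
    (by rintro (i | i); exacts [hA i, hB i]) (by positivity) hp
    (by rintro (i | i); exacts [hPA i, hPB i]) (by
      simp only [Fintype.card_sum, Fintype.card_fin, Nat.cast_add]
      rw [div_mul_eq_mul_div, le_div_iff₀ (by positivity)]
      have : (n : ℝ) ^ 2 ≤ (N : ℝ) ^ 2 := by gcongr
      nlinarith)
  refine (measure_mono ?_).trans E
  intro S hS
  by_contra hcon
  simp only [Set.mem_ofPred_eq, not_not] at hcon
  apply hS
  intro h hh
  have := le_emp_sq_of_cells (S := S) (π := L * R ^ 2 / (3 * n) / 2)
    (γ := a * ‖perp v w‖ * R / 12) (by positivity) hdisj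
    (f := fun x => u (inner ℝ v x.1) - h (inner ℝ w x.1)) (fun i x hx y hy => by
      have := hAB u hu h hh i x hx y hy
      linarith) (fun i => hcon (Sum.inl i)) (fun i => hcon (Sum.inr i))
  rw [Fintype.card_fin] at this
  calc _ = (a * ‖perp v w‖ * R / 12) ^ 2 * (n * (L * R ^ 2 / (3 * n) / 2)) := by
        field_simp; norm_num
    _ ≤ _ := this
    _ = _ := by congr 1; ext x; ring

end Sharpness


/-! ### Deterministic bounds on the empirical gradient. -/

section Gradient

variable {d m : ℕ} {a b : ℝ}

lemma inner_gradAt (S : Fin m → Vec d × ℝ) (w q : Vec d) :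
    (inner ℝ (gradAt a b (w, S)) q : ℝ) =
      emp S (fun p => (minimizer a b (w, S) (inner ℝ w p.1) - p.2) * (inner ℝ q p.1 : ℝ)) := by
  unfold gradAt empGrad emp
  rw [real_inner_comm]
  simp only [real_inner_smul_right, inner_sum]

/-- On a well-concentrated batch, the gradient is correlated with the error of the weights. -/
lemma le_inner_gradAt (ha : 0 < a) (hab : a ≤ b) {S : Fin m → Vec d × ℝ} {w v : Vec d}
    {u : ℝ → ℝ} (hu : u ∈ Activations a b) {r : ℝ} (hr : 0 < r)
    (hur : ∀ z z', z' ≤ z → r * (z - z') ≤ u z - u z') {ρ c : ℝ} (hρ : 0 ≤ ρ)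
    (h1 : |emp S (fun p => (p.2 - u (inner ℝ v p.1)) * (inner ℝ (w - v) p.1 : ℝ))| ≤
      3 * ρ * ‖w - v‖)
    (h2 : ∀ f : ℝ → ℝ, LipschitzWith b.toNNReal f → f 0 = 0 →
      emp S (fun p => (p.2 - u (inner ℝ v p.1)) * f (inner ℝ w p.1)) ≤
        2 * ρ * Real.sqrt (emp S (fun p => f (inner ℝ w p.1) ^ 2)) + 3 * ρ ^ 2)
    (h3 : emp S (fun p => (inner ℝ (w - v) p.1 : ℝ) ^ 2) ≤ 4 * ‖w - v‖ ^ 2)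
    (h4 : ∀ h ∈ Activations a b, c ≤
        emp S (fun p => (h (inner ℝ w p.1) - u (inner ℝ v p.1)) ^ 2)) :
    1 / b * c - 9 * ρ * ‖w - v‖ ≤ inner ℝ (gradAt a b (w, S)) (w - v) := by
  have hb : 0 < b := by linarith
  set uh := minimizer a b (w, S) with huh
  have hmin : IsEmpMinimizer a b S w uh := minimizer_spec ha hab (w, S)
  -- The same points with noiseless labels; their minimizer `us` is the comparison between the
  -- fitted activation and the truth.
  set S' : Fin m → Vec d × ℝ := fun i => ((S i).1, u (inner ℝ v (S i).1)) with hS'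
  obtain ⟨us, hs⟩ := exists_isEmpMinimizer ha hab S' w
  have hS'e : ∀ f : Vec d × ℝ → ℝ, emp S' f = emp S (fun p => f (p.1, u (inner ℝ v p.1))) :=
    fun f => rfl
  set h : ℝ → ℝ := fun z => uh z - us z with hh
  have hhl : LipschitzWith b.toNNReal h := LipschitzWith.of_dist_le_mul fun x y => by
    simpa [Real.dist_eq, Real.coe_toNNReal b hb.le] using
      activation_abs_sub_sub_le hmin.1 hs.1 x y
  have hh0 : h 0 = 0 := by simp [h, hmin.1.1, hs.1.1]
  set X := Real.sqrt (emp S (fun p => h (inner ℝ w p.1) ^ 2)) with hX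
  have hX0 : 0 ≤ X := Real.sqrt_nonneg _
  have hX2 : X ^ 2 = emp S (fun p => h (inner ℝ w p.1) ^ 2) :=
    Real.sq_sqrt (emp_nonneg S fun p => sq_nonneg _)
  -- Adding the two variational inequalities leaves `X ^ 2` at most the noise correlation with `uh -
  -- us`, hence `X ^ 2 ≤ 2 * ρ * X + 3 * ρ ^ 2`, that is `(X - 3 * ρ) * (X + ρ) ≤ 0`.
  have hXle : X ≤ 3 * ρ := by
    have v1 := hmin.variational hs.1
    have v2 := hs.variational hmin.1
    rw [hS'e] at v2
    have e : emp S (fun p => h (inner ℝ w p.1) ^ 2) -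
        emp S (fun p => (p.2 - u (inner ℝ v p.1)) * h (inner ℝ w p.1)) =
        emp S (fun p => (uh (inner ℝ w p.1) - p.2) * (uh (inner ℝ w p.1) - us (inner ℝ w p.1))) +
        emp S (fun p => (us (inner ℝ w p.1) - u (inner ℝ v p.1)) *
          (us (inner ℝ w p.1) - uh (inner ℝ w p.1))) := by
      rw [← emp_add, ← emp_sub]; congr 1; ext p; simp only [h]; ring
    have h2' := h2 h hhl hh0
    have : X ^ 2 ≤ 2 * ρ * X + 3 * ρ ^ 2 := by rw [hX2]; linarith
    nlinarith
  have hcorr := hs.realizable_correlation ha hb hu hr hur (w' := v) (fun i => rfl)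
  rw [hS'e, hS'e] at hcorr
  have hc := h4 us hs.1
  rw [inner_gradAt]
  have e : emp S (fun p => (uh (inner ℝ w p.1) - p.2) * (inner ℝ (w - v) p.1 : ℝ)) =
      emp S (fun p => h (inner ℝ w p.1) * (inner ℝ (w - v) p.1 : ℝ)) +
      emp S (fun p => (us (inner ℝ w p.1) - u (inner ℝ v p.1)) *
        ((inner ℝ w p.1 : ℝ) - inner ℝ v p.1)) -
      emp S (fun p => (p.2 - u (inner ℝ v p.1)) * (inner ℝ (w - v) p.1 : ℝ)) := by
    rw [← emp_add, ← emp_sub]; congr 1; ext p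
    simp only [h, inner_sub_left]; ring
  rw [e]
  have g1 : |emp S (fun p => h (inner ℝ w p.1) * (inner ℝ (w - v) p.1 : ℝ))| ≤
      6 * ρ * ‖w - v‖ := by
    refine (abs_emp_mul_le S _ _).trans ?_
    have : Real.sqrt (emp S (fun p => (inner ℝ (w - v) p.1 : ℝ) ^ 2)) ≤ 2 * ‖w - v‖ := by
      refine Real.sqrt_le_iff.2 ⟨by positivity, h3.trans (le_of_eq (by ring))⟩
    calc _ ≤ 3 * ρ * (2 * ‖w - v‖) := mul_le_mul hXle this (Real.sqrt_nonneg _) (by positivity)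
      _ = _ := by ring
  have g2 := (abs_le.1 g1).1
  have g3 := (abs_le.1 h1).2
  have g4 : 1 / b * c ≤ 1 / b *
      emp S (fun p => (us (inner ℝ w p.1) - u (inner ℝ v p.1)) ^ 2) := by gcongr
  linarith

/-- The gradient is tested against itself. Since the hypotheses are uniform in the direction `q`,
the data-dependent choice `q = g` is allowed. -/
lemma norm_gradAt_le (ha : 0 < a) (hab : a ≤ b) {S : Fin m → Vec d × ℝ} {w v : Vec d}
    {u : ℝ → ℝ} (hu : u ∈ Activations a b) {ρ : ℝ} (hρ : 0 ≤ ρ)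
    (h1 : ∀ q : Vec d, |emp S (fun p => (p.2 - u (inner ℝ v p.1)) * (inner ℝ q p.1 : ℝ))| ≤
      3 * ρ * ‖q‖)
    (h2 : ∀ f : ℝ → ℝ, LipschitzWith b.toNNReal f → f 0 = 0 → ∀ q : Vec d,
      |emp S (fun x => f (inner ℝ w x.1) * (inner ℝ q x.1 : ℝ))| ≤ 3 * b * ‖w‖ * ‖q‖)
    (h3 : ∀ f : ℝ → ℝ, LipschitzWith b.toNNReal f → f 0 = 0 → ∀ q : Vec d,
      |emp S (fun x => f (inner ℝ v x.1) * (inner ℝ q x.1 : ℝ))| ≤ 3 * b * ‖v‖ * ‖q‖) :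
    ‖gradAt a b (w, S)‖ ≤ 3 * b * ‖w‖ + 3 * b * ‖v‖ + 3 * ρ := by
  have hb : 0 < b := by linarith
  set g := gradAt a b (w, S) with hg
  set uh := minimizer a b (w, S) with huh
  have hmin : IsEmpMinimizer a b S w uh := minimizer_spec ha hab (w, S)
  have e : ‖g‖ ^ 2 = emp S (fun p => uh (inner ℝ w p.1) * (inner ℝ g p.1 : ℝ)) -
      emp S (fun p => u (inner ℝ v p.1) * (inner ℝ g p.1 : ℝ)) -
      emp S (fun p => (p.2 - u (inner ℝ v p.1)) * (inner ℝ g p.1 : ℝ)) := by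
    rw [← real_inner_self_eq_norm_sq]
    conv_lhs => rw [hg, inner_gradAt, ← hg]
    rw [← emp_sub, ← emp_sub]; congr 1; ext p; ring
  have g1 := (abs_le.1 (h1 g)).1
  have g2 := (abs_le.1 (h2 uh (activation_lipschitz hb.le hmin.1) hmin.1.1 g)).2
  have g3 := (abs_le.1 (h3 u (activation_lipschitz hb.le hu) hu.1 g)).1
  rcases (norm_nonneg g).eq_or_lt with h0 | h0
  · rw [← h0]; positivity
  · have : ‖g‖ * ‖g‖ ≤ (3 * b * ‖w‖ + 3 * b * ‖v‖ + 3 * ρ) * ‖g‖ := by nlinarith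
    exact le_of_mul_le_mul_right this h0

end Gradient

/-! ### All events of one step together. -/

section Step

variable {d m : ℕ} {a b L R : ℝ} {D : Measure (Vec d × ℝ)} [IsProbabilityMeasure D]

/-- A gradient step on a fresh batch is well-behaved with high probability. -/
lemma gradAt_deviation (hm : 0 < m) (hd : 0 < d) (ha : 0 < a) (hab : a ≤ b) (hL : 0 < L)
    (hR : 0 < R) (hR1 : R ≤ 1) (hD : WellBehaved L R D.fst)
    (hI : ∀ v : Vec d, ∫ p, (inner ℝ v p.1 : ℝ) ^ 2 ∂D ≤ ‖v‖ ^ 2) {v w : Vec d}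
    {u : ℝ → ℝ} (hu : u ∈ Activations a b) {r : ℝ} (hr : 0 < r)
    (hur : ∀ z z', z' ≤ z → r * (z - z') ≤ u z - u z')
    (hξ : MemLp (fun p : Vec d × ℝ => p.2 - u (inner ℝ v p.1)) 2 D) {ρ p T : ℝ} (hρ : 0 < ρ)
    (hξρ : ∫ p, (p.2 - u (inner ℝ v p.1)) ^ 2 ∂D ≤ ρ ^ 2) (hp : 0 < p) (hT : 0 ≤ T)
    (hv : perp v w ≠ 0) {N : ℕ} (hN : 0 < N)
    (hN1 : 12 * ‖v‖ ≤ N * ‖perp v w‖) (hN2 : 12 * b * ‖w‖ ≤ N * (a * ‖perp v w‖))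
    (hc1 : 4 * d * T ^ 2 ≤ m * p) (hc2 : 2 * d * tailBound L T ≤ p ^ 2)
    (hc3 : 4 * b ^ 2 * T ^ 2 * ‖w‖ ^ 2 ≤ ρ ^ 2 * (m * p))
    (hc4 : b ^ 2 * ‖w‖ ^ 2 * tailBound L T ≤ ρ ^ 2 * p ^ 2)
    (hc5 : 1536 / L ^ 6 ≤ 9 * (m * p)) (hc6 : 24 * (N : ℝ) ^ 2 ≤ L * R ^ 2 * (m * p)) :
    (Measure.pi fun _ : Fin m => D) {S | ¬
      (1 / b * (a ^ 2 * L * R ^ 4 / 864 * ‖perp v w‖ ^ 2) - 9 * ρ * ‖w - v‖ ≤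
          inner ℝ (gradAt a b (w, S)) (w - v) ∧
        ‖gradAt a b (w, S)‖ ≤ 3 * b * ‖w‖ + 3 * b * ‖v‖ + 3 * ρ)} ≤
      15 * ENNReal.ofReal p := by
  have hb : 0 < b := by linarith
  have ht := hD.hasExpTails hL
  have hξm : Measurable (fun p : Vec d × ℝ => p.2 - u (inner ℝ v p.1)) := by
    have := (activation_lipschitz hb.le hu).continuous.measurable
    exact measurable_snd.sub (this.comp (by fun_prop))
  have htau : 0 ≤ tailBound L T := by unfold tailBound; positivity
  have hc2' : d * tailBound L T ≤ p ^ 2 := by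
    have : 0 ≤ d * tailBound L T := by positivity
    linarith
  have E1 := noise_correlation_deviation hm hL ht hI hξm hξ hρ hp hξρ hc1 hc2
  have E2 := lipschitz_correlation_deviation hm hd hL ht hI hp hb hT hc1 hc2' w
  have E3 := lipschitz_correlation_deviation hm hd hL ht hI hp hb hT hc1 hc2' v
  have E4 := noise_lipschitz_deviation hm hL ht hξm hξ hρ hp hb hT hξρ w hc3 hc4
  have E5 := second_moment_deviation hm hL ht hI hc5 (w - v)
  have E6 := sharpness_deviation hm ha hb hL hR hR1 hD hv hN hN1 hN2 hp hc6 hu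
  set c := ENNReal.ofReal p
  have hsum : (15 : ENNReal) * c = 3 * c + 3 * c + 3 * c + 4 * c + c + c := by ring
  rw [hsum]
  refine le_trans (measure_mono ?_) ((measure_union_le _ _).trans (add_le_add
    ((measure_union_le _ _).trans (add_le_add ((measure_union_le _ _).trans (add_le_add
    ((measure_union_le _ _).trans (add_le_add ((measure_union_le _ _).trans
    (add_le_add E1 E2)) E3)) E4)) E5)) E6))
  intro S hS
  by_contra hcon
  simp only [Set.mem_union, Set.mem_ofPred_eq, not_or, not_not] at hcon
  obtain ⟨⟨⟨⟨⟨h1, h2⟩, h3⟩, h4⟩, h5⟩, h6⟩ := hcon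
  exact hS ⟨le_inner_gradAt ha hab hu hr hur hρ.le (h1 _) h4 h5 h6,
    norm_gradAt_le ha hab hu hρ.le h1 h2 h3⟩

end Step


/-! ### Making the reference activation strictly increasing. -/

section Regularization

variable {d : ℕ} {a b : ℝ} {D : Measure (Vec d × ℝ)}

/-- A strictly monotone activation whose loss is close to that of `u`. -/
lemma exists_strict_activation (ha : 0 < a) (hab : a ≤ b) {w : Vec d}
    (hw : MemLp (fun p : Vec d × ℝ => (inner ℝ w p.1 : ℝ)) 2 D)
    (hy : MemLp (fun p : Vec d × ℝ => p.2) 2 D) {u : ℝ → ℝ} (hu : u ∈ Activations a b) {ε : ℝ}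
    (hε : 0 < ε) :
    ∃ v ∈ Activations a b, ∃ r : ℝ, 0 < r ∧ (∀ z z', z' ≤ z → r * (z - z') ≤ v z - v z') ∧
      MemLp (fun p : Vec d × ℝ => p.2 - v (inner ℝ w p.1)) 2 D ∧
      ∫ p, (p.2 - v (inner ℝ w p.1)) ^ 2 ∂D ≤ sqLoss D w u + ε := by
  have hb : 0 < b := by linarith
  have hact : ∀ {f : ℝ → ℝ}, f ∈ Activations a b →
      MemLp (fun p : Vec d × ℝ => f (inner ℝ w p.1)) 2 D := by
    intro f hf
    refine MemLp.of_le_mul (c := b) hw ?_ (Filter.Eventually.of_forall fun p => ?_)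
    · exact ((activation_lipschitz hb.le hf).continuous.measurable.comp
        (by fun_prop)).aestronglyMeasurable
    · exact activation_abs_le hf _
  have hlin := linear_mem_activations (a := a) (b := b) hb.le hab le_rfl
  set g : Vec d × ℝ → ℝ := fun p => b * inner ℝ w p.1 - u (inner ℝ w p.1) with hg
  set ξ : Vec d × ℝ → ℝ := fun p => p.2 - u (inner ℝ w p.1) with hξ
  have hgL : MemLp g 2 D := (hact hlin).sub (hact hu)
  have hξL : MemLp ξ 2 D := hy.sub (hact hu)
  set A := 2 * |∫ p, ξ p * g p ∂D| + ∫ p, g p ^ 2 ∂D with hA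
  have hg2 : 0 ≤ ∫ p, g p ^ 2 ∂D := integral_nonneg fun p => sq_nonneg _
  have hA0 : 0 ≤ A := by positivity
  -- Blending in a fraction `l` of the line of slope `b` changes the loss by at most `l * A`, since
  -- `l ^ 2 ≤ l`, and gives slope at least `l * b` everywhere.
  set l := min 1 (ε / (A + 1)) with hl
  have hl0 : 0 < l := by positivity
  have hl1 : l ≤ 1 := min_le_left _ _
  have hlA : l * A ≤ ε := by
    calc l * A ≤ ε / (A + 1) * A := mul_le_mul_of_nonneg_right (min_le_right _ _) hA0
      _ = ε * (A / (A + 1)) := by ring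
      _ ≤ ε * 1 := by
        refine mul_le_mul_of_nonneg_left ?_ hε.le
        rw [div_le_one (by linarith)]; linarith
      _ = ε := mul_one _
  have hv := activation_convex hu hlin hl0.le hl1
  refine ⟨_, hv, l * b, by positivity, fun z z' h => ?_, hy.sub (hact hv), ?_⟩
  · have := hu.2.1 h
    nlinarith [mul_nonneg (sub_nonneg.2 hl1) (sub_nonneg.2 this)]
  · have hξg : Integrable (fun p => ξ p * g p) D := hξL.integrable_mul hgL
    have e : ∀ p : Vec d × ℝ, (p.2 - (u (inner ℝ w p.1) + l * (b * inner ℝ w p.1 -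
        u (inner ℝ w p.1)))) ^ 2 = ξ p ^ 2 + (-2 * l) * (ξ p * g p) + l ^ 2 * g p ^ 2 := by
      intro p; simp only [ξ, g]; ring
    simp only [e]
    have hsum : Integrable (fun p => ξ p ^ 2 + (-2 * l) * (ξ p * g p)) D :=
      hξL.integrable_sq.add (hξg.const_mul _)
    rw [integral_add hsum (hgL.integrable_sq.const_mul _), integral_add hξL.integrable_sq
      (hξg.const_mul _), integral_const_mul, integral_const_mul]
    have e2 : ∫ p, ξ p ^ 2 ∂D = sqLoss D w u := by
      unfold sqLoss
      congr 1; ext p; simp only [ξ]; ring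
    rw [e2]
    have h1 := mul_le_mul_of_nonneg_left (neg_abs_le (∫ p, ξ p * g p ∂D)) hl0.le
    have h2 : l ^ 2 * ∫ p, g p ^ 2 ∂D ≤ l * ∫ p, g p ^ 2 ∂D := by
      gcongr
      nlinarith
    have h3 : l * A = 2 * (l * |∫ p, ξ p * g p ∂D|) + l * ∫ p, g p ^ 2 ∂D := by rw [hA]; ring
    linarith

end Regularization

/-! ### One step of descent, and the numerical bounds behind the parameters. -/

/-- The decrease of the squared distance to `v` in a gradient step. -/
lemma gradient_step_decrease {d : ℕ} {w v g : Vec d} {b μ η ρ V : ℝ} (hb : 1 ≤ b) (hμ : 0 < μ)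
    (hμ1 : μ ≤ 1) (hη : η = μ ^ 3 / (2 ^ 7 * b ^ 4)) (hρ : 0 ≤ ρ)
    (hw : ‖w - v‖ ≤ ‖v‖) (hVv : V ≤ ‖v‖) (hV1 : μ * ‖v‖ / (4 * b) ≤ V)
    (hV2 : 64 * b ^ 2 / μ ^ 3 * ρ ≤ V)
    (h1 : 40 * μ * V ^ 2 - 9 * ρ * ‖w - v‖ ≤ inner ℝ g (w - v))
    (h2 : ‖g‖ ≤ 3 * b * ‖w‖ + 3 * b * ‖v‖ + 3 * ρ) :
    ‖w - η • g - v‖ ^ 2 ≤ ‖w - v‖ ^ 2 - μ ^ 6 / (128 * b ^ 6) * ‖v‖ ^ 2 := by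
  have hb0 : 0 < b := by linarith
  set ν := ‖v‖ with hν
  have hν0 : 0 ≤ ν := norm_nonneg _
  have hη0 : 0 < η := by rw [hη]; positivity
  have hwn : ‖w‖ ≤ 2 * ν := by
    have := norm_add_le (w - v) v
    rw [sub_add_cancel] at this; linarith
  have hV0 : 0 ≤ V := le_trans (by positivity) hV1
  have hνV : μ * ν ≤ 4 * b * V := by
    rw [div_le_iff₀ (by positivity)] at hV1; linarith
  have hρV : 64 * b ^ 2 * ρ ≤ μ ^ 3 * V := by
    rw [div_mul_eq_mul_div, div_le_iff₀ (by positivity)] at hV2; linarith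
  have hμ3 : μ ^ 3 ≤ 1 := pow_le_one₀ hμ.le hμ1
  have hb2 : 1 ≤ b ^ 2 := one_le_pow₀ hb
  have hρν : ρ ≤ ν := by
    have h3 : μ ^ 3 * V ≤ 1 * V := mul_le_mul_of_nonneg_right hμ3 hV0
    have h4 : 1 * ρ ≤ b ^ 2 * ρ := mul_le_mul_of_nonneg_right hb2 hρ
    linarith
  have hgn : ‖g‖ ≤ 12 * b * ν := by
    have h3 := mul_le_mul_of_nonneg_left hwn hb0.le
    have h4 : 1 * ν ≤ b * ν := mul_le_mul_of_nonneg_right hb hν0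
    linarith
  -- Multiplying the two lower bounds on `V`, one in terms of `ρ` and one in terms of `‖v‖`, bounds
  -- `ρ * ‖v‖` by `V ^ 2`. This is why the conclusion is a maximum of these two quantities.
  have hnoise : 9 * ρ * ‖w - v‖ ≤ μ * V ^ 2 := by
    have h3 : 64 * b ^ 2 * ρ * (μ * ν) ≤ μ ^ 3 * V * (4 * b * V) :=
      mul_le_mul hρV hνV (by positivity) (by positivity)
    have h4 : b * μ * (16 * b * (ρ * ν)) ≤ b * μ * (μ ^ 2 * V ^ 2) := by nlinarith
    have h5 := le_of_mul_le_mul_left h4 (by positivity)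
    have h6 : μ ^ 2 * V ^ 2 ≤ μ * V ^ 2 := mul_le_mul_of_nonneg_right (by nlinarith) (sq_nonneg V)
    have h7 : 1 * (ρ * ν) ≤ b * (ρ * ν) := mul_le_mul_of_nonneg_right hb (by positivity)
    have h8 : ρ * ‖w - v‖ ≤ ρ * ν := mul_le_mul_of_nonneg_left hw hρ
    nlinarith [mul_nonneg hρ hν0]
  have hin : 39 * μ * V ^ 2 ≤ inner ℝ g (w - v) := by linarith
  have hVsq : μ ^ 2 * ν ^ 2 ≤ 16 * b ^ 2 * V ^ 2 := by
    have := pow_le_pow_left₀ (by positivity) hνV 2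
    nlinarith
  have hin2 : 39 / 16 * (μ ^ 3 * ν ^ 2 / b ^ 2) ≤ inner ℝ g (w - v) := by
    refine le_trans ?_ hin
    rw [← mul_div_assoc, div_le_iff₀ (by positivity)]
    have := mul_le_mul_of_nonneg_left hVsq hμ.le
    nlinarith
  have hg2 : ‖g‖ ^ 2 ≤ 144 * b ^ 2 * ν ^ 2 := by
    have := pow_le_pow_left₀ (norm_nonneg g) hgn 2
    nlinarith
  have hηg : η * ‖g‖ ^ 2 ≤ 9 / 8 * (μ ^ 3 * ν ^ 2 / b ^ 2) := by
    calc η * ‖g‖ ^ 2 ≤ η * (144 * b ^ 2 * ν ^ 2) := by gcongr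
      _ = _ := by rw [hη]; field_simp; norm_num; ring
  have e : ‖w - η • g - v‖ ^ 2 = ‖w - v‖ ^ 2 - η * (2 * inner ℝ g (w - v) - η * ‖g‖ ^ 2) := by
    rw [sub_right_comm, norm_sub_sq_real, real_inner_smul_right, norm_smul, mul_pow,
      Real.norm_eq_abs, sq_abs, real_inner_comm]
    ring
  rw [e]
  have hx : 0 ≤ μ ^ 3 * ν ^ 2 / b ^ 2 := by positivity
  -- In units of the left-hand side, `39 / 8 - 9 / 8 ≥ 1`.
  have h3 : μ ^ 3 * ν ^ 2 / b ^ 2 ≤ 2 * inner ℝ g (w - v) - η * ‖g‖ ^ 2 := by linarith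
  have h4 := mul_le_mul_of_nonneg_left h3 hη0.le
  have h5 : η * (μ ^ 3 * ν ^ 2 / b ^ 2) = μ ^ 6 / (128 * b ^ 6) * ν ^ 2 := by
    rw [hη]; field_simp; norm_num; ring
  linarith


lemma sqrt_pow_nine {W : ℝ} (hW : 0 ≤ W) : W ^ (9 / 2 : ℝ) = Real.sqrt W ^ 9 := by
  rw [Real.sqrt_eq_rpow, ← Real.rpow_natCast, ← Real.rpow_mul hW]
  norm_num

lemma sqrt_pow_three {ε : ℝ} (hε : 0 ≤ ε) : ε ^ (3 / 2 : ℝ) = Real.sqrt ε ^ 3 := by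
  rw [Real.sqrt_eq_rpow, ← Real.rpow_natCast, ← Real.rpow_mul hε]
  norm_num

/-- The effective sample size per iteration. -/
lemma effective_sample_size {d : ℕ} {b L W ε δ μ t m : ℝ} (hd : 1 ≤ (d : ℝ)) (hb : 1 ≤ b)
    (hL : 0 < L) (hW : 1 ≤ W) (hε : 0 < ε) (hδ : 0 < δ) (hμ : 0 < μ)
    {Λ : ℝ} (hΛ : 1 ≤ Λ) (ht : 0 < t) (ht2 : t ≤ 256 * (b ^ 6 * Real.log (b / μ) / μ ^ 6))
    (hm : 20000000 * (W ^ (9 / 2 : ℝ) * b ^ 10 * d * Λ ^ 4 /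
      (L ^ 4 * μ ^ 6 * δ * ε ^ (3 / 2 : ℝ))) ≤ m)
    (hs : 64 * b ^ 2 / μ ^ 3 * Real.sqrt ε ≤ W) :
    300000 * (Real.sqrt W ^ 7 * b ^ 5 * d * Λ ^ 4) ≤
      m * (δ / (15 * t)) * (L ^ 4 * μ ^ 2 * ε) := by
  have hb0 : 0 < b := by linarith
  have hW0 : 0 < W := by linarith
  set c := Real.sqrt W with hc
  set s := Real.sqrt ε with hs'
  have hc0 : 0 < c := Real.sqrt_pos.2 hW0
  have hs0 : 0 < s := Real.sqrt_pos.2 hε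
  have hcW : W = c ^ 2 := (Real.sq_sqrt hW0.le).symm
  have hsε : ε = s ^ 2 := (Real.sq_sqrt hε.le).symm
  rw [sqrt_pow_nine hW0.le, sqrt_pow_three hε.le, ← hc, ← hs'] at hm
  have hlog : Real.log (b / μ) ≤ b / μ := (Real.log_le_sub_one_of_pos (by positivity)).trans
    (by linarith)
  have ht3 : t ≤ 256 * (b ^ 7 / μ ^ 7) := by
    refine ht2.trans ?_
    calc 256 * (b ^ 6 * Real.log (b / μ) / μ ^ 6) ≤ 256 * (b ^ 6 * (b / μ) / μ ^ 6) := by gcongr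
      _ = _ := by field_simp
  have hp : δ * μ ^ 7 / (3840 * b ^ 7) ≤ δ / (15 * t) := by
    rw [div_le_div_iff₀ (by positivity) (by positivity)]
    have : t * μ ^ 7 ≤ 256 * b ^ 7 := by
      rw [← mul_div_assoc, le_div_iff₀ (by positivity)] at ht3; exact ht3
    nlinarith [mul_le_mul_of_nonneg_left this hδ.le]
  have hs2 : 64 * b ^ 2 * s ≤ c ^ 2 * μ ^ 3 := by
    rw [div_mul_eq_mul_div, div_le_iff₀ (by positivity), hcW] at hs; exact hs
  have hm0 : 0 ≤ m := le_trans (by positivity) hm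
  have h1 : 20000000 * (c ^ 9 * b ^ 10 * d * Λ ^ 4 / (L ^ 4 * μ ^ 6 * δ * s ^ 3)) *
      (δ * μ ^ 7 / (3840 * b ^ 7)) ≤ m * (δ / (15 * t)) :=
    mul_le_mul hm hp (by positivity) hm0
  have h2 : 5000 * (c ^ 9 * b ^ 3 * d * Λ ^ 4 * μ / (L ^ 4 * s ^ 3)) ≤ m * (δ / (15 * t)) := by
    refine le_trans ?_ h1
    have e : 20000000 * (c ^ 9 * b ^ 10 * d * Λ ^ 4 / (L ^ 4 * μ ^ 6 * δ * s ^ 3)) *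
      (δ * μ ^ 7 / (3840 * b ^ 7)) =
      20000000 / 3840 * (c ^ 9 * b ^ 3 * d * Λ ^ 4 * μ / (L ^ 4 * s ^ 3)) := by
      field_simp
    rw [e]
    gcongr
    norm_num
  have h3 := mul_le_mul_of_nonneg_right h2 (by positivity : 0 ≤ L ^ 4 * μ ^ 2 * ε)
  refine le_trans ?_ h3
  have e : 5000 * (c ^ 9 * b ^ 3 * d * Λ ^ 4 * μ / (L ^ 4 * s ^ 3)) * (L ^ 4 * μ ^ 2 * ε) =
      5000 * (c ^ 7 * b ^ 3 * d * Λ ^ 4) * (c ^ 2 * μ ^ 3 / s) := by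
    rw [hsε]; field_simp
  rw [e]
  -- After multiplication by `ε` the half-integer powers leave one factor `W / √ε`, which the
  -- smallness of `ε` relative to `W` converts into `64 * b ^ 2 / μ ^ 3`.
  have h4 : 64 * b ^ 2 ≤ c ^ 2 * μ ^ 3 / s := by rwa [le_div_iff₀ hs0]
  calc 300000 * (c ^ 7 * b ^ 5 * d * Λ ^ 4) ≤
        5000 * (c ^ 7 * b ^ 3 * d * Λ ^ 4) * (64 * b ^ 2) := by
        have : 0 ≤ c ^ 7 * b ^ 5 * d * Λ ^ 4 := by positivity
        nlinarith
    _ ≤ _ := by gcongr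

/-- The choice of the truncation level makes the tails negligible. -/
lemma tailBound_le {d : ℕ} {b L W ε δ μ t : ℝ} (hd : 1 ≤ (d : ℝ)) (hb : 1 ≤ b)
    (hL : 0 < L) (hμL : μ ≤ L) (hW : 1 ≤ W) (hε : 0 < ε) (hδ : 0 < δ)
    (hμ : 0 < μ) (hbμ : 34560 ≤ b / μ) (ht : 0 < t)
    (ht2 : t ≤ 256 * (b ^ 6 * Real.log (b / μ) / μ ^ 6)) (hεW : ε ≤ W ^ 2) :
    4 * b ^ 2 * W ^ 2 * d / ε * tailBound L
      (124 * Real.sqrt W * max 1 (Real.log (d / (ε * δ))) * b / (μ * L)) ≤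
      (δ / (15 * t)) ^ 2 := by
  have hb0 : 0 < b := by linarith
  have hW0 : 0 < W := by linarith
  have hd0 : (0 : ℝ) < d := by linarith
  set Λ := max 1 (Real.log (d / (ε * δ))) with hΛ
  have hΛ1 : 1 ≤ Λ := le_max_left _ _
  set A := (d : ℝ) / (ε * δ) with hA
  have hA0 : 0 < A := by positivity
  have hAΛ : Real.log A ≤ Λ := le_max_right _ _
  set c := Real.sqrt W with hc
  have hc1 : 1 ≤ c := by rw [hc]; exact Real.one_le_sqrt.2 hW
  have hcW : W = c ^ 2 := (Real.sq_sqrt hW0.le).symm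
  set B := b / μ with hB
  have hB1 : 1 ≤ B := by linarith
  have hB0 : 0 < B := by linarith
  have ht3 : 15 * t ≤ 3840 * B ^ 7 := by
    have hlog : Real.log B ≤ B := (Real.log_le_sub_one_of_pos hB0).trans (by linarith)
    have : t ≤ 256 * (b ^ 6 * B / μ ^ 6) := ht2.trans (by gcongr)
    have e : b ^ 6 * B / μ ^ 6 = B ^ 7 := by rw [hB]; field_simp
    rw [e] at this; linarith
  set E := L * (124 * c * Λ * b / (μ * L)) / 4 with hE
  have hEe : E = 31 * (c * Λ * B) := by rw [hE, hB]; field_simp; ring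
  have hlogc : Real.log c ≤ c := (Real.log_le_sub_one_of_pos (by linarith)).trans (by linarith)
  have hlogB : Real.log B ≤ B := (Real.log_le_sub_one_of_pos hB0).trans (by linarith)
  -- In logarithms: `8 * log c + 2 * log A + 21 * log B`, each logarithm being at most `c * Λ * B`,
  -- and `8 + 2 + 21 = 31`; this fixes `124 = 4 * 31` in the truncation level. Of the power 21,
  -- fourteen pay for the squared failure probability, four for `b ^ 2 / L ^ 4`, three for numerical
  -- constants.
  have hbig : W ^ 4 * A ^ 2 * B ^ 21 ≤ Real.exp E := by
    rw [← Real.log_le_iff_le_exp (by positivity), Real.log_mul (by positivity) (by positivity),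
      Real.log_mul (by positivity) (by positivity), Real.log_pow, Real.log_pow, Real.log_pow, hcW,
      Real.log_pow, hEe]
    have k1 : c ≤ c * Λ * B := by
      calc c = c * 1 * 1 := by ring
        _ ≤ c * Λ * B := by gcongr
    have k2 : Λ ≤ c * Λ * B := by
      calc Λ = 1 * Λ * 1 := by ring
        _ ≤ c * Λ * B := by gcongr
    have k3 : B ≤ c * Λ * B := by
      calc B = 1 * 1 * B := by ring
        _ ≤ c * Λ * B := by gcongr
    push_cast
    linarith
  have hexp : Real.exp (-E) ≤ 1 / (W ^ 4 * A ^ 2 * B ^ 21) := by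
    rw [Real.exp_neg, ← one_div]
    exact one_div_le_one_div_of_le (by positivity) hbig
  have hbB : b ^ 2 / L ^ 4 ≤ B ^ 4 := by
    rw [hB, div_pow]
    calc b ^ 2 / L ^ 4 ≤ b ^ 4 / L ^ 4 := by gcongr; norm_num
      _ ≤ _ := by gcongr
  have hp : δ / (3840 * B ^ 7) ≤ δ / (15 * t) := by gcongr
  have hBc : 512 * 3840 ^ 2 ≤ B ^ 3 := by
    calc (512 : ℝ) * 3840 ^ 2 ≤ 34560 ^ 3 := by norm_num
      _ ≤ B ^ 3 := by gcongr
  unfold tailBound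
  rw [← hE]
  calc 4 * b ^ 2 * W ^ 2 * d / ε * (128 / L ^ 4 * Real.exp (-E))
      ≤ 4 * b ^ 2 * W ^ 2 * d / ε * (128 / L ^ 4 * (1 / (W ^ 4 * A ^ 2 * B ^ 21))) := by gcongr
    _ = 512 * (b ^ 2 / L ^ 4) * (ε * δ ^ 2 / (W ^ 2 * d)) * (1 / B ^ 21) := by
        rw [hA]; field_simp; norm_num
    _ ≤ 512 * B ^ 4 * (1 * δ ^ 2) * (1 / B ^ 21) := by
        gcongr
        rw [div_le_iff₀ (by positivity), one_mul, mul_comm ε]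
        have : ε ≤ W ^ 2 * d := hεW.trans (by nlinarith [sq_nonneg W])
        gcongr
    _ = 512 / B ^ 3 * (δ / B ^ 7) ^ 2 := by field_simp
    _ ≤ 1 / 3840 ^ 2 * (δ / B ^ 7) ^ 2 := by
        refine mul_le_mul_of_nonneg_right ?_ (by positivity)
        rw [div_le_div_iff₀ (by positivity) (by positivity)]; linarith
    _ = (δ / (3840 * B ^ 7)) ^ 2 := by field_simp
    _ ≤ (δ / (15 * t)) ^ 2 := by gcongr


lemma exists_isInitRun {d m T : ℕ} {a b η : ℝ} (ha : 0 < a) (hab : a ≤ b)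
    (S : Fin T → Fin m → Vec d × ℝ) : ∃ w, IsInitRun a b η S w := by
  obtain ⟨w, hw0, hw⟩ := exists_trajectory
    (fun q : Vec d × (Fin m → Vec d × ℝ) => q.1 - η • gradAt a b q) (0 : Vec d) S
  exact ⟨w, hw0, fun t => ⟨_, minimizer_spec ha hab (w t.castSucc, S t), hw t⟩⟩

/-- Consequences of the lower bound on the effective sample size `M`. -/
lemma sample_size_bounds {b c d L W ε μ Λ M T : ℝ} (hb : 1 ≤ b) (hc1 : 1 ≤ c) (hcW : W = c ^ 2)
    (hd1 : 1 ≤ d) (hL : 0 < L) (hL1 : L ≤ 1) (hμ0 : 0 < μ) (hμ1 : μ ≤ 1) (hμL' : 34560 * μ ≤ L)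
    (hε : 0 < ε) (hΛ1 : 1 ≤ Λ) (hM0 : 0 < M) (hεW : ε * (4096 * b ^ 4) ≤ W ^ 2 * μ ^ 6)
    (hεW' : ε ≤ W ^ 2) (hTsq : T ^ 2 * (μ ^ 2 * L ^ 2) = 15376 * (c ^ 2 * Λ ^ 2 * b ^ 2))
    (hM : 300000 * (c ^ 7 * b ^ 5 * d * Λ ^ 4) ≤ M * (L ^ 4 * μ ^ 2 * ε)) :
    16 * b ^ 2 * T ^ 2 * W ^ 2 * d ≤ ε * M ∧ 4 * d * T ^ 2 ≤ M ∧ 1536 / L ^ 6 ≤ 9 * M ∧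
      10 * (b ^ 3 / μ ^ 3) ≤ M := by
  have hb0 : 0 < b := by linarith
  have hc0 : 0 < c := by linarith
  have hL4 : L ^ 4 ≤ L ^ 2 := pow_le_pow_of_le_one hL.le hL1 (by norm_num)
  have hcond3 : 16 * b ^ 2 * T ^ 2 * W ^ 2 * d ≤ ε * M := by
    have h1 : 300000 * (c ^ 6 * b ^ 4 * d * Λ ^ 2) ≤ 300000 * (c ^ 7 * b ^ 5 * d * Λ ^ 4) := by
      gcongr <;> first | assumption | norm_num
    have h2 : M * (L ^ 4 * μ ^ 2 * ε) ≤ M * (L ^ 2 * μ ^ 2 * ε) := by gcongr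
    have h3 : 16 * b ^ 2 * T ^ 2 * W ^ 2 * d * (μ ^ 2 * L ^ 2) =
        246016 * (c ^ 6 * b ^ 4 * d * Λ ^ 2) := by
      calc _ = 16 * b ^ 2 * W ^ 2 * d * (T ^ 2 * (μ ^ 2 * L ^ 2)) := by ring
        _ = _ := by rw [hTsq, hcW]; ring
    have h4 : 0 ≤ c ^ 6 * b ^ 4 * d * Λ ^ 2 := by positivity
    have h5 : 16 * b ^ 2 * T ^ 2 * W ^ 2 * d * (μ ^ 2 * L ^ 2) ≤ ε * M * (μ ^ 2 * L ^ 2) := by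
      rw [h3]; linarith
    exact le_of_mul_le_mul_right h5 (by positivity)
  have hcond1 : 4 * d * T ^ 2 ≤ M := by
    have h1 : ε * (4 * d * T ^ 2) ≤ W ^ 2 * (4 * d * T ^ 2) := by gcongr
    have h2 : W ^ 2 * (4 * d * T ^ 2) * 1 ≤ W ^ 2 * (4 * d * T ^ 2) * (4 * b ^ 2) := by
      gcongr; nlinarith
    refine le_of_mul_le_mul_left (?_ : ε * (4 * d * T ^ 2) ≤ ε * M) hε
    linarith
  -- The upper bound on `ε` removes `ε` and `W` from the sample-size condition.
  have hbig : 300000 * b ^ 5 * (4096 * b ^ 4) ≤ M * μ ^ 8 := by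
    have h1 : 300000 * (1 * b ^ 5 * 1 * 1) * c ^ 4 ≤ 300000 * (c ^ 7 * b ^ 5 * d * Λ ^ 4) := by
      have h2 : 1 * b ^ 5 * 1 * 1 ≤ c ^ 3 * b ^ 5 * d * Λ ^ 4 := by
        gcongr <;> exact one_le_pow₀ (by assumption)
      have := mul_le_mul_of_nonneg_right h2 (by positivity : 0 ≤ c ^ 4)
      linarith
    have h3 : M * (L ^ 4 * μ ^ 2 * ε) * (4096 * b ^ 4) ≤ M * μ ^ 8 * c ^ 4 := by
      calc _ = M * (L ^ 4 * μ ^ 2) * (ε * (4096 * b ^ 4)) := by ring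
        _ ≤ M * (1 * μ ^ 2) * (W ^ 2 * μ ^ 6) := by
          gcongr; exact pow_le_one₀ hL.le hL1
        _ = _ := by rw [hcW]; ring
    have h4 := mul_le_mul_of_nonneg_right (h1.trans hM) (by positivity : 0 ≤ 4096 * b ^ 4)
    refine le_of_mul_le_mul_right (?_ : _ * c ^ 4 ≤ _ * c ^ 4) (by positivity)
    linarith
  have hb4 : 1 ≤ b ^ 4 := one_le_pow₀ hb
  have hb5 : 1 ≤ b ^ 5 := one_le_pow₀ hb
  have hb9 : 300000 * b ^ 5 * (4096 * 1) ≤ 300000 * b ^ 5 * (4096 * b ^ 4) := by gcongr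
  have hcond5 : 1536 / L ^ 6 ≤ 9 * M := by
    have h1 : 1536 / L ^ 6 ≤ 1536 / (34560 * μ) ^ 6 := by gcongr
    refine h1.trans ?_
    have : μ ^ 8 ≤ μ ^ 6 := pow_le_pow_of_le_one hμ0.le hμ1 (by norm_num)
    have := mul_le_mul_of_nonneg_left this hM0.le
    rw [div_le_iff₀ (by positivity), mul_pow]
    linarith
  have hM2 : 10 * (b ^ 3 / μ ^ 3) ≤ M := by
    have k6 : b ^ 3 ≤ b ^ 5 := pow_le_pow_right₀ hb (by norm_num)
    have : μ ^ 8 ≤ μ ^ 3 := pow_le_pow_of_le_one hμ0.le hμ1 (by norm_num)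
    have := mul_le_mul_of_nonneg_left this hM0.le
    rw [← mul_div_assoc, div_le_iff₀ (by positivity)]
    linarith
  exact ⟨hcond3, hcond1, hcond5, hM2⟩

/-- The number of cells used to discretise the angle to `v`. -/
lemma exists_cell_count {a b L R μ M V x y : ℝ} (ha : 0 < a) (ha1 : a ≤ 1) (hb : 1 ≤ b)
    (hL : 0 < L) (hR : 0 < R) (hR1 : R ≤ 1) (hμ0 : 0 < μ) (hμ1 : μ ≤ 1)
    (hμb : 34560 * μ * b = a ^ 2 * L * R ^ 4) (hM2 : 10 * (b ^ 3 / μ ^ 3) ≤ M)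
    (hV0 : 0 < V) (hvV : μ * y ≤ 4 * b * V) (hwn' : x ≤ 2 * y) :
    ∃ N : ℕ, 0 < N ∧ 12 * b * x ≤ N * (a * V) ∧ 12 * y ≤ N * V ∧
      24 * (N : ℝ) ^ 2 ≤ L * R ^ 2 * M := by
  have hb0 : 0 < b := by linarith
  -- From `x ≤ 2 * y` and `μ * y ≤ 4 * b * V`: `12 * b * x * μ ≤ 24 * b * (4 * b * V) = 96 * b ^ 2 *
  -- V`.
  set N := ⌈96 * b ^ 2 / (a * μ)⌉₊ with hN
  have hq0 : 0 < 96 * b ^ 2 / (a * μ) := by positivity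
  have hN0 : 0 < N := Nat.ceil_pos.2 hq0
  have hN1 : 96 * b ^ 2 / (a * μ) ≤ N := Nat.le_ceil _
  have hN2 : (N : ℝ) ≤ 97 * b ^ 2 / (a * μ) := by
    have h1 := (Nat.ceil_lt_add_one hq0.le).le
    have h2 : 1 ≤ b ^ 2 / (a * μ) := by
      rw [le_div_iff₀ (by positivity)]
      nlinarith
    have h3 : 97 * b ^ 2 / (a * μ) = 96 * b ^ 2 / (a * μ) + b ^ 2 / (a * μ) := by ring
    rw [h3]; linarith
  have hNa : 96 * b ^ 2 ≤ N * a * μ := by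
    rw [div_le_iff₀ (by positivity)] at hN1; linarith
  have hcN2 : 12 * b * x ≤ N * (a * V) := by
    refine le_of_mul_le_mul_right (?_ : 12 * b * x * μ ≤ N * (a * V) * μ) hμ0
    calc 12 * b * x * μ ≤ 12 * b * (2 * y) * μ := by gcongr
      _ = 24 * b * (μ * y) := by ring
      _ ≤ 24 * b * (4 * b * V) := by gcongr
      _ = 96 * b ^ 2 * V := by ring
      _ ≤ N * a * μ * V := by gcongr
      _ = _ := by ring
  have hcN1 : 12 * y ≤ N * V := by
    refine le_of_mul_le_mul_right (?_ : 12 * y * μ ≤ N * V * μ) hμ0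
    calc 12 * y * μ = 12 * (μ * y) := by ring
      _ ≤ 12 * (4 * b * V) := by gcongr
      _ ≤ 96 * b ^ 2 * V := by nlinarith [mul_nonneg hb0.le hV0.le]
      _ ≤ N * a * μ * V := by gcongr
      _ ≤ N * 1 * μ * V := by gcongr
      _ = _ := by ring
  have hcond6 : 24 * (N : ℝ) ^ 2 ≤ L * R ^ 2 * M := by
    have h1 : (N : ℝ) ^ 2 ≤ (97 * b ^ 2 / (a * μ)) ^ 2 := by gcongr
    have h2 : (97 * b ^ 2 / (a * μ)) ^ 2 * a ^ 2 = 9409 * b ^ 4 / μ ^ 2 := by field_simp; norm_num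
    have h3 : 34560 * μ * b ≤ a ^ 2 * (L * R ^ 2) := by
      rw [hμb]
      have : R ^ 4 ≤ R ^ 2 := pow_le_pow_of_le_one hR.le hR1 (by norm_num)
      have := mul_le_mul_of_nonneg_left this (by positivity : 0 ≤ a ^ 2 * L)
      linarith
    refine le_of_mul_le_mul_left (?_ : a ^ 2 * (24 * (N : ℝ) ^ 2) ≤ a ^ 2 * (L * R ^ 2 * M))
      (by positivity)
    calc a ^ 2 * (24 * (N : ℝ) ^ 2) ≤ a ^ 2 * (24 * (97 * b ^ 2 / (a * μ)) ^ 2) := by gcongr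
      _ = 24 * ((97 * b ^ 2 / (a * μ)) ^ 2 * a ^ 2) := by ring
      _ = 24 * 9409 * (b ^ 4 / μ ^ 2) := by rw [h2]; ring
      _ ≤ 345600 * (b ^ 4 / μ ^ 2) := by gcongr; norm_num
      _ = 34560 * μ * b * (10 * (b ^ 3 / μ ^ 3)) := by field_simp; norm_num
      _ ≤ a ^ 2 * (L * R ^ 2) * M := by gcongr
      _ = _ := by ring
  exact ⟨N, hN0, hcN2, hcN1, hcond6⟩

/-! ### Assembly: failure probability of a step, length of the run, and the theorem. -/

set_option maxHeartbeats 1000000 in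
/-- The probability that a step from a fixed point `w` fails to decrease the distance to `v`. -/
lemma step_deviation {d m : ℕ} {a b L R W ε δ μ η t : ℝ} {D : Measure (Vec d × ℝ)}
    [IsProbabilityMeasure D] (hd : 0 < d) (ha : 0 < a) (ha1 : a ≤ 1) (hb : 1 ≤ b) (hL : 0 < L)
    (hL1 : L ≤ 1) (hR : 0 < R) (hR1 : R ≤ 1) (hW : 1 ≤ W) (hε : 0 < ε) (hδ : 0 < δ)
    (hD : WellBehaved L R D.fst)
    (hI : ∀ v : Vec d, ∫ p, (inner ℝ v p.1 : ℝ) ^ 2 ∂D ≤ ‖v‖ ^ 2)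
    (hy : MemLp (fun p : Vec d × ℝ => p.2) 2 D) {v w : Vec d} {u : ℝ → ℝ} (hvW : ‖v‖ ≤ W)
    (hu : u ∈ Activations a b) (hμ : μ = 1 / 34560 * a ^ 2 * L * R ^ 4 / b)
    (hη : η = μ ^ 3 / (2 ^ 7 * b ^ 4))
    (hm : 20000000 * (W ^ (9 / 2 : ℝ) * b ^ 10 * d * (max 1 (Real.log (d / (ε * δ)))) ^ 4 /
      (L ^ 4 * μ ^ 6 * δ * ε ^ (3 / 2 : ℝ))) ≤ m) (ht : 0 < t)
    (ht2 : t ≤ 256 * (b ^ 6 * Real.log (b / μ) / μ ^ 6)) (hw : ‖w - v‖ ≤ ‖v‖)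
    (hV1 : μ * ‖v‖ / (4 * b) < ‖perp v w‖)
    (hV2 : 64 * b ^ 2 / μ ^ 3 * (Real.sqrt (sqLoss D v u) + Real.sqrt ε) < ‖perp v w‖) :
    (Measure.pi fun _ : Fin m => D) {S | ‖w - v‖ ^ 2 - μ ^ 6 / (128 * b ^ 6) * ‖v‖ ^ 2 <
      ‖w - η • gradAt a b (w, S) - v‖ ^ 2} ≤ ENNReal.ofReal (δ / t) := by
  have hb0 : 0 < b := by linarith
  have hab : a ≤ b := by linarith
  have hμ0 : 0 < μ := by rw [hμ]; positivity
  have ha2 : a ^ 2 ≤ 1 := pow_le_one₀ ha.le ha1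
  have hR4 : R ^ 4 ≤ 1 := pow_le_one₀ hR.le hR1
  have hμb : 34560 * μ * b = a ^ 2 * L * R ^ 4 := by rw [hμ]; field_simp
  have hμL' : 34560 * μ ≤ L := by
    have h1 : a ^ 2 * L * R ^ 4 ≤ 1 * L * 1 := by gcongr
    have h2 : 34560 * μ * 1 ≤ 34560 * μ * b := by gcongr
    linarith
  have hμL : μ ≤ L := by linarith
  have hμ1 : μ ≤ 1 := by linarith
  have hbμ : 34560 ≤ b / μ := by rw [le_div_iff₀ hμ0]; linarith
  have hd1 : (1 : ℝ) ≤ d := by exact_mod_cast hd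
  have hW0 : 0 < W := by linarith
  set Λ := max 1 (Real.log (d / (ε * δ))) with hΛ
  have hΛ1 : 1 ≤ Λ := le_max_left _ _
  set ρ := Real.sqrt (sqLoss D v u) + Real.sqrt ε with hρdef
  have hloss : 0 ≤ sqLoss D v u := integral_nonneg fun p => sq_nonneg _
  have hsε : 0 < Real.sqrt ε := Real.sqrt_pos.2 hε
  have hρ : 0 < ρ := add_pos_of_nonneg_of_pos (Real.sqrt_nonneg _) hsε
  have hρ2 : sqLoss D v u + ε ≤ ρ ^ 2 := by
    rw [hρdef, add_sq, Real.sq_sqrt hloss, Real.sq_sqrt hε.le]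
    have : 0 ≤ 2 * Real.sqrt (sqLoss D v u) * Real.sqrt ε := by positivity
    linarith
  have hερ : ε ≤ ρ ^ 2 := by linarith
  set V := ‖perp v w‖ with hV
  have hVv : V ≤ ‖v‖ := norm_perp_le v w
  have hV0 : 0 < V := lt_of_le_of_lt (by positivity) hV1
  -- An upper bound on `ε` comes for free from `V ≤ ‖v‖ ≤ W`: for larger `ε` the iterate would
  -- already be close enough.
  have hs : 64 * b ^ 2 / μ ^ 3 * Real.sqrt ε ≤ W := by
    have : 64 * b ^ 2 / μ ^ 3 * Real.sqrt ε ≤ 64 * b ^ 2 / μ ^ 3 * ρ := by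
      gcongr; rw [hρdef]; linarith [Real.sqrt_nonneg (sqLoss D v u)]
    linarith
  have hεW : ε * (4096 * b ^ 4) ≤ W ^ 2 * μ ^ 6 := by
    rw [div_mul_eq_mul_div, div_le_iff₀ (by positivity)] at hs
    have := pow_le_pow_left₀ (by positivity) hs 2
    rw [mul_pow, Real.sq_sqrt hε.le] at this
    nlinarith
  have hb4 : 1 ≤ b ^ 4 := one_le_pow₀ hb
  have hμ6 : μ ^ 6 ≤ 1 := pow_le_one₀ hμ0.le hμ1
  have hεW' : ε ≤ W ^ 2 := by
    have h1 : ε * 1 ≤ ε * (4096 * b ^ 4) := by gcongr; linarith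
    have h2 : W ^ 2 * μ ^ 6 ≤ W ^ 2 * 1 := by gcongr
    linarith
  have hM := effective_sample_size hd1 hb hL hW hε hδ hμ0 hΛ1 ht ht2 hm hs
  have hτ := tailBound_le hd1 hb hL hμL hW hε hδ hμ0 hbμ ht ht2 hεW'
  rw [← hΛ] at hτ
  set p := δ / (15 * t) with hp
  set M := (m : ℝ) * p with hMdef
  set T := 124 * Real.sqrt W * Λ * b / (μ * L) with hT
  set c := Real.sqrt W with hc
  have hp0 : 0 < p := by positivity
  have hc1 : 1 ≤ c := Real.one_le_sqrt.2 hW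
  have hc0 : 0 < c := by linarith
  have hcW : W = c ^ 2 := (Real.sq_sqrt hW0.le).symm
  have hT0 : 0 ≤ T := by positivity
  have hτ0 : 0 ≤ tailBound L T := by unfold tailBound; positivity
  have hm0 : 0 < m := by
    have : (0 : ℝ) < m := lt_of_lt_of_le (by positivity) hm
    exact_mod_cast this
  have hM0 : 0 < M := by
    have : (0 : ℝ) < m := by exact_mod_cast hm0
    positivity
  have hTsq : T ^ 2 * (μ ^ 2 * L ^ 2) = 15376 * (c ^ 2 * Λ ^ 2 * b ^ 2) := by
    rw [hT]; field_simp; norm_num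
  have hwn : ‖w‖ ≤ 2 * W := by
    have := norm_add_le (w - v) v
    rw [sub_add_cancel] at this; linarith
  obtain ⟨hcond3, hcond1, hcond5, hM2⟩ := sample_size_bounds hb hc1 hcW hd1 hL hL1 hμ0 hμ1 hμL' hε
    hΛ1 hM0 hεW hεW' hTsq hM
  have hvV : μ * ‖v‖ ≤ 4 * b * V := by
    rw [div_lt_iff₀ (by positivity)] at hV1; linarith
  have hwn' : ‖w‖ ≤ 2 * ‖v‖ := by
    have := norm_add_le (w - v) v
    rw [sub_add_cancel] at this; linarith
  obtain ⟨N, hN0, hcN2, hcN1, hcond6⟩ := exists_cell_count ha ha1 hb hL hR hR1 hμ0 hμ1 hμb hM2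
    hV0 hvV hwn'
  have hcond2 : 2 * d * tailBound L T ≤ p ^ 2 := by
    refine le_trans ?_ hτ
    gcongr
    rw [le_div_iff₀ hε]
    have h1 : 2 * (d : ℝ) * ε ≤ 2 * d * W ^ 2 := by gcongr
    have h2 : (1 : ℝ) * (d * W ^ 2) ≤ b ^ 2 * (d * W ^ 2) := by
      gcongr; exact one_le_pow₀ hb
    have h3 : 0 ≤ (d : ℝ) * W ^ 2 := by positivity
    linarith
  have hcond4 : b ^ 2 * ‖w‖ ^ 2 * tailBound L T ≤ ρ ^ 2 * p ^ 2 := by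
    have h1 : b ^ 2 * ‖w‖ ^ 2 * tailBound L T ≤ b ^ 2 * (2 * W) ^ 2 * tailBound L T * d := by
      calc _ ≤ b ^ 2 * (2 * W) ^ 2 * tailBound L T := by gcongr
        _ = b ^ 2 * (2 * W) ^ 2 * tailBound L T * 1 := by ring
        _ ≤ _ := by gcongr
    have h2 : b ^ 2 * (2 * W) ^ 2 * tailBound L T * d =
        ε * (4 * b ^ 2 * W ^ 2 * d / ε * tailBound L T) := by field_simp; ring
    rw [h2] at h1
    refine h1.trans ?_
    gcongr
  have hcond3' : 4 * b ^ 2 * T ^ 2 * ‖w‖ ^ 2 ≤ ρ ^ 2 * M := by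
    calc 4 * b ^ 2 * T ^ 2 * ‖w‖ ^ 2 ≤ 4 * b ^ 2 * T ^ 2 * (2 * W) ^ 2 := by gcongr
      _ = 16 * b ^ 2 * T ^ 2 * W ^ 2 * 1 := by ring
      _ ≤ 16 * b ^ 2 * T ^ 2 * W ^ 2 * d := by gcongr
      _ ≤ ε * M := hcond3
      _ ≤ ρ ^ 2 * M := by gcongr
  -- The reference activation is regularized at cost `ε`, which `ρ ^ 2` covers. The slope `r` enters
  -- no quantitative bound.
  obtain ⟨u', hu', r, hr, hur, hξ, hξε⟩ := exists_strict_activation ha hab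
    ((hD.hasExpTails hL).memLp hL v) hy hu hε
  have hvne : perp v w ≠ 0 := norm_pos_iff.1 hV0
  have key := gradAt_deviation hm0 hd ha hab hL hR hR1 hD hI hu' hr hur hξ hρ (hξε.trans hρ2)
    hp0 hT0 hvne hN0 hcN1 hcN2 hcond1 hcond2 hcond3' hcond4 hcond5 hcond6
  have e15 : (15 : ENNReal) * ENNReal.ofReal p = ENNReal.ofReal (δ / t) := by
    rw [show (15 : ENNReal) = ENNReal.ofReal 15 by simp, ← ENNReal.ofReal_mul (by norm_num), hp]
    congr 1; field_simp
  rw [e15] at key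
  refine (measure_mono ?_).trans key
  intro S hS
  by_contra hcon
  simp only [Set.mem_ofPred_eq, not_not] at hcon
  have hg := gradient_step_decrease hb hμ0 hμ1 hη hρ.le hw hVv hV1.le hV2.le
    (g := gradAt a b (w, S)) (by
      refine le_trans (le_of_eq ?_) hcon.1
      -- Here `34560 = 40 * 864`, which fixes the constant in `μ`.
      have : 1 / b * (a ^ 2 * L * R ^ 4 / 864 * V ^ 2) = 40 * μ * V ^ 2 := by
        rw [← hμb]; field_simp; norm_num
      rw [this]) hcon.2
  exact absurd hS (not_lt.2 hg)

lemma measurable_perp {d : ℕ} (v : Vec d) : Measurable (perp v) := by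
  unfold perp
  fun_prop

/-- The number of steps suffices, with the guaranteed decrease per step, to exhaust `x`. -/
lemma lt_floor_mul_decrease {a b L R μ x : ℝ} {t : ℕ} (ha : 0 < a) (ha1 : a ≤ 1) (hb : 1 ≤ b)
    (hL : 0 < L) (hL1 : L ≤ 1) (hR : 0 < R) (hR1 : R ≤ 1)
    (hμ : μ = 1 / 34560 * a ^ 2 * L * R ^ 4 / b)
    (ht : t = ⌊256 * (b ^ 6 * Real.log (b / μ) / μ ^ 6)⌋₊) (hx0 : 0 < x) :
    (0 : ℝ) < t ∧ (t : ℝ) ≤ 256 * (b ^ 6 * Real.log (b / μ) / μ ^ 6) ∧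
      x < t * (μ ^ 6 / (128 * b ^ 6) * x) := by
  have hb0 : 0 < b := by linarith
  have hμ0 : 0 < μ := by rw [hμ]; positivity
  have hbμ : 34560 * μ ≤ b := by
    have h1 : a ^ 2 * L * R ^ 4 ≤ 1 * 1 * 1 := by
      gcongr
      · exact pow_le_one₀ ha.le ha1
      · exact pow_le_one₀ hR.le hR1
    have h2 : 34560 * μ * b = a ^ 2 * L * R ^ 4 := by rw [hμ]; field_simp
    nlinarith
  have hx : b ^ 6 / μ ^ 6 ≤ b ^ 6 * Real.log (b / μ) / μ ^ 6 := by
    have h1 : 1 ≤ Real.log (b / μ) := by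
      rw [Real.le_log_iff_exp_le (by positivity), le_div_iff₀ hμ0]
      have := Real.exp_one_lt_d9
      nlinarith
    gcongr
    exact le_mul_of_one_le_right (by positivity) h1
  have hx1 : 1 ≤ b ^ 6 / μ ^ 6 := by
    rw [one_le_div (by positivity)]
    gcongr; linarith
  have htx : (t : ℝ) ≤ 256 * (b ^ 6 * Real.log (b / μ) / μ ^ 6) := by
    rw [ht]; exact Nat.floor_le (by linarith)
  -- The constant 256 is twice what the potential argument needs; the slack absorbs the rounding, as
  -- `log (b / μ) ≥ 1` and `b ^ 6 / μ ^ 6 ≥ 1`.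
  have ht1 : 128 * (b ^ 6 / μ ^ 6) < t := by
    have := Nat.lt_floor_add_one (256 * (b ^ 6 * Real.log (b / μ) / μ ^ 6))
    rw [← ht] at this
    linarith
  have ht0 : (0 : ℝ) < t := lt_trans (by positivity) ht1
  refine ⟨ht0, htx, ?_⟩
  have h1 : 1 < t * (μ ^ 6 / (128 * b ^ 6)) := by
    calc (1 : ℝ) = 128 * (b ^ 6 / μ ^ 6) * (μ ^ 6 / (128 * b ^ 6)) := by field_simp
      _ < _ := by gcongr
  rw [← mul_assoc]
  exact lt_mul_of_one_lt_left (by positivity) h1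

/-- If no step of the iteration fails and no iterate is close, the distances decrease. -/
lemma dist_sq_le_of_notMem {d t m : ℕ} {F : Vec d × (Fin m → Vec d × ℝ) → Vec d} {v : Vec d}
    {κ τ : ℝ} (hκ0 : 0 ≤ κ) {S : Fin t → Fin m → Vec d × ℝ} {w : Fin (t + 1) → Vec d}
    (hw : w 0 = 0) (hstep : ∀ s : Fin t, w s.succ = F (w s.castSucc, S s))
    (hno : ∀ s, τ < ‖perp v (w s)‖)
    (hgood : ∀ s : Fin t, ¬ (‖w s.castSucc - v‖ ≤ ‖v‖ ∧ τ < ‖perp v (w s.castSucc)‖ ∧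
      ‖w s.castSucc - v‖ ^ 2 - κ < ‖F (w s.castSucc, S s) - v‖ ^ 2)) (s : Fin (t + 1)) :
    ‖w s - v‖ ^ 2 ≤ ‖v‖ ^ 2 - (s : ℕ) * κ := by
  induction s using Fin.induction with
  | zero => rw [hw]; simp
  | succ s ih =>
    have h1 : ‖w s.castSucc - v‖ ≤ ‖v‖ := by
      refine le_of_sq_le_sq (ih.trans ?_) (norm_nonneg _)
      have : 0 ≤ ((s.castSucc : ℕ) : ℝ) * κ := by positivity
      linarith
    have h2 := hgood s
    simp only [not_and, not_lt] at h2
    have h3 := h2 h1 (hno _)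
    rw [← hstep] at h3
    rw [Fin.val_succ]
    rw [Fin.val_castSucc] at ih
    push_cast
    linarith

set_option maxHeartbeats 1000000 in
/-- Some iterate of every run started from independent batches is close to the line of `v`. -/
theorem measure_forall_far_le {d m t : ℕ} {a b L R W ε δ μ η : ℝ}
    (ha : 0 < a) (ha1 : a ≤ 1) (hb : 1 ≤ b) (hL : 0 < L) (hL1 : L ≤ 1) (hR : 0 < R) (hR1 : R ≤ 1)
    (hW : 1 ≤ W) (hε : 0 < ε) (hδ : 0 < δ) {D : Measure (Vec d × ℝ)} [IsProbabilityMeasure D]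
    (hD : WellBehaved L R D.fst)
    (hI : ∀ v : Vec d, ∫ x, (inner ℝ v x : ℝ) ^ 2 ∂D.fst ≤ ‖v‖ ^ 2)
    (hy : Integrable (fun p : Vec d × ℝ => p.2 ^ 2) D) {v : Vec d} {u : ℝ → ℝ} (hvW : ‖v‖ ≤ W)
    (hu : u ∈ Activations a b) (hμ : μ = 1 / 34560 * a ^ 2 * L * R ^ 4 / b)
    (hη : η = μ ^ 3 / (2 ^ 7 * b ^ 4))
    (hm : 20000000 * (W ^ (9 / 2 : ℝ) * b ^ 10 * d * (max 1 (Real.log (d / (ε * δ)))) ^ 4 /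
      (L ^ 4 * μ ^ 6 * δ * ε ^ (3 / 2 : ℝ))) ≤ m)
    (ht : t = ⌊256 * (b ^ 6 * Real.log (b / μ) / μ ^ 6)⌋₊) :
    batchLaw D t m {S | (∃ w, IsInitRun a b η S w) ∧ ∀ w, IsInitRun a b η S w →
      ∃ s : Fin (t + 1), ‖perp v (w s)‖ ≤ max (μ * ‖v‖ / (4 * b))
        (64 * b ^ 2 / μ ^ 3 * (Real.sqrt (sqLoss D v u) + Real.sqrt ε))}ᶜ ≤ ENNReal.ofReal δ := by
  have hab : a ≤ b := ha1.trans hb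
  have hb0 : 0 < b := by linarith
  set τ := max (μ * ‖v‖ / (4 * b)) (64 * b ^ 2 / μ ^ 3 *
    (Real.sqrt (sqLoss D v u) + Real.sqrt ε)) with hτ
  -- If `‖v‖` is below the target, the starting point `0` already qualifies because `perp v 0 = v`.
  -- Otherwise `v ≠ 0`, so `d > 0`.
  by_cases hsmall : ‖v‖ ≤ τ
  · have : {S : Fin t → Fin m → Vec d × ℝ | (∃ w, IsInitRun a b η S w) ∧
        ∀ w, IsInitRun a b η S w → ∃ s : Fin (t + 1), ‖perp v (w s)‖ ≤ τ}ᶜ = ∅ := by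
      rw [Set.compl_empty_iff, Set.eq_univ_iff_forall]
      intro S
      refine ⟨exists_isInitRun ha hab S, fun w hw => ⟨0, ?_⟩⟩
      rw [hw.1, perp_zero_right]; exact hsmall
    rw [this]; simp
  push Not at hsmall
  have hμ0 : 0 < μ := by rw [hμ]; positivity
  have hτ0 : 0 ≤ τ := le_trans (by positivity) (le_max_left _ _)
  have hv0 : 0 < ‖v‖ := hτ0.trans_lt hsmall
  have hd : 0 < d := by
    rcases Nat.eq_zero_or_pos d with rfl | h
    · exact absurd (Subsingleton.elim v 0) (norm_pos_iff.1 hv0)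
    · exact h
  have hI' : ∀ v : Vec d, ∫ p, (inner ℝ v p.1 : ℝ) ^ 2 ∂D ≤ ‖v‖ ^ 2 := by
    intro v
    have h := hI v
    rwa [Measure.fst, integral_map measurable_fst.aemeasurable
      (Measurable.aestronglyMeasurable (by fun_prop))] at h
  have hy' : MemLp (fun p : Vec d × ℝ => p.2) 2 D :=
    (memLp_two_iff_integrable_sq measurable_snd.aestronglyMeasurable).2 hy
  obtain ⟨ht0, htx, htκ⟩ := lt_floor_mul_decrease ha ha1 hb hL hL1 hR hR1 hμ ht
    (by positivity : 0 < ‖v‖ ^ 2)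
  set κ := μ ^ 6 / (128 * b ^ 6) * ‖v‖ ^ 2 with hκ
  have hκ0 : 0 < κ := by positivity
  set F : Vec d × (Fin m → Vec d × ℝ) → Vec d := fun q => q.1 - η • gradAt a b q with hF
  have hgc := continuous_gradAt (d := d) (m := m) ha hab
  have hFm : Measurable F := Continuous.measurable (by fun_prop)
  -- The conditions on `w` are part of the bad event, so its probability is at most `δ / t` for
  -- every `w`, as the union bound along the trajectory requires.
  set B : Set (Vec d × (Fin m → Vec d × ℝ)) :=
    {q | ‖q.1 - v‖ ≤ ‖v‖ ∧ τ < ‖perp v q.1‖ ∧ ‖q.1 - v‖ ^ 2 - κ < ‖F q - v‖ ^ 2} with hB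
  have hBm : MeasurableSet B := by
    have h1 : Measurable fun q : Vec d × (Fin m → Vec d × ℝ) => ‖q.1 - v‖ := by fun_prop
    have h2 : Measurable fun q : Vec d × (Fin m → Vec d × ℝ) => ‖perp v q.1‖ :=
      ((measurable_perp v).comp measurable_fst).norm
    have h3 : Measurable fun q => ‖F q - v‖ := (hFm.sub measurable_const).norm
    exact (measurableSet_le h1 measurable_const).inter ((measurableSet_lt measurable_const h2).inter
      (measurableSet_lt ((h1.pow_const 2).sub_const κ) (h3.pow_const 2)))
  have hBp : ∀ w, (Measure.pi fun _ : Fin m => D) {S | (w, S) ∈ B} ≤ ENNReal.ofReal (δ / t) := by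
    intro w
    by_cases hw : ‖w - v‖ ≤ ‖v‖ ∧ τ < ‖perp v w‖
    · refine (measure_mono fun S hS => hS.2.2).trans
        (step_deviation hd ha ha1 hb hL hL1 hR hR1 hW hε hδ hD hI' hy' hvW hu hμ hη hm ht0 htx
          hw.1 ((le_max_left _ _).trans_lt hw.2) ((le_max_right _ _).trans_lt hw.2))
    · have : {S : Fin m → Vec d × ℝ | (w, S) ∈ B} = ∅ := by
        ext S
        simp only [Set.mem_ofPred_eq, Set.mem_empty_iff_false, iff_false]
        exact fun hS => hw ⟨hS.1, hS.2.1⟩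
      rw [this]; simp
  have hhit := measure_hitSet_le hFm hBm hBp t 0
  have hδt : (t : ENNReal) * ENNReal.ofReal (δ / t) = ENNReal.ofReal δ := by
    rw [← ENNReal.ofReal_natCast, ← ENNReal.ofReal_mul ht0.le]
    congr 1; field_simp
  rw [hδt] at hhit
  refine (measure_mono ?_).trans hhit
  intro S hS
  by_contra hcon
  refine hS ⟨exists_isInitRun ha hab S, fun w hw => ?_⟩
  by_contra hno
  push Not at hno
  have hstep : ∀ s : Fin t, w s.succ = F (w s.castSucc, S s) := by
    intro s
    obtain ⟨f, hf, hws⟩ := hw.2 s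
    rw [hws, hf.empGrad_eq ha hab]
  have hgood := notMem_of_notMem_hitSet (F := F) (B := B) (S := S) (w := w)
    (by rw [hw.1]; exact hcon) hstep
  have := dist_sq_le_of_notMem hκ0.le hw.1 hstep hno hgood (Fin.last t)
  -- At the last index the squared distance would be at most `‖v‖ ^ 2 - t * κ < 0`.
  rw [Fin.val_last] at this
  linarith [sq_nonneg ‖w (Fin.last t) - v‖]

end RobustSIM

theorem lemma4p1 :
    -- absolute constants
    ∃ C C₁ C₂ : ℝ, 0 < C ∧ 0 < C₁ ∧ 0 < C₂ ∧
    ∀ (d : ℕ) (a b L R W ε δ : ℝ),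
      0 < a → a ≤ 1 → 1 ≤ b → 0 < L → L ≤ 1 → 0 < R → R ≤ 1 → 1 ≤ W → 0 < ε → 0 < δ →
    ∀ (D : Measure (RobustSIM.Vec d × ℝ)) [IsProbabilityMeasure D],
      RobustSIM.WellBehaved L R D.fst →
      (∀ v : RobustSIM.Vec d, ∫ x, (inner ℝ v x : ℝ) ^ 2 ∂D.fst ≤ ‖v‖ ^ 2) →
      Integrable (fun p : RobustSIM.Vec d × ℝ => p.2 ^ 2) D →
    ∀ (wstar : RobustSIM.Vec d) (ustar : ℝ → ℝ),
      ‖wstar‖ ≤ W → ustar ∈ RobustSIM.Activations a b →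
      RobustSIM.sqLoss D wstar ustar = RobustSIM.opt D a b W →
    ∀ (μ η : ℝ) (m₀ t₀ : ℕ),
      μ = C * a ^ 2 * L * R ^ 4 / b →
      η = μ ^ 3 / (2 ^ 7 * b ^ 4) →
      C₁ * (W ^ (9 / 2 : ℝ) * b ^ 10 * d * (max 1 (Real.log (d / (ε * δ)))) ^ 4
        / (L ^ 4 * μ ^ 6 * δ * ε ^ (3 / 2 : ℝ))) ≤ m₀ →
      t₀ = ⌊C₂ * (b ^ 6 * Real.log (b / μ) / μ ^ 6)⌋₊ →
      RobustSIM.batchLaw D t₀ m₀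
        {S | (∃ w, RobustSIM.IsInitRun a b η S w) ∧
          ∀ w, RobustSIM.IsInitRun a b η S w →
            ∃ t : Fin (t₀ + 1),
              ‖RobustSIM.perp wstar (w t)‖ ≤
                max (μ * ‖wstar‖ / (4 * b))
                  (64 * b ^ 2 / μ ^ 3 *
                    (Real.sqrt (RobustSIM.opt D a b W) + Real.sqrt ε))}ᶜ
        ≤ ENNReal.ofReal δ := by
  refine ⟨1 / 34560, 20000000, 256, by norm_num, by norm_num, by norm_num, ?_⟩
  intro d a b L R W ε δ ha ha1 hb hL hL1 hR hR1 hW hε hδ D _ hD hI hy v u hvW hu hopt μ η m t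
    hμ hη hm ht
  rw [← hopt]
  exact RobustSIM.measure_forall_far_le ha ha1 hb hL hL1 hR hR1 hW hε hδ hD hI hy hvW hu hμ hη hm ht
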